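/- Let $d\in\mathbb N$, $d\ge1$, and let $\mathcal F g(\xi)=\int g(x)e^{-2\pi i x\xi}\,dx$. **Spaces.** Let $1<p<\infty$ and $s>1/p$. Let $L\in\mathbb N_0$ with $L+1>s$ and let $\Psi_0,\Psi_1\in C_0^\infty(\mathbb R)$ (complex-valued) be such that, for some $\varepsilon>0$, $|\mathcal F\Psi_0(\xi)|>0$ for $|\xi|<\varepsilon$, $|\mathcal F\Psi_1(\xi)|>0$ for $\varepsilon/2<|\xi|<2\varepsilon$, and $D^\alpha\mathcal F\Psi_1(0)=0$ for $0\le\alpha\le L$. Put $\Psi_j=2^{j-1}\Psi_1(2^{j-1}\,\cdot)$ for $j\in\mathbb N$, and $\Psi_m(x)=\prod_{i=1}^d\Psi_{m_i}(x_i)$ for $m\in\mathbb N_0^d$, $x\in\mathbb R^d$. For $f\in\mathcal S'(\mathbb R^d)$ let $$\|f\|_{\mathbf W^s_p}=\Big\|\Big(\sum_{m\in\mathbb N_0^d}2^{2s|m|_1}|\Psi_m*f|^2\Big)^{1/2}\Big\|_{L_p(\mathbb R^d)},$$ and let $\mathring{\mathbf W}^s_p$ be the space of all $f\in\mathcal S'(\mathbb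 R^d)$ with $\|f\|_{\mathbf W^s_p}<\infty$ and $\operatorname{supp} f\subset[0,1]^d$. **Cubature formula.** Let $\xi_1<\dots<\xi_d$ be the roots of the polynomial $\prod_{j=1}^d(t-2j+1)-1$, which are real and simple, let $\widetilde T=(\xi_i^{j-1})_{i,j=1}^d$, $T_n=(n\det\widetilde T)^{-1/d}\,\widetilde T$ and $$Q_n(f)=\frac1n\sum_{x\in T_n(\mathbb Z^d)\cap[0,1)^d}f(x).$$ **Statement.** Every $f\in\mathring{\mathbf W}^s_p$ is (represented by) a bounded continuous function, which is used to evaluate $Q_n(f)$. Let $$e(Q_n,\mathring{\mathbf W}^s_p)=\sup\Big\{\Big|\int_{[0,1]^d}f(x)\,dx-Q_n(f)\Big| : f\in\mathring{\mathbf W}^s_p,\ \|f\|_{\mathbf W^s_p}\le1\Big\}.$$ Then, with constants independent of $n$: 1. if $s>1/2$, then $e(Q_n,\mathring{\mathbf W}^s_p)\asymp n^{-s}(\log n)^{(d-1)/2}$ for all integers $n\ge2$; 2. if $s<1/2$, then $e(Q_n,\mathring{\mathbf W}^s_p)\lesssim n^{-s}(\log n)^{(d-1)(1-s)}$ for all integers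 $n\ge2$; 3. if $s=1/2$, then $e(Q_n,\mathring{\mathbf W}^s_p)\lesssim n^{-s}(\log n)^{(d-1)/2}\sqrt{\log\log n}$ for all integers $n\ge3$. -/

import Mathlib

open scoped SchwartzMap FourierTransform ContDiff ENNReal BoundedContinuousFunction

noncomputable section

namespace Frolov

/-- The Euclidean space `ℝ^d`. -/
abbrev Space (d : ℕ) : Type := EuclideanSpace ℝ (Fin d)

/-- The closed unit cube `[0,1]^d`. -/
def closedCube (d : ℕ) : Set (Space d) := {x | ∀ i, x i ∈ Set.Icc (0 : ℝ) 1}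

/-- The half-open unit cube `[0,1)^d`. -/
def halfOpenCube (d : ℕ) : Set (Space d) := {x | ∀ i, x i ∈ Set.Ico (0 : ℝ) 1}

/-! ### Function spaces of dominating mixed smoothness through local means -/

/-- A pair `Ψ₀, Ψ₁ ∈ C₀^∞(ℝ)` of kernels of local means: for some `ε > 0`, the Fourier transform
of `Ψ₀` has no zero in `|ξ| < ε`, that of `Ψ₁` has no zero in `ε/2 < |ξ| < 2ε`, and all derivatives
of the latter up to order `L` vanish at the origin. -/
structure LocalMeans (L : ℕ) where
  Ψ₀ : ℝ → ℂ
  Ψ₁ : ℝ → ℂ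
  smooth₀ : ContDiff ℝ ∞ Ψ₀
  smooth₁ : ContDiff ℝ ∞ Ψ₁
  compact₀ : HasCompactSupport Ψ₀
  compact₁ : HasCompactSupport Ψ₁
  ε : ℝ
  ε_pos : 0 < ε
  fourier₀ : ∀ ξ : ℝ, |ξ| < ε → 𝓕 Ψ₀ ξ ≠ 0
  fourier₁ : ∀ ξ : ℝ, ε / 2 < |ξ| → |ξ| < 2 * ε → 𝓕 Ψ₁ ξ ≠ 0
  moments : ∀ α : ℕ, α ≤ L → iteratedDeriv α (𝓕 Ψ₁) 0 = 0

namespace LocalMeans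

variable {L : ℕ} (K : LocalMeans L) {d : ℕ}

/-- The univariate kernels: `Ψ₀`, and `Ψ_j(t) = 2^(j-1) Ψ₁(2^(j-1) t)` for `j ≥ 1`. -/
def kernel : ℕ → ℝ → ℂ
  | 0 => K.Ψ₀
  | j + 1 => fun t => (2 : ℂ) ^ j * K.Ψ₁ ((2 : ℝ) ^ j * t)

/-- The tensorized kernels `Ψ_m(x) = ∏ i, Ψ_{m_i}(x_i)`, `m ∈ ℕ₀^d`. -/
def tensorKernel (m : Fin d → ℕ) (x : Space d) : ℂ := ∏ i, K.kernel (m i) (x i)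

theorem kernel_contDiff (j : ℕ) : ContDiff ℝ ∞ (K.kernel j) := by
  cases j with
  | zero => exact K.smooth₀
  | succ j => exact contDiff_const.mul (K.smooth₁.comp (contDiff_const.mul contDiff_id))

theorem kernel_hasCompactSupport (j : ℕ) : HasCompactSupport (K.kernel j) := by
  cases j with
  | zero => exact K.compact₀
  | succ j =>
    have h : HasCompactSupport fun t : ℝ => K.Ψ₁ ((2 : ℝ) ^ j * t) :=
      K.compact₁.comp_homeomorph (Homeomorph.mulLeft₀ ((2 : ℝ) ^ j) (by positivity))
    exact h.mul_left

theorem tensorKernel_contDiff (m : Fin d → ℕ) :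
    ContDiff ℝ ∞ (K.tensorKernel m : Space d → ℂ) := by
  unfold tensorKernel
  refine contDiff_prod fun i _ => (K.kernel_contDiff (m i)).comp ?_
  fun_prop

theorem tensorKernel_hasCompactSupport (m : Fin d → ℕ) :
    HasCompactSupport (K.tensorKernel m : Space d → ℂ) := by
  have hc : IsCompact (Set.univ.pi fun i : Fin d => tsupport (K.kernel (m i))) :=
    isCompact_univ_pi fun i => K.kernel_hasCompactSupport (m i)
  refine HasCompactSupport.intro
    (hc.image (PiLp.continuous_toLp 2 fun _ : Fin d => ℝ)) fun x hx => ?_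
  by_contra h
  refine hx ⟨x.ofLp, fun i _ => subset_tsupport _ fun hi => h ?_, rfl⟩
  exact Finset.prod_eq_zero (Finset.mem_univ i) hi

/-- The test function `y ↦ Ψ_m(x - y)`. -/
def reflectedTranslate (m : Fin d → ℕ) (x : Space d) : 𝓢(Space d, ℂ) :=
  HasCompactSupport.toSchwartzMap (f := fun y => K.tensorKernel m (x - y))
    ((K.tensorKernel_hasCompactSupport m).comp_homeomorph (Homeomorph.subLeft x))
    ((K.tensorKernel_contDiff m).comp (contDiff_const.sub contDiff_id))

/-- The function `Ψ_m * T`, that is, `(Ψ_m * T)(x) = T(Ψ_m(x - ·))`. -/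
def conv (m : Fin d → ℕ) (T : 𝓢'(Space d, ℂ)) (x : Space d) : ℂ :=
  T (K.reflectedTranslate m x)

/-- The Triebel-Lizorkin norm of dominating mixed smoothness
`‖(∑_m 2^(s|m|₁θ) |Ψ_m * T|^θ)^(1/θ)‖_p`, for `0 < p, θ < ∞`, with values in `[0,∞]`. -/
def triebelLizorkinNorm (s p θ : ℝ) (T : 𝓢'(Space d, ℂ)) : ℝ≥0∞ :=
  (∫⁻ x : Space d, ((∑' m : Fin d → ℕ,
      (ENNReal.ofReal ((2 : ℝ) ^ (s * ∑ i, (m i : ℝ))) * ‖K.conv m T x‖ₑ) ^ θ) ^ (1 / θ)) ^ p)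
    ^ (1 / p)

/-- The Sobolev norm of dominating mixed smoothness, the case `θ = 2` of the Triebel-Lizorkin
norm. -/
def sobolevNorm (s p : ℝ) (T : 𝓢'(Space d, ℂ)) : ℝ≥0∞ := K.triebelLizorkinNorm s p 2 T

/-- The tempered distributions in the mixed Sobolev space of smoothness `s` and integrability `p`
that are supported in the closed unit cube. -/
def sobolevCube (d : ℕ) (s p : ℝ) : Set 𝓢'(Space d, ℂ) :=
  {T | K.sobolevNorm s p T < ⊤ ∧ Distribution.dsupport T ⊆ closedCube d}

end LocalMeans

/-- The tempered distribution `T` is (given by) the bounded continuous function `f`. -/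
def IsRepresentedBy {d : ℕ} (T : 𝓢'(Space d, ℂ)) (f : Space d →ᵇ ℂ) : Prop :=
  ∀ φ : 𝓢(Space d, ℂ), T φ = ∫ x, φ x * f x

/-! ### The cubature formula -/

/-- The polynomial `∏_{j=1}^d (t - 2j + 1) - 1`. -/
def poly (d : ℕ) : Polynomial ℝ :=
  ∏ j ∈ Finset.Icc 1 d, (Polynomial.X - Polynomial.C (2 * (j : ℝ) - 1)) - 1

/-- The `d` (real, simple) roots `ξ_1 < ... < ξ_d` of the polynomial, in increasing order. -/
def root (d : ℕ) (i : Fin d) : ℝ := ((poly d).roots.sort (· ≤ ·)).getD i 0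

/-- The Vandermonde matrix `(ξ_i^(j-1))_{i,j}`. Its determinant is positive, the roots being in
increasing order. -/
def baseMatrix (d : ℕ) : Matrix (Fin d) (Fin d) ℝ := Matrix.vandermonde (root d)

/-- The generator of the lattice, of determinant `1/n`. -/
def generator (d n : ℕ) : Matrix (Fin d) (Fin d) ℝ :=
  ((n : ℝ) * (baseMatrix d).det) ^ (-(1 / (d : ℝ))) • baseMatrix d

/-- The set of all points `T_n k`, `k ∈ ℤ^d`, with `T_n` the generator. -/
def lattice (d n : ℕ) : Set (Space d) :=
  {x | ∃ k : Fin d → ℤ, x = WithLp.toLp 2 ((generator d n).mulVec fun i => (k i : ℝ))}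

/-- The cubature formula `Q_n(f) = (1/n) ∑ f(x)`, the sum being over the finitely many lattice
points `x` in `[0,1)^d`. -/
def cubature (d n : ℕ) (f : Space d → ℂ) : ℂ :=
  1 / (n : ℂ) * ∑ᶠ x ∈ lattice d n ∩ halfOpenCube d, f x

/-- The worst-case error of `Q_n` over the unit ball of a class `W` of tempered distributions with
(quasi-)norm `N`, whose members are evaluated through their continuous representatives. -/
def worstCaseError {d : ℕ} (n : ℕ) (W : Set 𝓢'(Space d, ℂ)) (N : 𝓢'(Space d, ℂ) → ℝ≥0∞) : ℝ≥0∞ :=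
  ⨆ (T : 𝓢'(Space d, ℂ)) (f : Space d →ᵇ ℂ) (_ : T ∈ W) (_ : N T ≤ 1) (_ : IsRepresentedBy T f),
    ‖(∫ x in closedCube d, f x) - cubature d n f‖ₑ

end Frolov

end

/-! The error is analysed through a Calderón-type reproducing formula. Dividing a dyadic partition
of unity on the frequency side by the Fourier transforms of the kernels Ψ_m gives band-limited dual
kernels Λ_m with T = ∑_m Λ_m * (Ψ_m * T). For T supported in the cube and s > 1/p, Hölder's
inequality makes this series of blocks converge absolutely, with decay ∏ (1 + x_i²)⁻¹. This yields
the continuous representative (`exists_isRepresentedBy`) and lets the error be taken termwise: it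
equals ∑_m ∫ (Ψ_m * T)(z) e_m(z) dz, where e_m(z) is the error of the full lattice rule on Λ_m(· -
z) (`hasSum_integral_conv_mul_latticeError`).

Arithmetic enters through admissibility. The polynomial is irreducible over ℤ and has d real roots,
so a nonzero integer polynomial of degree below d has product of values at the roots at least 1 in
modulus. Hence nonzero points x of the lattice satisfy ∏ |x_i| ≥ c/n, and nonzero points y of the
dual lattice satisfy ∏ |y_i| ≥ cn. The dual bound and Poisson summation give e_m = 0 for 2^|m| <
c₀n, because the Fourier transform of Λ_m lives in a box of volume of order 2^|m|
(`exists_latticeError_eq_zero`). The primal bound says that lattice points are separated, so for the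
remaining m the error e_m is at most C 2^|m|/n everywhere and has bounded L_1 norm on a fixed box
(`exists_latticeError_bound`).

For the upper bounds, Cauchy-Schwarz in m and Hölder in z reduce everything to the L_q norm, 1/p +
1/q = 1, of (∑ 2^(-2s|m|) |e_m|²)^(1/2) over |m| ≥ ℓ, where 2^ℓ is of order n (`worstCaseError_le`).
Each term is estimated by interpolating between L_1 and L_∞, and the level ℓ contains at most
(ℓ+1)^(d-1) multi-indices. If s > 1/2, Minkowski's inequality in L_r with r = max(q,2) leaves a
convergent geometric series, so the first level dominates. If s ≤ 1/2, the L_2 bounds no longer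
decay in |m|; they are used only on about log₂ ℓ^(d-1) levels, after which the embedding of ℓ_q in
ℓ_2 takes over, whose bounds decay because s > 1 - 1/q. Balancing the two gives the exponent
(d-1)(1-s), and at s = 1/2 the number of intermediate levels gives the iterated logarithm.

For the lower bound, take 2^M of order n. By admissibility, in every dyadic box of volume 2^(-M), of
whatever shape, one of two opposite corners contains no lattice point. A sum of bumps placed in such
corners vanishes on the lattice and has integral of order M^(d-1). The vanishing moments (L + 1 > s)
make its local means decay away from the matching level, and a Schur test bounds its norm by 2^(sM)
M^((d-1)/2) up to a constant. -/

noncomputable section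

namespace Frolov

/-! ### The number theory of the Frolov polynomial -/

section NumberTheory

open Polynomial

/-- The Frolov polynomial with integer coefficients. -/
def polyInt (d : ℕ) : ℤ[X] := ∏ j ∈ Finset.Icc 1 d, (X - C (2 * (j : ℤ) - 1)) - 1

theorem map_polyInt (d : ℕ) : (polyInt d).map (Int.castRingHom ℝ) = poly d := by
  simp [polyInt, poly, Polynomial.map_prod, Polynomial.map_sub, Polynomial.map_mul,
    Polynomial.map_ofNat, show (C (2 : ℝ)) = 2 from map_ofNat C 2]

theorem natDegree_prod_nodes (d : ℕ) :
    (∏ j ∈ Finset.Icc 1 d, (X - C (2 * (j : ℤ) - 1))).natDegree = d := by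
  rw [natDegree_prod_of_monic _ _ fun j _ => monic_X_sub_C _]
  simp only [natDegree_X_sub_C, Finset.sum_const, Nat.card_Icc, smul_eq_mul, mul_one,
    add_tsub_cancel_right]

theorem degree_prod_nodes (d : ℕ) :
    (∏ j ∈ Finset.Icc 1 d, (X - C (2 * (j : ℤ) - 1))).degree = (d : WithBot ℕ) := by
  rw [degree_eq_natDegree (monic_prod_of_monic _ _ fun j _ => monic_X_sub_C _).ne_zero,
    natDegree_prod_nodes]

theorem monic_polyInt {d : ℕ} (hd : 1 ≤ d) : (polyInt d).Monic := by
  refine (monic_prod_of_monic _ _ fun j _ => monic_X_sub_C _).sub_of_left ?_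
  rw [degree_prod_nodes, degree_one]
  exact_mod_cast hd

theorem natDegree_polyInt {d : ℕ} (hd : 1 ≤ d) : (polyInt d).natDegree = d := by
  unfold polyInt
  rw [natDegree_sub_eq_left_of_natDegree_lt, natDegree_prod_nodes]
  rw [natDegree_prod_nodes, natDegree_one]
  exact hd

theorem eval_polyInt_node {d j : ℕ} (hj : j ∈ Finset.Icc 1 d) :
    (polyInt d).eval (2 * (j : ℤ) - 1) = -1 := by
  rw [polyInt, eval_sub, eval_prod, Finset.prod_eq_zero hj (by simp)]
  simp

/-- A factorization into monic f and g has f g = -1 at the d odd nodes, so f and g take opposite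
values ±1 there and f + g has d zeros. If both factors are nonconstant, f + g has degree below d,
hence f = -g, which is impossible for monic polynomials. -/
theorem irreducible_polyInt {d : ℕ} (hd : 1 ≤ d) : Irreducible (polyInt d) := by
  have hP := monic_polyInt hd
  have h1 : polyInt d ≠ 1 := fun h => by
    have := natDegree_polyInt hd
    rw [h, natDegree_one] at this
    omega
  rw [hP.irreducible_iff_natDegree' ]
  refine ⟨h1, fun f g hf hg hfg hmem => ?_⟩
  rw [Finset.mem_Ioc, natDegree_polyInt hd] at hmem
  have hdeg : f.natDegree + g.natDegree = d := by
    rw [← hf.natDegree_mul hg, hfg, natDegree_polyInt hd]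
  have hsum : f + g = 0 := by
    refine eq_zero_of_natDegree_lt_card_of_eval_eq_zero' (f + g)
      ((Finset.Icc 1 d).image fun j : ℕ => 2 * (j : ℤ) - 1) ?_ ?_
    · intro x hx
      obtain ⟨j, hj, rfl⟩ := Finset.mem_image.1 hx
      have h := eval_polyInt_node hj
      rw [← hfg, eval_mul] at h
      rw [eval_add]
      rcases Int.mul_eq_neg_one_iff_eq_one_or_neg_one.1 h with ⟨h1, h2⟩ | ⟨h1, h2⟩ <;>
        rw [h1, h2] <;> norm_num
    · rw [Finset.card_image_of_injective _ fun a b hab => by simpa using hab]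
      refine (natDegree_add_le f g).trans_lt ?_
      simp only [Nat.card_Icc, add_tsub_cancel_right]
      rw [max_lt_iff]
      omega
  have hfg' : f = -g := eq_neg_of_add_eq_zero_left hsum
  have := hf.leadingCoeff
  rw [hfg', leadingCoeff_neg, hg.leadingCoeff] at this
  norm_num at this

theorem eval_polyInt_two_mul (d : ℕ) (k : ℤ) :
    (polyInt d).eval (2 * k) = ∏ j ∈ Finset.Icc 1 d, (2 * (k - j) + 1) - 1 := by
  rw [polyInt, eval_sub, eval_prod, eval_one]
  congr 1
  refine Finset.prod_congr rfl fun j _ => ?_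
  rw [eval_sub, eval_X, eval_C]
  ring

/-- An irreducible polynomial with an integer root is linear. For d = 1 there is such a root, namely
2. -/
theorem eval_polyInt_ne_zero {d : ℕ} (hd : 2 ≤ d) (k : ℤ) : (polyInt d).eval k ≠ 0 := by
  intro h
  have := degree_eq_one_of_irreducible_of_root (irreducible_polyInt (by omega : 1 ≤ d)) h
  rw [degree_eq_natDegree (monic_polyInt (by omega : 1 ≤ d)).ne_zero,
    natDegree_polyInt (by omega)] at this
  norm_cast at this
  omega

/-- Consecutive even integers up to `2d` separate the roots. -/
theorem eval_poly_mul_eval_poly_neg {d : ℕ} (hd : 2 ≤ d) {k : ℕ} (hk : k < d) :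
    (polyInt d).eval (2 * (k : ℤ)) * (polyInt d).eval (2 * ((k + 1 : ℕ) : ℤ)) < 0 := by
  -- At 2k the product over the nodes is a product of odd integers with d - k negative factors.
  -- Subtracting 1 from this nonzero integer cannot reverse the sign, and the result is nonzero by
  -- irreducibility.
  have key : ∀ k : ℕ, k ≤ d → 0 < (polyInt d).eval (2 * (k : ℤ)) * (-1) ^ (d - k) := by
    intro k hk
    have hne := eval_polyInt_ne_zero hd (2 * (k : ℤ))
    rw [eval_polyInt_two_mul] at hne ⊢
    have hpos : 0 < (∏ j ∈ Finset.Icc 1 d, (2 * ((k : ℤ) - j) + 1)) * (-1) ^ (d - k) := by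
      have hcard : (-1 : ℤ) ^ (d - k) = ∏ j ∈ Finset.Icc 1 d, if k < j then (-1 : ℤ) else 1 := by
        rw [Finset.prod_ite, Finset.prod_const_one, mul_one, Finset.prod_const]
        congr 1
        have : (Finset.Icc 1 d).filter (fun j => k < j) = Finset.Ioc k d := by
          ext j; simp; omega
        rw [this, Nat.card_Ioc]
      rw [hcard, ← Finset.prod_mul_distrib]
      refine Finset.prod_pos fun j _ => ?_
      split_ifs with h <;> omega
    rcases neg_one_pow_eq_or ℤ (d - k) with h | h <;> rw [h] at hpos ⊢ <;> omega
  have h1 := key k hk.le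
  have h2 := key (k + 1) hk
  have e : d - k = (d - (k + 1)) + 1 := by omega
  rw [e, pow_succ] at h1
  rcases neg_one_pow_eq_or ℤ (d - (k + 1)) with h | h <;> rw [h] at h1 h2 <;>
    [exact mul_neg_of_neg_of_pos (by linarith) (by linarith);
     exact mul_neg_of_pos_of_neg (by linarith) (by linarith)]

theorem eval_poly_intCast (d : ℕ) (k : ℤ) : (poly d).eval (k : ℝ) = ((polyInt d).eval k : ℤ) := by
  rw [← map_polyInt, eval_intCast_map]
  simp

theorem monic_poly {d : ℕ} (hd : 1 ≤ d) : (poly d).Monic := by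
  rw [← map_polyInt]; exact (monic_polyInt hd).map _

theorem natDegree_poly {d : ℕ} (hd : 1 ≤ d) : (poly d).natDegree = d := by
  rw [← map_polyInt, (monic_polyInt hd).natDegree_map, natDegree_polyInt hd]

theorem exists_root_poly {d : ℕ} (hd : 2 ≤ d) {k : ℕ} (hk : k < d) :
    ∃ x ∈ Set.Ioo (2 * (k : ℝ)) (2 * (k + 1)), (poly d).eval x = 0 := by
  have h := eval_poly_mul_eval_poly_neg hd hk
  have h' : (poly d).eval (2 * (k : ℝ)) * (poly d).eval (2 * ((k : ℝ) + 1)) < 0 := by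
    have e1 := eval_poly_intCast d (2 * (k : ℤ))
    have e2 := eval_poly_intCast d (2 * ((k + 1 : ℕ) : ℤ))
    push_cast at e1 e2
    rw [e1, e2]
    exact_mod_cast h
  have hcont : ContinuousOn (fun x => (poly d).eval x) (Set.Icc (2 * (k : ℝ)) (2 * (k + 1))) :=
    (poly d).continuous.continuousOn
  have hle : 2 * (k : ℝ) ≤ 2 * (k + 1) := by linarith
  rcases mul_neg_iff.1 h' with ⟨h1, h2⟩ | ⟨h1, h2⟩
  · obtain ⟨x, hx, hx0⟩ := intermediate_value_Ioo' hle hcont ⟨h2, h1⟩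
    exact ⟨x, hx, hx0⟩
  · obtain ⟨x, hx, hx0⟩ := intermediate_value_Ioo hle hcont ⟨h1, h2⟩
    exact ⟨x, hx, hx0⟩

theorem exists_injective_roots {d : ℕ} (hd : 1 ≤ d) :
    ∃ r : Fin d → ℝ, Function.Injective r ∧ ∀ i, (poly d).eval (r i) = 0 := by
  rcases hd.eq_or_lt with rfl | hd2
  -- For d = 1 the root is the even integer 2 itself, so the sign-change argument does not apply.
  · refine ⟨fun _ => 2, fun a b _ => Subsingleton.elim a b, fun _ => ?_⟩
    norm_num [poly]
  · choose r hr hr0 using fun i : Fin d => exists_root_poly hd2 i.2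
    refine ⟨r, StrictMono.injective fun i j hij => ?_, hr0⟩
    have : ((i : ℕ) : ℝ) + 1 ≤ (j : ℕ) := by exact_mod_cast hij
    linarith [(hr i).2, (hr j).1]

theorem roots_poly {d : ℕ} (hd : 1 ≤ d) :
    (poly d).roots.Nodup ∧ Multiset.card (poly d).roots = d := by
  obtain ⟨r, hr, h0⟩ := exists_injective_roots hd
  have hne := (monic_poly hd).ne_zero
  have hle : (Finset.univ.image r).val ≤ (poly d).roots := by
    rw [Multiset.le_iff_subset (Finset.nodup _)]
    intro x hx
    obtain ⟨i, -, rfl⟩ := Finset.mem_image.1 (show x ∈ Finset.univ.image r from hx)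
    exact (mem_roots hne).2 (h0 i)
  have hc : (Finset.univ.image r).val.card = d := by
    rw [Finset.card_val, Finset.card_image_of_injective _ hr, Finset.card_fin]
  have hc' : Multiset.card (poly d).roots ≤ d := (card_roots' (poly d)).trans_eq (natDegree_poly hd)
  have heq := Multiset.eq_of_le_of_card_le hle (hc'.trans hc.ge)
  rw [← heq]
  exact ⟨Finset.nodup _, hc⟩

theorem root_mem {d : ℕ} (hd : 1 ≤ d) (i : Fin d) : (poly d).eval (root d i) = 0 := by
  -- The sorted list has exactly d entries, so the default value in `root` is never used.
  have hi : (i : ℕ) < ((poly d).roots.sort (· ≤ ·)).length := by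
    rw [Multiset.length_sort, (roots_poly hd).2]; exact i.2
  have : root d i ∈ (poly d).roots := by
    rw [← Multiset.mem_sort (r := (· ≤ ·)), root, List.getD_eq_getElem _ _ hi]
    exact List.getElem_mem hi
  exact (mem_roots'.1 this).2

theorem strictMono_root {d : ℕ} (hd : 1 ≤ d) : StrictMono (root d) := by
  intro i j hij
  have hlen : ((poly d).roots.sort (· ≤ ·)).length = d := by
    rw [Multiset.length_sort, (roots_poly hd).2]
  have hnd : ((poly d).roots.sort (· ≤ ·)).Nodup := by
    rw [← Multiset.coe_nodup, Multiset.sort_eq]; exact (roots_poly hd).1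
  have hs := Multiset.pairwise_sort (poly d).roots (· ≤ ·)
  have hi : (i : ℕ) < ((poly d).roots.sort (· ≤ ·)).length := i.2.trans_eq hlen.symm
  have hj : (j : ℕ) < ((poly d).roots.sort (· ≤ ·)).length := j.2.trans_eq hlen.symm
  rw [root, root, List.getD_eq_getElem _ _ hi, List.getD_eq_getElem _ _ hj]
  refine lt_of_le_of_ne (List.pairwise_iff_getElem.1 hs _ _ hi hj hij) fun h => ?_
  exact hij.ne (Fin.ext (hnd.getElem_inj_iff.1 h))

theorem det_baseMatrix_pos {d : ℕ} (hd : 1 ≤ d) : 0 < (baseMatrix d).det := by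
  rw [baseMatrix, Matrix.det_vandermonde]
  exact Finset.prod_pos fun i _ => Finset.prod_pos fun j hj =>
    sub_pos.2 (strictMono_root hd (Finset.mem_Ioi.1 hj))

theorem aeval_root_polyInt {d : ℕ} (hd : 1 ≤ d) (i : Fin d) : aeval (root d i) (polyInt d) = 0 := by
  rw [aeval_def, algebraMap_int_eq, ← eval_map, map_polyInt, root_mem hd]

/-- By irreducibility the polynomial is, up to a unit, the minimal polynomial over ℤ of each of its
roots; it cannot divide a nonzero polynomial of smaller degree. -/
theorem aeval_root_ne_zero {d : ℕ} (hd : 1 ≤ d) {q : ℤ[X]} (hq : q ≠ 0) (hdeg : q.natDegree < d)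
    (i : Fin d) : aeval (root d i) q ≠ 0 := by
  intro h
  have hint : IsIntegral ℤ (root d i) := ⟨polyInt d, monic_polyInt hd, aeval_root_polyInt hd i⟩
  have h1 : minpoly ℤ (root d i) ∣ polyInt d :=
    minpoly.isIntegrallyClosed_dvd hint (aeval_root_polyInt hd i)
  have h2 : minpoly ℤ (root d i) ∣ q := minpoly.isIntegrallyClosed_dvd hint h
  have h3 : Associated (minpoly ℤ (root d i)) (polyInt d) :=
    ((irreducible_polyInt hd).dvd_iff.1 h1).resolve_left (minpoly.not_isUnit ℤ _) |>.symm
  have := natDegree_le_of_dvd (h3.symm.dvd.trans h2) hq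
  rw [natDegree_polyInt hd] at this
  omega

/-- The norm of a nonzero integer polynomial at the roots is at least one in absolute value. -/
theorem one_le_prod_abs_aeval_root {d : ℕ} (hd : 1 ≤ d) {q : ℤ[X]} (hq : q ≠ 0)
    (hdeg : q.natDegree < d) : 1 ≤ ∏ i, |aeval (root d i) q| := by
  -- M is multiplication by q on ℤ[X] modulo the polynomial, in the basis of powers. The Vandermonde
  -- matrix diagonalizes it, with the values of q at the roots as eigenvalues, so the product of
  -- these values is the nonzero integer det M.
  let M : Matrix (Fin d) (Fin d) ℤ := fun i j => ((q * X ^ (j : ℕ)) %ₘ polyInt d).coeff i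
  have hM : baseMatrix d * M.map (Int.cast : ℤ → ℝ) =
      Matrix.diagonal (fun i => aeval (root d i) q) * baseMatrix d := by
    ext i j
    rw [Matrix.diagonal_mul, Matrix.mul_apply]
    have h1 : aeval (root d i) ((q * X ^ (j : ℕ)) %ₘ polyInt d) =
        aeval (root d i) q * root d i ^ (j : ℕ) := by
      rw [aeval_modByMonic_eq_self_of_root (aeval_root_polyInt hd i)]
      simp
    have h2 : ((q * X ^ (j : ℕ)) %ₘ polyInt d).natDegree < d := by
      have hP := monic_polyInt hd
      have := natDegree_modByMonic_lt (q * X ^ (j : ℕ)) hP (fun h => by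
        have := natDegree_polyInt hd
        rw [h, natDegree_one] at this
        omega)
      rwa [natDegree_polyInt hd] at this
    rw [aeval_eq_sum_range' h2, ← Fin.sum_univ_eq_sum_range
      (fun k => ((q * X ^ (j : ℕ)) %ₘ polyInt d).coeff k • root d i ^ k)] at h1
    simp only [baseMatrix, Matrix.vandermonde_apply, M]
    rw [← h1]
    refine Finset.sum_congr rfl fun k _ => ?_
    rw [zsmul_eq_mul, mul_comm]
    rfl
  have hdet : ((M.det : ℤ) : ℝ) = ∏ i, aeval (root d i) q := by
    have := congrArg Matrix.det hM
    rw [Matrix.det_mul, Matrix.det_mul, Matrix.det_diagonal, mul_comm] at this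
    have h3 := mul_right_cancel₀ (det_baseMatrix_pos hd).ne' this
    rw [← h3]
    exact (Int.cast_det M)
  have hne : M.det ≠ 0 := by
    intro h
    rw [h, Int.cast_zero] at hdet
    exact (Finset.prod_ne_zero_iff.2 fun i _ => aeval_root_ne_zero hd hq hdeg i) hdet.symm
  rw [← Finset.abs_prod, ← hdet]
  exact_mod_cast Int.one_le_abs hne

/-- The coordinates of the lattice vector are the values at the roots of the integer polynomial with
coefficients k, so the norm bound applies. -/
theorem one_le_prod_abs_baseMatrix_mulVec {d : ℕ} (hd : 1 ≤ d) {k : Fin d → ℤ} (hk : k ≠ 0) :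
    1 ≤ ∏ i, |(baseMatrix d).mulVec (fun j => (k j : ℝ)) i| := by
  let q : ℤ[X] := ∑ j : Fin d, C (k j) * X ^ (j : ℕ)
  have hcoeff : ∀ j : Fin d, q.coeff j = k j := by
    intro j
    simp [q, coeff_X_pow, Fin.val_inj]
  have hq : q ≠ 0 := by
    rintro h
    refine hk (funext fun j => ?_)
    rw [← hcoeff, h]; simp
  have hdeg : q.natDegree < d := by
    refine (natDegree_sum_le_of_forall_le (n := d - 1) _ _ fun j _ => ?_).trans_lt (by omega)
    exact (natDegree_C_mul_X_pow_le _ _).trans (by omega)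
  convert one_le_prod_abs_aeval_root hd hq hdeg using 3 with i
  simp [q, Matrix.mulVec, dotProduct, baseMatrix, mul_comm]

/-- The sum is the difference quotient (P(x) - P(y))/(x - y) written out in powers. At two distinct
roots it is zero, on the diagonal it is the derivative. This is Euler's description of the dual
basis of the power basis and gives access to the dual lattice. -/
theorem sum_coeff_mul_geom {d : ℕ} (hd : 1 ≤ d) (i k : Fin d) :
    ∑ a ∈ Finset.range (d + 1), ((polyInt d).coeff a : ℝ) *
      ∑ j ∈ Finset.range a, root d i ^ j * root d k ^ (a - 1 - j) =
    if i = k then aeval (root d k) (derivative (polyInt d)) else 0 := by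
  have hdeg : (polyInt d).natDegree < d + 1 := by rw [natDegree_polyInt hd]; omega
  split_ifs with h
  · subst h
    rw [aeval_eq_sum_range' (n := d) ((natDegree_derivative_lt
      (by rw [natDegree_polyInt hd]; omega)).trans_eq (natDegree_polyInt hd)),
      Finset.sum_range_succ']
    simp only [Finset.range_zero, Finset.sum_empty, mul_zero, add_zero]
    refine Finset.sum_congr rfl fun a _ => ?_
    rw [Finset.sum_congr rfl (g := fun _ => root d i ^ a) fun j hj => by
      rw [← pow_add]; congr 1; have := Finset.mem_range.1 hj; omega]
    rw [coeff_derivative, Finset.sum_const, Finset.card_range, zsmul_eq_mul, nsmul_eq_mul]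
    push_cast
    ring
  · have hne : root d i - root d k ≠ 0 :=
      sub_ne_zero.2 fun e => h ((strictMono_root hd).injective e)
    refine (mul_eq_zero.1 ?_).resolve_right hne
    rw [Finset.sum_mul]
    have e : ∀ a ∈ Finset.range (d + 1), ((polyInt d).coeff a : ℝ) *
        (∑ j ∈ Finset.range a, root d i ^ j * root d k ^ (a - 1 - j)) * (root d i - root d k) =
        (polyInt d).coeff a • root d i ^ a - (polyInt d).coeff a • root d k ^ a := by
      intro a _
      rw [mul_assoc, (Commute.all (root d i) (root d k)).geom_sum₂_mul, zsmul_eq_mul, zsmul_eq_mul]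
      ring
    rw [Finset.sum_congr rfl e, Finset.sum_sub_distrib, ← aeval_eq_sum_range' hdeg,
      ← aeval_eq_sum_range' hdeg, aeval_root_polyInt hd, aeval_root_polyInt hd, sub_zero]

/-- The dual lattice of the Vandermonde lattice is bounded away from the coordinate planes. -/
theorem exists_le_prod_abs_of_transpose_mulVec {d : ℕ} (hd : 1 ≤ d) :
    ∃ c : ℝ, 0 < c ∧ ∀ y : Fin d → ℝ, y ≠ 0 → (∃ k : Fin d → ℤ,
      (baseMatrix d).transpose.mulVec y = fun j => (k j : ℝ)) → c ≤ ∏ i, |y i| := by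
  set Δ : ℝ := ∏ i, |aeval (root d i) (derivative (polyInt d))| with hΔ
  have hΔ0 : 0 ≤ Δ := Finset.prod_nonneg fun i _ => abs_nonneg _
  refine ⟨1 / (Δ + 1), by positivity, fun y hy ⟨m, hm⟩ => ?_⟩
  -- Extension of m by zero; only the indices below d occur in what follows.
  let m' : ℕ → ℤ := fun j => if h : j < d then m ⟨j, h⟩ else 0
  have hm' : ∀ j < d, ((m' j : ℤ) : ℝ) = ∑ i, root d i ^ j * y i := by
    intro j hj
    have := congrFun hm ⟨j, hj⟩
    simp only [Matrix.mulVec, dotProduct, Matrix.transpose_apply, baseMatrix,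
      Matrix.vandermonde_apply] at this
    simp only [m', hj, dif_pos, ← this]
  -- This integer polynomial takes the value P'(ξ_k) y_k at ξ_k, by Euler's identity. Its norm is at
  -- least 1, so ∏ |y_k| is at least 1/∏ |P'(ξ_k)|; the summand 1 in the chosen constant only spares
  -- a proof that the denominator is positive.
  let q : ℤ[X] := ∑ a ∈ Finset.range (d + 1), C ((polyInt d).coeff a) *
    ∑ j ∈ Finset.range a, C (m' j) * X ^ (a - 1 - j)
  have hdeg : q.natDegree < d := by
    refine (natDegree_sum_le_of_forall_le (n := d - 1) _ _ fun a ha => ?_).trans_lt (by omega)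
    refine (natDegree_C_mul_le _ _).trans
      (natDegree_sum_le_of_forall_le (n := d - 1) _ _ fun j hj => ?_)
    have := Finset.mem_range.1 ha
    exact (natDegree_C_mul_X_pow_le _ _).trans (by omega)
  have hq : ∀ k, aeval (root d k) q = aeval (root d k) (derivative (polyInt d)) * y k := by
    intro k
    have e : aeval (root d k) q = ∑ i, y i * ∑ a ∈ Finset.range (d + 1),
        ((polyInt d).coeff a : ℝ) *
          ∑ j ∈ Finset.range a, root d i ^ j * root d k ^ (a - 1 - j) := by
      simp only [q, map_sum, map_mul, map_pow, aeval_X, eq_intCast, map_intCast]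
      simp only [Finset.mul_sum]
      rw [Finset.sum_comm]
      refine Finset.sum_congr rfl fun a ha => ?_
      rw [Finset.sum_comm]
      refine Finset.sum_congr rfl fun j hj => ?_
      rw [hm' j (by have := Finset.mem_range.1 ha; have := Finset.mem_range.1 hj; omega),
        Finset.sum_mul, Finset.mul_sum]
      exact Finset.sum_congr rfl fun i _ => by ring
    rw [e, Finset.sum_congr rfl fun i _ => by rw [sum_coeff_mul_geom hd i k]]
    simp [mul_comm]
  have hder : derivative (polyInt d) ≠ 0 := by
    intro h
    have := derivative_eq_zero.1 h
    rw [natDegree_polyInt hd] at this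
    omega
  have hderdeg : (derivative (polyInt d)).natDegree < d :=
    (natDegree_derivative_lt (by rw [natDegree_polyInt hd]; omega)).trans_eq (natDegree_polyInt hd)
  have hq0 : q ≠ 0 := by
    obtain ⟨k, hk⟩ := Function.ne_iff.1 hy
    intro h
    have := hq k
    rw [h, map_zero] at this
    exact mul_ne_zero (aeval_root_ne_zero hd hder hderdeg k) hk this.symm
  have h1 := one_le_prod_abs_aeval_root hd hq0 hdeg
  simp only [hq, abs_mul, Finset.prod_mul_distrib] at h1
  rw [← hΔ] at h1
  rw [div_le_iff₀ (by positivity)]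
  have : 0 ≤ ∏ i, |y i| := Finset.prod_nonneg fun i _ => abs_nonneg _
  nlinarith

theorem generator_scale_pow {d n : ℕ} (hd : 1 ≤ d) (hn : 1 ≤ n) :
    (((n : ℝ) * (baseMatrix d).det) ^ (-(1 / (d : ℝ)))) ^ d = ((n : ℝ) * (baseMatrix d).det)⁻¹ := by
  have h0 : 0 < (n : ℝ) * (baseMatrix d).det :=
    mul_pos (by exact_mod_cast hn) (det_baseMatrix_pos hd)
  rw [← Real.rpow_natCast, ← Real.rpow_mul h0.le, ← Real.rpow_neg_one]
  congr 1
  have : (d : ℝ) ≠ 0 := by positivity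
  field_simp

theorem det_generator {d n : ℕ} (hd : 1 ≤ d) (hn : 1 ≤ n) :
    (generator d n).det = (n : ℝ)⁻¹ := by
  have := (det_baseMatrix_pos hd).ne'
  rw [generator, Matrix.det_smul, Fintype.card_fin, generator_scale_pow hd hn]
  field_simp

/-- The Frolov lattices are admissible. -/
theorem exists_div_le_prod_abs_generator_mulVec {d : ℕ} (hd : 1 ≤ d) :
    ∃ c : ℝ, 0 < c ∧ ∀ n : ℕ, 1 ≤ n → ∀ k : Fin d → ℤ, k ≠ 0 →
      c / n ≤ ∏ i, |(generator d n).mulVec (fun j => (k j : ℝ)) i| := by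
  have hdet := det_baseMatrix_pos hd
  refine ⟨((baseMatrix d).det)⁻¹, inv_pos.2 hdet, fun n hn k hk => ?_⟩
  have hn0 : (0 : ℝ) < n := by exact_mod_cast hn
  simp only [generator, Matrix.smul_mulVec, Pi.smul_apply, smul_eq_mul, abs_mul,
    Finset.prod_mul_distrib, Finset.prod_const, Finset.card_fin]
  rw [abs_of_nonneg (by positivity), generator_scale_pow hd hn, mul_inv, div_eq_inv_mul]
  exact le_mul_of_one_le_right (by positivity) (one_le_prod_abs_baseMatrix_mulVec hd hk)

/-- The duals of the Frolov lattices are admissible. -/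
theorem exists_mul_le_prod_abs_of_generator_transpose_mulVec {d : ℕ} (hd : 1 ≤ d) :
    ∃ c : ℝ, 0 < c ∧ ∀ n : ℕ, 1 ≤ n → ∀ y : Fin d → ℝ, y ≠ 0 → (∃ k : Fin d → ℤ,
      (generator d n).transpose.mulVec y = fun j => (k j : ℝ)) → c * n ≤ ∏ i, |y i| := by
  have hdet := det_baseMatrix_pos hd
  obtain ⟨c, hc, h⟩ := exists_le_prod_abs_of_transpose_mulVec hd
  refine ⟨c * (baseMatrix d).det, mul_pos hc hdet, fun n hn y hy ⟨k, hk⟩ => ?_⟩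
  have hn0 : (0 : ℝ) < n := by exact_mod_cast hn
  set a := ((n : ℝ) * (baseMatrix d).det) ^ (-(1 / (d : ℝ))) with ha
  have ha0 : 0 < a := by positivity
  have h1 := h (a • y) (smul_ne_zero ha0.ne' hy) ⟨k, by
    rw [← hk, generator, Matrix.transpose_smul, Matrix.smul_mulVec, Matrix.mulVec_smul]⟩
  simp only [Pi.smul_apply, smul_eq_mul, abs_mul, Finset.prod_mul_distrib, Finset.prod_const,
    Finset.card_fin] at h1
  rw [abs_of_pos ha0, generator_scale_pow hd hn, inv_mul_eq_div, le_div_iff₀ (by positivity)] at h1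
  linarith

end NumberTheory

end Frolov

end

noncomputable section

namespace Frolov

/-! ### Sums and integrals of product functions -/

section Products

open MeasureTheory

theorem tsum_fin_prod_eq_prod_tsum {α : Type*} {d : ℕ} (f : Fin d → α → ℝ≥0∞) :
    ∑' k : Fin d → α, ∏ i, f i (k i) = ∏ i, ∑' a, f i a := by
  induction d with
  | zero => simp
  | succ d ih =>
    rw [← (Fin.consEquiv fun _ : Fin (d + 1) => α).tsum_eq, ENNReal.tsum_prod', Fin.prod_univ_succ,
      ← ih, ← ENNReal.tsum_mul_right]
    refine tsum_congr fun a => ?_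
    rw [← ENNReal.tsum_mul_left]
    refine tsum_congr fun k => ?_
    rw [Fin.prod_univ_succ]
    simp [Fin.consEquiv]

theorem lintegral_fin_prod_eq_prod_lintegral {d : ℕ} (f : Fin d → ℝ → ℝ≥0∞)
    (hf : ∀ i, Measurable (f i)) :
    ∫⁻ x : Fin d → ℝ, ∏ i, f i (x i) = ∏ i, ∫⁻ t, f i t := by
  induction d with
  | zero => simp [volume_pi]
  | succ d ih =>
    have hm : Measurable fun x : Fin d → ℝ => ∏ i, f i.succ (x i) :=
      Finset.measurable_prod _ fun i _ => (hf i.succ).comp (measurable_pi_apply i)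
    have e := (volume_preserving_piFinSuccAbove (fun _ : Fin (d + 1) => ℝ) 0).symm
    rw [← e.lintegral_comp_emb (MeasurableEquiv.measurableEmbedding _), Fin.prod_univ_succ,
      ← ih (fun i => f i.succ) fun i => hf i.succ, ← lintegral_prod_mul (hf 0).aemeasurable
        hm.aemeasurable]
    refine lintegral_congr fun x => ?_
    rw [Fin.prod_univ_succ]
    rfl

theorem integral_space {d : ℕ} {E : Type*} [NormedAddCommGroup E] [NormedSpace ℝ E]
    (f : Space d → E) : ∫ x, f x = ∫ u : Fin d → ℝ, f (WithLp.toLp 2 u) :=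
  ((PiLp.volume_preserving_toLp (Fin d)).integral_comp
    (MeasurableEquiv.toLp 2 (Fin d → ℝ)).measurableEmbedding f).symm

theorem lintegral_space {d : ℕ} (f : Space d → ℝ≥0∞) :
    ∫⁻ x, f x = ∫⁻ u : Fin d → ℝ, f (WithLp.toLp 2 u) :=
  ((PiLp.volume_preserving_toLp (Fin d)).lintegral_comp_emb
    (MeasurableEquiv.toLp 2 (Fin d → ℝ)).measurableEmbedding f).symm

theorem integral_space_prod {d : ℕ} (f : Fin d → ℝ → ℂ) :
    ∫ x : Space d, ∏ i, f i (x i) = ∏ i, ∫ t, f i t := by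
  rw [integral_space]
  exact integral_fintype_prod_volume_eq_prod f

theorem lintegral_space_prod {d : ℕ} (f : Fin d → ℝ → ℝ≥0∞) (hf : ∀ i, Measurable (f i)) :
    ∫⁻ x : Space d, ∏ i, f i (x i) = ∏ i, ∫⁻ t, f i t := by
  rw [lintegral_space]
  exact lintegral_fin_prod_eq_prod_lintegral f hf

end Products

/-! ### The weight `∏ (1 + x_i²)` -/

section Weight

/-- The tensor weight `∏ (1 + u_i²)`. -/
def weight {d : ℕ} (u : Fin d → ℝ) : ℝ := ∏ i, (1 + u i ^ 2)

variable {d : ℕ}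

theorem weight_pos (u : Fin d → ℝ) : 0 < weight u := Finset.prod_pos fun i _ => by positivity

theorem one_le_weight (u : Fin d → ℝ) : 1 ≤ weight u :=
  Finset.one_le_prod (fun i _ => by nlinarith [sq_nonneg (u i)])

/-- Peetre's inequality 1 + (a + b)² ≤ 2 (1 + a²)(1 + b²) in each coordinate. It is what makes the
weight usable under translations. -/
theorem weight_add_le (u v : Fin d → ℝ) : weight (u + v) ≤ 2 ^ d * weight u * weight v := by
  have h : (2 : ℝ) ^ d = ∏ _i : Fin d, (2 : ℝ) := by simp
  rw [weight, weight, weight, h, ← Finset.prod_mul_distrib, ← Finset.prod_mul_distrib]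
  refine Finset.prod_le_prod (fun i _ => by positivity) fun i _ => ?_
  simp only [Pi.add_apply]
  nlinarith [sq_nonneg (u i - v i), sq_nonneg (u i * v i)]

theorem weight_neg (u : Fin d → ℝ) : weight (-u) = weight u := by simp [weight]

theorem continuous_weight : Continuous (weight : (Fin d → ℝ) → ℝ) := by
  unfold weight; fun_prop

theorem integrable_inv_weight : MeasureTheory.Integrable fun u : Fin d → ℝ => (weight u)⁻¹ := by
  simp only [weight, ← Finset.prod_inv_distrib]
  exact MeasureTheory.Integrable.fintype_prod fun i => integrable_inv_one_add_sq

theorem summable_inv_one_add_sq_int : Summable fun k : ℤ => (1 + (k : ℝ) ^ 2)⁻¹ := by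
  have h : Summable fun k : ℤ => 1 / (k : ℝ) ^ 2 := by
    simpa using Real.summable_one_div_int_pow.2 (by norm_num : 1 < 2)
  have h2 := h.add (summable_of_hasFiniteSupport (f := fun k : ℤ => if k = 0 then (1 : ℝ) else 0)
    ((Set.finite_singleton 0).subset fun k hk => by
      by_contra hne; simp at hne; simp [hne] at hk))
  refine h2.of_nonneg_of_le (fun k => by positivity) fun k => ?_
  by_cases hk : k = 0
  · simp [hk]
  · have : (0 : ℝ) < (k : ℝ) ^ 2 := by positivity
    simp only [hk, if_false, add_zero, ← one_div]
    exact one_div_le_one_div_of_le this (by linarith)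

theorem summable_inv_weight_int : Summable fun k : Fin d → ℤ => (weight fun i => (k i : ℝ))⁻¹ := by
  have h : ∑' k : Fin d → ℤ, ENNReal.ofReal ((weight fun i => (k i : ℝ))⁻¹) ≠ ⊤ := by
    have e : ∀ k : Fin d → ℤ, ENNReal.ofReal ((weight fun i => (k i : ℝ))⁻¹) =
        ∏ i, ENNReal.ofReal ((1 + (k i : ℝ) ^ 2)⁻¹) := fun k => by
      rw [weight, ← Finset.prod_inv_distrib,
        ENNReal.ofReal_prod_of_nonneg fun i _ => by positivity]
    simp_rw [e]
    rw [tsum_fin_prod_eq_prod_tsum fun (_ : Fin d) (k : ℤ) => ENNReal.ofReal ((1 + (k : ℝ) ^ 2)⁻¹)]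
    exact ENNReal.prod_ne_top fun i _ =>
      ENNReal.ofReal_tsum_of_nonneg (fun k => by positivity) summable_inv_one_add_sq_int ▸
        ENNReal.ofReal_ne_top
  exact (ENNReal.summable_toReal h).congr fun k =>
    ENNReal.toReal_ofReal (inv_nonneg.2 (weight_pos _).le)

end Weight

/-! ### Poisson summation -/

section Poisson

open MeasureTheory Filter Topology

variable {d : ℕ}

/-- The half-open unit cubes with integral corners. -/
def unitBox (k : Fin d → ℤ) : Set (Fin d → ℝ) := {u | ∀ i, u i ∈ Set.Ioc (k i : ℝ) (k i + 1)}

theorem measurableSet_unitBox (k : Fin d → ℤ) : MeasurableSet (unitBox k) :=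
  MeasurableSet.univ_pi' fun _ => measurableSet_Ioc

theorem iUnion_unitBox : ⋃ k, unitBox (d := d) k = Set.univ := by
  refine Set.eq_univ_of_forall fun u => Set.mem_iUnion.2 ⟨fun i => ⌈u i⌉ - 1, fun i => ?_⟩
  push_cast
  exact ⟨by linarith [Int.ceil_lt_add_one (u i)], by linarith [Int.le_ceil (u i)]⟩

theorem pairwise_disjoint_unitBox :
    Pairwise (Function.onFun Disjoint (unitBox : (Fin d → ℤ) → Set (Fin d → ℝ))) := by
  intro k l hkl
  rw [Function.onFun, Set.disjoint_left]
  intro u hk hl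
  refine hkl (funext fun i => ?_)
  have h1 := hk i
  have h2 := hl i
  have a : (k i : ℝ) < l i + 1 := h1.1.trans_le h2.2
  have b : (l i : ℝ) < k i + 1 := h2.1.trans_le h1.2
  have a' : k i < l i + 1 := by exact_mod_cast a
  have b' : l i < k i + 1 := by exact_mod_cast b
  omega

theorem setIntegral_unitBox {E : Type*} [NormedAddCommGroup E] [NormedSpace ℝ E]
    (F : (Fin d → ℝ) → E) (k : Fin d → ℤ) :
    ∫ u in unitBox k, F u = ∫ u in unitBox 0, F (u + fun i => (k i : ℝ)) := by
  have h := measurePreserving_add_right (volume : Measure (Fin d → ℝ)) fun i => (k i : ℝ)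
  rw [← h.setIntegral_preimage_emb (measurableEmbedding_addRight _)]
  congr 2
  ext u
  change (∀ i, u i + (k i : ℝ) ∈ Set.Ioc (k i : ℝ) (k i + 1)) ↔
    ∀ i, u i ∈ Set.Ioc ((0 : ℤ) : ℝ) ((0 : ℤ) + 1)
  rw [Int.cast_zero]
  exact forall_congr' fun i => ⟨fun h => ⟨by linarith [h.1], by linarith [h.2]⟩,
    fun h => ⟨by linarith [h.1], by linarith [h.2]⟩⟩

theorem hasSum_setIntegral_unitBox {E : Type*} [NormedAddCommGroup E] [NormedSpace ℝ E]
    [CompleteSpace E] {F : (Fin d → ℝ) → E} (hF : Integrable F) :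
    HasSum (fun k : Fin d → ℤ => ∫ u in unitBox 0, F (u + fun i => (k i : ℝ))) (∫ u, F u) := by
  have := hasSum_integral_iUnion (fun k => measurableSet_unitBox (d := d) k)
    pairwise_disjoint_unitBox (hF.integrableOn)
  rw [iUnion_unitBox, Measure.restrict_univ] at this
  exact (funext fun k => setIntegral_unitBox F k : (fun k : Fin d → ℤ => ∫ u in unitBox k, F u) = _) ▸ this

/-- The canonical projection onto the torus. -/
def toTorus (u : Fin d → ℝ) : UnitAddTorus (Fin d) := fun i => (u i : UnitAddCircle)

theorem isOpenQuotientMap_toTorus : IsOpenQuotientMap (toTorus (d := d)) :=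
  IsOpenQuotientMap.piMap fun _ => QuotientAddGroup.isOpenQuotientMap_mk

theorem mFourier_toTorus (k : Fin d → ℤ) (u : Fin d → ℝ) :
    UnitAddTorus.mFourier k (toTorus u) = ((Real.fourierChar (∑ i, (k i : ℝ) * u i) : Circle) : ℂ) := by
  have h : UnitAddTorus.mFourier k (toTorus u) =
      ∏ i, Complex.exp (2 * Real.pi * Complex.I * k i * u i / (1 : ℝ)) := by
    change ∏ i, fourier (k i) ((u i : ℝ) : UnitAddCircle) = _
    exact Finset.prod_congr rfl fun i _ => fourier_coe_apply
  rw [h, Real.fourierChar_apply, ← Complex.exp_sum]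
  congr 1
  push_cast
  rw [Finset.mul_sum, Finset.sum_mul]
  exact Finset.sum_congr rfl fun i _ => by simp; ring

/-- Peetre's inequality for k = (u + k) - u turns decay in u + k into decay in k, locally uniformly
in u. This dominates the periodization. -/
theorem norm_add_int_le {F : (Fin d → ℝ) → ℂ} {C : ℝ} (hC : ∀ u, ‖F u‖ ≤ C * (weight u)⁻¹)
    (u : Fin d → ℝ) (k : Fin d → ℤ) :
    ‖F (u + fun i => (k i : ℝ))‖ ≤ C * (2 ^ d * weight u * (weight fun i => (k i : ℝ))⁻¹) := by
  have hC0 : 0 ≤ C := by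
    have := (norm_nonneg _).trans (hC 0)
    exact nonneg_of_mul_nonneg_left this (inv_pos.2 (weight_pos _))
  refine (hC _).trans (mul_le_mul_of_nonneg_left ?_ hC0)
  have h := weight_add_le (u + fun i => (k i : ℝ)) (-u)
  rw [weight_neg, add_comm u, add_neg_cancel_right] at h
  have hk := weight_pos fun i => (k i : ℝ)
  rw [add_comm u, inv_le_comm₀ (weight_pos _) (by have := weight_pos u; positivity), mul_inv,
    inv_inv, inv_mul_le_iff₀ (by have := weight_pos u; positivity)]
  linarith

/-- **Poisson summation** for a function whose Fourier transform vanishes at all nonzero integer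
points. -/
theorem tsum_int_eq_integral {F : (Fin d → ℝ) → ℂ} (hF : Continuous F) {C : ℝ}
    (hC : ∀ u, ‖F u‖ ≤ C * (weight u)⁻¹)
    (h0 : ∀ k : Fin d → ℤ, k ≠ 0 →
      ∫ u, ((Real.fourierChar (-∑ i, (k i : ℝ) * u i) : Circle) : ℂ) * F u = 0) :
    ∑' k : Fin d → ℤ, F (fun i => (k i : ℝ)) = ∫ u, F u := by
  -- The periodization of F. It is continuous by local dominated convergence and descends to a
  -- continuous function f on the torus.
  set P : (Fin d → ℝ) → ℂ := fun u => ∑' k : Fin d → ℤ, F (u + fun i => (k i : ℝ)) with hP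
  have hint : Integrable F :=
    (integrable_inv_weight.const_mul C).mono' hF.aestronglyMeasurable (ae_of_all _ hC)
  have hPc : Continuous P := by
    refine continuous_iff_continuousAt.2 fun u₀ => ?_
    obtain ⟨W, hW⟩ := (isCompact_closedBall u₀ 1).exists_bound_of_continuousOn
      (continuous_weight (d := d)).continuousOn
    have : ContinuousOn P (Metric.closedBall u₀ 1) := by
      refine continuousOn_tsum (fun k => (hF.comp (continuous_id.add
        continuous_const)).continuousOn) ((summable_inv_weight_int.mul_left (2 ^ d * W)).mul_left
        C) fun k u hu => (norm_add_int_le hC u k).trans ?_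
      have hC0 : 0 ≤ C := by
        have := (norm_nonneg _).trans (hC 0)
        exact nonneg_of_mul_nonneg_left this (inv_pos.2 (weight_pos _))
      have := (le_abs_self _).trans (hW u hu)
      have := weight_pos fun i => (k i : ℝ)
      gcongr
    exact this.continuousAt (Metric.closedBall_mem_nhds _ one_pos)
  have hper : ∀ u v, toTorus u = toTorus v → P u = P v := by
    intro u v huv
    have : ∀ i, ∃ m : ℤ, u i = v i + m := fun i => by
      have h := congrFun huv i
      simp only [toTorus] at h
      obtain ⟨m, hm⟩ := AddSubgroup.mem_zmultiples_iff.1 (QuotientAddGroup.eq.1 h.symm)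
      exact ⟨m, by simp at hm; linarith⟩
    choose m hm using this
    have : u = v + fun i => (m i : ℝ) := funext hm
    rw [this]
    simp only [hP]
    rw [← (Equiv.addLeft m).tsum_eq (fun k : Fin d → ℤ => F (v + fun i => (k i : ℝ)))]
    refine tsum_congr fun k => ?_
    congr 1
    ext i
    simp
    ring
  let f : C(UnitAddTorus (Fin d), ℂ) :=
    ⟨fun x => P (Function.surjInv isOpenQuotientMap_toTorus.surjective x), by
      rw [isOpenQuotientMap_toTorus.isQuotientMap.continuous_iff]
      refine hPc.congr fun u => hper _ _ ?_
      exact (Function.surjInv_eq isOpenQuotientMap_toTorus.surjective (toTorus u)).symm⟩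
  have hf : ∀ u, f (toTorus u) = P u := fun u =>
    hper _ _ (Function.surjInv_eq isOpenQuotientMap_toTorus.surjective (toTorus u))
  -- Unfolding: the integral of the periodization over a unit box is the integral of F over the
  -- whole space, since characters with integral frequency are invariant under integral
  -- translations.
  have hcoeff : ∀ k, UnitAddTorus.mFourierCoeff f k =
      ∫ u, ((Real.fourierChar (-∑ i, (k i : ℝ) * u i) : Circle) : ℂ) * F u := by
    intro k
    have hint' : Integrable fun u => ((Real.fourierChar (-∑ i, (k i : ℝ) * u i) : Circle) : ℂ) * F u := by
      refine hint.bdd_mul (c := 1) (Continuous.aestronglyMeasurable ?_) (ae_of_all _ fun u => ?_)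
      · fun_prop
      · exact (Circle.norm_coe _).le
    rw [UnitAddTorus.mFourierCoeff_eq_integral f k 0,
      ← (hasSum_setIntegral_unitBox hint').tsum_eq]
    have e : ∀ j : Fin d → ℤ, ∀ u : Fin d → ℝ,
        ((Real.fourierChar (-∑ i, (k i : ℝ) * (u + fun i => (j i : ℝ)) i) : Circle) : ℂ) =
        Real.fourierChar (-∑ i, (k i : ℝ) * u i) := by
      intro j u
      rw [show (-∑ i, (k i : ℝ) * (u + fun i => (j i : ℝ)) i) =
        (-∑ i, (k i : ℝ) * u i) + ((-∑ i, k i * j i : ℤ) : ℝ) by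
          push_cast; simp only [Pi.add_apply, mul_add, Finset.sum_add_distrib]; ring]
      rw [AddChar.map_add_eq_mul, Circle.coe_mul]
      have : ((Real.fourierChar ((-∑ i, k i * j i : ℤ) : ℝ) : Circle) : ℂ) = 1 := by
        rw [Real.fourierChar_apply, Complex.exp_eq_one_iff]
        exact ⟨-∑ i, k i * j i, by push_cast; ring⟩
      rw [this, mul_one]
    rw [integral_tsum_of_summable_integral_norm]
    · have : {x : Fin d → ℝ | ∀ i, x i ∈ Set.Ioc ((0 : Fin d → ℝ) i) ((0 : Fin d → ℝ) i + 1)} =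
          unitBox 0 := by simp [unitBox]
      rw [this]
      refine setIntegral_congr_fun (measurableSet_unitBox 0) fun u _ => ?_
      have h2 : UnitAddTorus.mFourier (-k) (toTorus u) =
          ((Real.fourierChar (-∑ i, (k i : ℝ) * u i) : Circle) : ℂ) := by
        rw [mFourier_toTorus]
        simp
      change UnitAddTorus.mFourier (-k) (toTorus u) • f (toTorus u) = _
      rw [h2, hf, smul_eq_mul, ← tsum_mul_left]
      exact tsum_congr fun j => by rw [e]
    · intro j
      exact (hint'.comp_add_right fun i => (j i : ℝ)).integrableOn
    · exact (hasSum_setIntegral_unitBox hint'.norm).summable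
  have hz : ∀ k, k ≠ 0 → UnitAddTorus.mFourierCoeff f k = 0 := fun k hk => by rw [hcoeff, h0 k hk]
  -- Only the coefficient at 0 survives, so the Fourier series trivially converges to f; evaluation
  -- at the origin is the claim.
  have hsum : Summable (UnitAddTorus.mFourierCoeff f) :=
    summable_of_hasFiniteSupport ((Set.finite_singleton 0).subset fun k hk => by
      by_contra hne; exact hk (hz k hne))
  have h1 := UnitAddTorus.hasSum_mFourier_series_apply_of_summable hsum (toTorus 0)
  have h2 := (hasSum_single (f := fun k => UnitAddTorus.mFourierCoeff f k •
    UnitAddTorus.mFourier k (toTorus 0)) 0 fun k hk => by rw [hz k hk, zero_smul]).unique h1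
  rw [hf, hcoeff, mFourier_toTorus] at h2
  simpa [hP] using h2.symm

end Poisson

end Frolov

end

noncomputable section

namespace Frolov

/-! ### Convolutions of tempered distributions with Schwartz functions -/

section Swap

open MeasureTheory SchwartzMap LineDeriv Topology Filter

variable {V : Type*} [NormedAddCommGroup V] [InnerProductSpace ℝ V]

/-- The translate `y ↦ b (y - z)`. -/
def translate (b : 𝓢(V, ℂ)) (z : V) : 𝓢(V, ℂ) := compSubConstCLM ℂ z b

theorem translate_apply (b : 𝓢(V, ℂ)) (z y : V) : translate b z y = b (y - z) := rfl

theorem iteratedFDeriv_translate (b : 𝓢(V, ℂ)) (l : ℕ) (z y : V) :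
    iteratedFDeriv ℝ l (translate b z) y = iteratedFDeriv ℝ l b (y - z) :=
  iteratedFDeriv_comp_sub l z y

theorem exists_one_add_pow_mul_le (b : 𝓢(V, ℂ)) (k l : ℕ) :
    ∃ C, 0 ≤ C ∧ ∀ x, (1 + ‖x‖) ^ k * ‖iteratedFDeriv ℝ l b x‖ ≤ C :=
  ⟨_, (by positivity), fun x => one_add_le_sup_seminorm_apply (𝕜 := ℝ) (m := (k, l)) le_rfl le_rfl b x⟩

theorem pow_mul_norm_iteratedFDeriv_translate_le (b : 𝓢(V, ℂ)) (k l : ℕ) :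
    ∃ C, 0 ≤ C ∧ ∀ z y, ‖y‖ ^ k * ‖iteratedFDeriv ℝ l (translate b z) y‖ ≤ C * (1 + ‖z‖) ^ k := by
  obtain ⟨C, hC0, hC⟩ := exists_one_add_pow_mul_le b k l
  refine ⟨C, hC0, fun z y => ?_⟩
  rw [iteratedFDeriv_translate]
  have h1 : ‖y‖ ≤ (1 + ‖z‖) * (1 + ‖y - z‖) := by
    have := norm_add_le (y - z) z
    rw [sub_add_cancel] at this
    nlinarith [norm_nonneg z, norm_nonneg (y - z)]
  calc ‖y‖ ^ k * ‖iteratedFDeriv ℝ l b (y - z)‖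
      ≤ ((1 + ‖z‖) * (1 + ‖y - z‖)) ^ k * ‖iteratedFDeriv ℝ l b (y - z)‖ := by gcongr
    _ = ((1 + ‖y - z‖) ^ k * ‖iteratedFDeriv ℝ l b (y - z)‖) * (1 + ‖z‖) ^ k := by
        rw [mul_pow]; ring
    _ ≤ C * (1 + ‖z‖) ^ k := by gcongr; exact hC _

/-- The mean value inequality for the l-th derivative along the segment from y - z₀ to y - z gives a
bound linear in ‖z - z₀‖. The weight ‖y‖^k is absorbed because points of that segment are within
distance 1 of y - z₀. -/
theorem continuous_translate (b : 𝓢(V, ℂ)) : Continuous (translate b) := by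
  refine continuous_iff_continuousAt.2 fun z₀ => ?_
  rw [ContinuousAt, (schwartz_withSeminorms ℝ V ℂ).tendsto_nhds]
  rintro ⟨k, l⟩ ε hε
  obtain ⟨C, hC0, hC⟩ := exists_one_add_pow_mul_le b k (l + 1)
  set R : ℝ := ‖z₀‖ + 1 with hR
  have hR0 : 1 ≤ R := by have := norm_nonneg z₀; linarith
  have key : ∀ z, ‖z - z₀‖ ≤ 1 →
      SchwartzMap.seminorm ℝ k l (translate b z - translate b z₀) ≤ R ^ k * C * ‖z - z₀‖ := by
    intro z hz
    refine seminorm_le_bound ℝ k l _ (by positivity) fun y => ?_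
    have e : iteratedFDeriv ℝ l (translate b z - translate b z₀ : 𝓢(V, ℂ)) y =
        iteratedFDeriv ℝ l b (y - z) - iteratedFDeriv ℝ l b (y - z₀) := by
      rw [← iteratedFDeriv_translate, ← iteratedFDeriv_translate]
      exact iteratedFDeriv_sub_apply ((translate b z).contDiffAt l) ((translate b z₀).contDiffAt l)
    rw [e]
    have hd : Differentiable ℝ (iteratedFDeriv ℝ l b) :=
      (b.smooth ⊤).differentiable_iteratedFDeriv (mod_cast ENat.natCast_lt_top l)
    have hmv : ‖y‖ ^ k * ‖iteratedFDeriv ℝ l b (y - z) - iteratedFDeriv ℝ l b (y - z₀)‖ =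
        ‖(‖y‖ ^ k) • iteratedFDeriv ℝ l b (y - z) - (‖y‖ ^ k) • iteratedFDeriv ℝ l b (y - z₀)‖ := by
      rw [← smul_sub, norm_smul, Real.norm_of_nonneg (by positivity)]
    rw [hmv]
    have := Convex.norm_image_sub_le_of_norm_fderiv_le (𝕜 := ℝ)
      (f := fun x => (‖y‖ ^ k) • iteratedFDeriv ℝ l b x) (s := segment ℝ (y - z₀) (y - z))
      (C := R ^ k * C) (x := y - z₀) (y := y - z) (fun x _ => (hd x).fun_const_smul _) (fun x hx => ?_)
      (convex_segment _ _) (left_mem_segment ℝ _ _) (right_mem_segment ℝ _ _)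
    · rw [sub_sub_sub_cancel_left, norm_sub_rev z₀] at this
      exact this
    · rw [fderiv_fun_const_smul (hd x), norm_smul, Real.norm_of_nonneg (by positivity),
        norm_fderiv_iteratedFDeriv]
      have hx' : ‖x - (y - z₀)‖ ≤ 1 := by
        have h1 : segment ℝ (y - z₀) (y - z) ⊆ Metric.closedBall (y - z₀) 1 :=
          (convex_closedBall _ _).segment_subset (Metric.mem_closedBall_self zero_le_one)
            (by rw [Metric.mem_closedBall, dist_eq_norm, sub_sub_sub_cancel_left, norm_sub_rev]
                exact hz)
        simpa [dist_eq_norm] using h1 hx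
      have hy : ‖y‖ ≤ R * (1 + ‖x‖) := by
        have h2 : ‖y‖ ≤ ‖x‖ + ‖x - (y - z₀)‖ + ‖z₀‖ := by
          calc ‖y‖ = ‖x - (x - (y - z₀)) + z₀‖ := by congr 1; abel
            _ ≤ _ := (norm_add_le _ _).trans (by gcongr; exact norm_sub_le _ _)
        nlinarith [norm_nonneg x, norm_nonneg z₀]
      calc ‖y‖ ^ k * ‖iteratedFDeriv ℝ (l + 1) b x‖
          ≤ (R * (1 + ‖x‖)) ^ k * ‖iteratedFDeriv ℝ (l + 1) b x‖ := by gcongr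
        _ = R ^ k * ((1 + ‖x‖) ^ k * ‖iteratedFDeriv ℝ (l + 1) b x‖) := by rw [mul_pow]; ring
        _ ≤ R ^ k * C := by gcongr; exact hC x
  have h1 : Tendsto (fun z => R ^ k * C * ‖z - z₀‖) (𝓝 z₀) (𝓝 0) := by
    have : Continuous fun z => R ^ k * C * ‖z - z₀‖ := by fun_prop
    simpa using this.tendsto z₀
  filter_upwards [h1.eventually_lt_const hε, Metric.closedBall_mem_nhds z₀ one_pos] with z hz hz1
  exact (key z (by simpa [dist_eq_norm] using hz1)).trans_lt hz

/-- The space of `l`-linear forms, as a normed space. -/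
def DerivSpace (V : Type*) [NormedAddCommGroup V] [InnerProductSpace ℝ V] (l : ℕ) : Type _ :=
  ContinuousMultilinearMap ℝ (fun _ : Fin l => V) ℂ

instance (l : ℕ) : NormedAddCommGroup (DerivSpace V l) :=
  inferInstanceAs (NormedAddCommGroup (ContinuousMultilinearMap ℝ (fun _ : Fin l => V) ℂ))

instance (l : ℕ) : NormedSpace ℂ (DerivSpace V l) :=
  inferInstanceAs (NormedSpace ℂ (ContinuousMultilinearMap ℝ (fun _ : Fin l => V) ℂ))

instance (l : ℕ) : CompleteSpace (DerivSpace V l) :=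
  inferInstanceAs (CompleteSpace (ContinuousMultilinearMap ℝ (fun _ : Fin l => V) ℂ))

/-- The `l`-th derivative with values in the space of `l`-linear forms. -/
def derivValue (l : ℕ) (φ : 𝓢(V, ℂ)) (y : V) : DerivSpace V l := iteratedFDeriv ℝ l φ y

theorem norm_derivValue (l : ℕ) (φ : 𝓢(V, ℂ)) (y : V) :
    ‖derivValue l φ y‖ = ‖iteratedFDeriv ℝ l φ y‖ := rfl

/-- Evaluation of multilinear forms. -/
def DerivSpace.eval {l : ℕ} (m : Fin l → V) : DerivSpace V l →L[ℝ] ℂ :=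
  ContinuousMultilinearMap.apply ℝ (fun _ : Fin l => V) ℂ m

/-- The bounded function `y ↦ ‖y‖ᵏ Dˡφ(y)`. -/
def weightedDeriv (k l : ℕ) : 𝓢(V, ℂ) →ₗ[ℂ] (V →ᵇ DerivSpace V l) where
  toFun φ := BoundedContinuousFunction.ofNormedAddCommGroup
    (fun y => (‖y‖ ^ k : ℝ) • derivValue l φ y)
    ((by fun_prop : Continuous fun y : V => ‖y‖ ^ k).smul
      ((φ.smooth ⊤).continuous_iteratedFDeriv (mod_cast le_top)))
    (SchwartzMap.seminorm ℝ k l φ) fun y => by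
      rw [norm_smul, Real.norm_of_nonneg (by positivity), norm_derivValue]
      exact le_seminorm ℝ k l φ y
  map_add' φ ψ := by
    ext1 y
    have h : derivValue l (φ + ψ) y = derivValue l φ y + derivValue l ψ y :=
      iteratedFDeriv_add_apply (φ.contDiffAt l) (ψ.contDiffAt l)
    simp [h]
  map_smul' c φ := by
    ext1 y
    have h : derivValue l (c • φ) y = c • derivValue l φ y :=
      iteratedFDeriv_const_smul_apply (φ.contDiffAt l)
    simp only [BoundedContinuousFunction.coe_ofNormedAddCommGroup, RingHom.id_apply,
      BoundedContinuousFunction.smul_apply, h]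
    exact smul_comm _ _ _

theorem weightedDeriv_apply (k l : ℕ) (φ : 𝓢(V, ℂ)) (y : V) :
    weightedDeriv k l φ y = (‖y‖ ^ k : ℝ) • derivValue l φ y := rfl

theorem norm_weightedDeriv_apply (k l : ℕ) (φ : 𝓢(V, ℂ)) (y : V) :
    ‖weightedDeriv k l φ y‖ = ‖y‖ ^ k * ‖iteratedFDeriv ℝ l φ y‖ := by
  rw [weightedDeriv_apply, norm_smul, Real.norm_of_nonneg (by positivity), norm_derivValue]

theorem seminorm_le_norm_weightedDeriv (k l : ℕ) (φ : 𝓢(V, ℂ)) :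
    SchwartzMap.seminorm ℝ k l φ ≤ ‖weightedDeriv k l φ‖ :=
  seminorm_le_bound ℝ k l φ (norm_nonneg _) fun y =>
    norm_weightedDeriv_apply k l φ y ▸ (weightedDeriv k l φ).norm_coe_le_norm y

theorem norm_weightedDeriv_le_seminorm (k l : ℕ) (φ : 𝓢(V, ℂ)) :
    ‖weightedDeriv k l φ‖ ≤ SchwartzMap.seminorm ℝ k l φ :=
  (BoundedContinuousFunction.norm_le (apply_nonneg _ _)).2 fun y => by
    rw [norm_weightedDeriv_apply]; exact le_seminorm ℝ k l φ y

theorem continuous_weightedDeriv (k l : ℕ) : Continuous (weightedDeriv (V := V) k l) := by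
  refine continuous_of_continuousAt_zero _ ?_
  rw [ContinuousAt, map_zero, tendsto_zero_iff_norm_tendsto_zero]
  have h : Continuous (SchwartzMap.seminorm ℝ k l : 𝓢(V, ℂ) → ℝ) :=
    (schwartz_withSeminorms ℝ V ℂ).continuous_seminorm (k, l)
  have h0 := h.tendsto 0
  rw [map_zero] at h0
  exact squeeze_zero (fun _ => norm_nonneg _) (fun φ => norm_weightedDeriv_le_seminorm k l φ) h0

/-- The estimate shows that T factors through the range of J as a bounded functional; Hahn-Banach
extends it to the whole normed space. This replaces a functional on Schwartz space by one on a
Banach space, where Bochner integrals are available. -/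
theorem exists_continuousLinearMap_comp_eq {X W : Type*} [AddCommGroup X] [Module ℂ X]
    [NormedAddCommGroup W] [NormedSpace ℂ W] (T : X →ₗ[ℂ] ℂ) (J : X →ₗ[ℂ] W) (C : ℝ)
    (h : ∀ x, ‖T x‖ ≤ C * ‖J x‖) : ∃ S : W →L[ℂ] ℂ, ∀ x, S (J x) = T x := by
  have hker : LinearMap.ker J ≤ LinearMap.ker T := fun x hx => by
    have := h x
    rw [LinearMap.mem_ker.1 hx, norm_zero, mul_zero] at this
    exact norm_le_zero_iff.1 this
  let f : LinearMap.range J →ₗ[ℂ] ℂ :=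
    (LinearMap.ker J).liftQ T hker ∘ₗ J.quotKerEquivRange.symm.toLinearMap
  have hf : ∀ x, f ⟨J x, x, rfl⟩ = T x := by
    intro x
    have : J.quotKerEquivRange.symm ⟨J x, x, rfl⟩ = (LinearMap.ker J).mkQ x := by
      rw [LinearEquiv.symm_apply_eq]; rfl
    simp [f, this]
  let g : LinearMap.range J →L[ℂ] ℂ := f.mkContinuous C fun w => by
    obtain ⟨_, x, rfl⟩ := w
    rw [hf]
    exact h x
  obtain ⟨S, hS, -⟩ := exists_extension_norm_eq (LinearMap.range J) g
  exact ⟨S, fun x => (hS ⟨J x, x, rfl⟩).trans (hf x)⟩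

theorem continuous_temperedDistribution_translate (T : 𝓢'(V, ℂ)) (b : 𝓢(V, ℂ)) :
    Continuous fun z => T (translate b z) :=
  (map_continuous T).comp (continuous_translate b)

variable [FiniteDimensional ℝ V] [MeasurableSpace V] [BorelSpace V]

/-- The convolution of two Schwartz functions. -/
def conv (b u : 𝓢(V, ℂ)) : 𝓢(V, ℂ) := convolution (ContinuousLinearMap.mul ℂ ℂ) b u

theorem conv_apply (b u : 𝓢(V, ℂ)) (y : V) : conv b u y = ∫ z, b (y - z) * u z := by
  rw [conv, convolution_apply]
  exact convolution_mul_swap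

theorem fourier_conv (b u : 𝓢(V, ℂ)) (ξ : V) : 𝓕 (conv b u) ξ = 𝓕 b ξ * 𝓕 u ξ := by
  rw [conv, fourier_convolution]
  rfl

/-- On the Fourier side the derivative is multiplication by a linear factor, which may be attached
to the first factor of the product. -/
theorem lineDerivOp_conv (b u : 𝓢(V, ℂ)) (m : V) : ∂_{m} (conv b u) = conv (∂_{m} b) u := by
  have h : 𝓕 (∂_{m} (conv b u)) = 𝓕 (conv (∂_{m} b) u) := by
    ext ξ
    have hg : (inner ℝ · m : V → ℝ).HasTemperateGrowth := ((innerSL ℝ).flip m).hasTemperateGrowth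
    rw [fourier_conv, fourier_lineDerivOp_eq, fourier_lineDerivOp_eq]
    simp only [_root_.smul_apply, smulLeftCLM_apply_apply hg, fourier_conv]
    simp only [smul_eq_mul, Complex.real_smul]
    ring
  have := congrArg (fun f => 𝓕⁻ f) h
  simpa using this

theorem iteratedLineDerivOp_conv (b u : 𝓢(V, ℂ)) {l : ℕ} (m : Fin l → V) :
    ∂^{m} (conv b u) = conv (∂^{m} b) u := by
  induction l with
  | zero => simp
  | succ l ih => rw [iteratedLineDerivOp_succ_left, iteratedLineDerivOp_succ_left, ih,
      lineDerivOp_conv]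

theorem integrable_one_add_norm_pow_mul (u : 𝓢(V, ℂ)) (k : ℕ) :
    Integrable fun z => (1 + ‖z‖) ^ k * ‖u z‖ := by
  have h := (u.integrable (μ := volume)).norm.add (u.integrable_pow_mul volume k)
  refine (h.const_mul (2 ^ k)).mono' ?_ (ae_of_all _ fun z => ?_)
  · exact Continuous.aestronglyMeasurable (by have := u.continuous; fun_prop)
  · rw [Real.norm_of_nonneg (by positivity)]
    have h1 : (1 + ‖z‖) ^ k ≤ 2 ^ k * (1 + ‖z‖ ^ k) := by
      refine (add_pow_le zero_le_one (norm_nonneg z) k).trans ?_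
      rw [one_pow]
      gcongr
      · norm_num
      · omega
    simp only [Pi.add_apply]
    nlinarith [mul_le_mul_of_nonneg_right h1 (norm_nonneg (u z))]

/-- Tempered distributions commute with superpositions of translates. -/
theorem temperedDistribution_conv (T : 𝓢'(V, ℂ)) (b u : 𝓢(V, ℂ)) :
    T (conv b u) = ∫ z, T (translate b z) * u z := by
  have hTc : Continuous T := map_continuous T
  -- T is controlled by finitely many seminorms, hence extends to a functional S on a finite product
  -- of spaces of bounded continuous functions. There the convolution is the Bochner integral of
  -- u(z) times the translates of b, and S commutes with it.
  obtain ⟨s, C, -, hC⟩ := Seminorm.bound_of_continuous (schwartz_withSeminorms ℂ V ℂ)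
    ((normSeminorm ℂ ℂ).comp (T : 𝓢(V, ℂ) →ₗ[ℂ] ℂ)) (continuous_norm.comp hTc)
  let J : 𝓢(V, ℂ) →ₗ[ℂ] (∀ i : s, V →ᵇ DerivSpace V i.1.2) :=
    LinearMap.pi fun i => weightedDeriv i.1.1 i.1.2
  have hJc : Continuous J := continuous_pi fun i => continuous_weightedDeriv i.1.1 i.1.2
  have hbound : ∀ φ, ‖T φ‖ ≤ C * ‖J φ‖ := by
    intro φ
    refine (hC φ).trans ?_
    refine mul_le_mul_of_nonneg_left ?_ C.2
    refine Seminorm.finset_sup_apply_le (norm_nonneg _) fun i hi => ?_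
    exact (seminorm_le_norm_weightedDeriv i.1 i.2 φ).trans (norm_le_pi_norm (J φ) ⟨i, hi⟩)
  obtain ⟨S, hS⟩ := exists_continuousLinearMap_comp_eq (T : 𝓢(V, ℂ) →ₗ[ℂ] ℂ) J C hbound
  have hS' : ∀ φ, S (J φ) = T φ := hS
  have hint : Integrable fun z => u z • J (translate b z) := by
    have hC' := fun i : s => pow_mul_norm_iteratedFDeriv_translate_le b i.1.1 i.1.2
    choose c hc0 hc using hC'
    set K := s.sup fun i => i.1
    refine ((integrable_one_add_norm_pow_mul u K).const_mul (∑ i, c i)).mono'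
      (Continuous.aestronglyMeasurable (u.continuous.smul (hJc.comp (continuous_translate b))))
      (ae_of_all _ fun z => ?_)
    rw [norm_smul, mul_comm, ← mul_assoc]
    refine mul_le_mul_of_nonneg_right ?_ (norm_nonneg _)
    have hsum : 0 ≤ ∑ i, c i := Finset.sum_nonneg fun i _ => hc0 i
    refine (pi_norm_le_iff_of_nonneg (by positivity)).2 fun i => ?_
    refine (BoundedContinuousFunction.norm_le (by positivity)).2 fun y => ?_
    refine (norm_weightedDeriv_apply i.1.1 i.1.2 (translate b z) y).trans_le ((hc i z y).trans ?_)
    gcongr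
    · exact Finset.single_le_sum (fun i _ => hc0 i) (Finset.mem_univ i)
    · linarith [norm_nonneg z]
    · exact Finset.le_sup (f := fun i : ℕ × ℕ => i.1) i.2
  have hJ : J (conv b u) = ∫ z, u z • J (translate b z) := by
    -- An identity in the product space is tested at an index, a point and a tuple of directions;
    -- evaluation is continuous, so it passes through the integral, and the derivative falls on b.
    refine funext fun i => BoundedContinuousFunction.ext fun y =>
      ContinuousMultilinearMap.ext fun m => ?_
    let E₁ : (V →ᵇ DerivSpace V i.1.2) →L[ℝ] ℂ :=
      (DerivSpace.eval m).comp (BoundedContinuousFunction.evalCLM ℝ y)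
    let E₂ : (∀ i : s, V →ᵇ DerivSpace V i.1.2) →L[ℝ] ℂ :=
      E₁.comp (ContinuousLinearMap.proj i)
    have h := E₂.integral_comp_comm hint
    refine Eq.trans ?_ h
    have e1 : E₂ (J (conv b u)) = (‖y‖ ^ i.1.1) * (conv (∂^{m} b) u) y := by
      rw [← iteratedLineDerivOp_conv, iteratedLineDerivOp_eq_iteratedFDeriv]
      change (‖y‖ ^ i.1.1 : ℝ) • iteratedFDeriv ℝ i.1.2 (conv b u) y m = _
      simp
    refine e1.trans ?_
    rw [ conv_apply, ← integral_const_mul]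
    refine integral_congr_ae (ae_of_all _ fun z => ?_)
    have e2 : E₂ (u z • J (translate b z)) =
        u z * ((‖y‖ ^ i.1.1 : ℝ) • iteratedFDeriv ℝ i.1.2 (translate b z) y m) := rfl
    simp only [e2]
    rw [iteratedFDeriv_translate, iteratedLineDerivOp_eq_iteratedFDeriv]
    simp
    ring
  rw [← hS', hJ, ← S.integral_comp_comm hint]
  refine integral_congr_ae (ae_of_all _ fun z => ?_)
  simp only [map_smul, hS', smul_eq_mul]
  ring

end Swap

end Frolov

end

noncomputable section

namespace Frolov

/-! ### Smooth cutoffs in the Schwartz space -/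

section Cutoff

open SchwartzMap Topology Filter

variable {V : Type*} [NormedAddCommGroup V] [InnerProductSpace ℝ V]

theorem exists_norm_iteratedFDeriv_le_of_hasCompactSupport {χ : V → ℂ} (hχ : ContDiff ℝ ∞ χ)
    (hc : HasCompactSupport χ) (i : ℕ) : ∃ C, 0 ≤ C ∧ ∀ x, ‖iteratedFDeriv ℝ i χ x‖ ≤ C := by
  refine ⟨_, apply_nonneg (SchwartzMap.seminorm ℝ 0 i) (hc.toSchwartzMap hχ), fun x => ?_⟩
  exact norm_iteratedFDeriv_le_seminorm ℝ (hc.toSchwartzMap hχ) i x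

/-- The difference W N - w vanishes for ‖y‖ < r 2^N. Elsewhere one additional power of ‖y‖ in the
seminorm buys the factor (r 2^N)⁻¹, while the derivatives of the cutoff stay bounded under
contraction. -/
theorem tendsto_of_eq_cutoff_mul {χ : V → ℂ} (hχ : ContDiff ℝ ∞ χ) (hc : HasCompactSupport χ)
    {r : ℝ} (hr : 0 < r) (h1 : ∀ x, ‖x‖ < r → χ x = 1) (w : 𝓢(V, ℂ)) (W : ℕ → 𝓢(V, ℂ))
    (hW : ∀ N x, W N x = χ (((2 : ℝ) ^ N)⁻¹ • x) * w x) : Tendsto W atTop (𝓝 w) := by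
  rw [(schwartz_withSeminorms ℝ V ℂ).tendsto_nhds]
  rintro ⟨k, l⟩ ε hε
  choose C hC0 hC using exists_norm_iteratedFDeriv_le_of_hasCompactSupport hχ hc
  set B : ℝ := ∑ i ∈ Finset.range (l + 1), (l.choose i : ℝ) * (C i + 1) *
    SchwartzMap.seminorm ℝ (k + 1) (l - i) w with hB
  have hB0 : 0 ≤ B := Finset.sum_nonneg fun i _ => by have := hC0 i; positivity
  have key : ∀ N, SchwartzMap.seminorm ℝ k l (W N - w) ≤ B / r * ((2 : ℝ) ^ N)⁻¹ := by
    intro N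
    have hN : (0 : ℝ) < 2 ^ N := by positivity
    have hN1 : (1 : ℝ) ≤ 2 ^ N := one_le_pow₀ (by norm_num)
    refine seminorm_le_bound ℝ k l _ (by positivity) fun y => ?_
    set g : V → ℂ := fun x => χ (((2 : ℝ) ^ N)⁻¹ • x) - 1 with hg
    have hgc : ContDiff ℝ ∞ g := (hχ.comp (contDiff_const_smul _)).sub contDiff_const
    have e : ((W N - w : 𝓢(V, ℂ)) : V → ℂ) = fun x => g x * w x := by
      ext x
      rw [_root_.sub_apply, hW, hg]
      ring
    rw [e]
    rcases lt_or_ge ‖y‖ (r * 2 ^ N) with hy | hy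
    · have : (fun x => g x * w x) =ᶠ[𝓝 y] fun _ => (0 : ℂ) := by
        have ho : IsOpen {x : V | ‖x‖ < r * 2 ^ N} := isOpen_lt continuous_norm continuous_const
        filter_upwards [ho.mem_nhds hy] with x hx
        have : ‖((2 : ℝ) ^ N)⁻¹ • x‖ < r := by
          rw [norm_smul, norm_inv, Real.norm_of_nonneg hN.le, inv_mul_lt_iff₀ hN, mul_comm]
          exact hx
        simp [hg, h1 _ this]
      rw [(this.iteratedFDeriv ℝ l).eq_of_nhds]
      have hz : iteratedFDeriv ℝ l (fun _ : V => (0 : ℂ)) y = 0 := by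
        simp
      rw [hz, norm_zero, mul_zero]
      positivity
    · have hgi : ∀ i, ‖iteratedFDeriv ℝ i g y‖ ≤ C i + 1 := by
        intro i
        have e1 : iteratedFDeriv ℝ i g y =
            iteratedFDeriv ℝ i (fun x => χ (((2 : ℝ) ^ N)⁻¹ • x)) y -
              iteratedFDeriv ℝ i (fun _ => (1 : ℂ)) y :=
          iteratedFDeriv_sub_apply ((hχ.comp (contDiff_const_smul _)).contDiffAt.of_le
            (mod_cast le_top)) contDiffAt_const
        rw [e1]
        refine (norm_sub_le _ _).trans (add_le_add ?_ ?_)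
        · rw [iteratedFDeriv_comp_const_smul _ (hχ.of_le (mod_cast le_top))]
          simp only [norm_smul, norm_pow, norm_inv, Real.norm_of_nonneg hN.le]
          calc _ ≤ 1 * C i := mul_le_mul (pow_le_one₀ (by positivity) (inv_le_one_of_one_le₀ hN1))
                (hC i _) (norm_nonneg _) zero_le_one
            _ = C i := one_mul _
        · rcases Nat.eq_zero_or_pos i with rfl | hi
          · simp
          · rw [iteratedFDeriv_const_of_ne hi.ne']
            simp
      have hle := norm_iteratedFDeriv_mul_le hgc (w.smooth ⊤) y (n := l) (mod_cast le_top)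
      have hy0 : 0 < ‖y‖ := lt_of_lt_of_le (by positivity) hy
      have hmul : ‖y‖ * (‖y‖ ^ k * ‖iteratedFDeriv ℝ l (fun x => g x * w x) y‖) ≤ B := by
        calc _ ≤ ‖y‖ * (‖y‖ ^ k * ∑ i ∈ Finset.range (l + 1), (l.choose i : ℝ) *
              ‖iteratedFDeriv ℝ i g y‖ * ‖iteratedFDeriv ℝ (l - i) w y‖) := by gcongr
          _ = ∑ i ∈ Finset.range (l + 1), (l.choose i : ℝ) * ‖iteratedFDeriv ℝ i g y‖ *
              (‖y‖ ^ (k + 1) * ‖iteratedFDeriv ℝ (l - i) w y‖) := by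
            rw [Finset.mul_sum, Finset.mul_sum]
            exact Finset.sum_congr rfl fun i _ => by rw [pow_succ]; ring
          _ ≤ B := by
            refine Finset.sum_le_sum fun i _ => ?_
            have h3 := hC0 i
            have h4 := hgi i
            have h5 := le_seminorm ℝ (k + 1) (l - i) w y
            gcongr
      rw [div_mul_eq_mul_div, ← div_eq_mul_inv, div_div, le_div_iff₀ (by positivity), mul_comm]
      refine le_trans ?_ hmul
      gcongr
      linarith
  have hlim : Tendsto (fun N : ℕ => B / r * ((2 : ℝ) ^ N)⁻¹) atTop (𝓝 0) := by
    have := (tendsto_inv_atTop_zero.comp (tendsto_pow_atTop_atTop_of_one_lt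
      (one_lt_two : (1 : ℝ) < 2))).const_mul (B / r)
    simpa using this
  filter_upwards [hlim.eventually_lt_const hε] with N hN
  exact (key N).trans_lt hN

end Cutoff

/-! ### Fourier transforms of tensor products and dilates -/

section FourierTensor

open MeasureTheory

variable {d : ℕ}

theorem fourier_tensor (f : Fin d → ℝ → ℂ) (ξ : Space d) :
    𝓕 (fun x : Space d => ∏ i, f i (x i)) ξ = ∏ i, 𝓕 (f i) (ξ i) := by
  simp only [Real.fourier_eq', smul_eq_mul]
  rw [← integral_space_prod]
  refine integral_congr_ae (ae_of_all _ fun x => ?_)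
  simp only [Finset.prod_mul_distrib, ← Complex.exp_sum]
  congr 2
  rw [← Finset.sum_mul]
  congr 1
  rw [PiLp.inner_apply]
  push_cast
  rw [Finset.mul_sum]

theorem fourierInv_tensor (f : Fin d → ℝ → ℂ) (ξ : Space d) :
    𝓕⁻ (fun x : Space d => ∏ i, f i (x i)) ξ = ∏ i, 𝓕⁻ (f i) (ξ i) := by
  simp only [Real.fourierInv_eq_fourier_neg, fourier_tensor]
  rfl

theorem fourier_dilate (g : ℝ → ℂ) (j : ℕ) (ξ : ℝ) :
    𝓕 (fun t : ℝ => (2 : ℂ) ^ j * g ((2 : ℝ) ^ j * t)) ξ = 𝓕 g (ξ / 2 ^ j) := by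
  have h2 : (0 : ℝ) < 2 ^ j := by positivity
  simp only [Real.fourier_real_eq_integral_exp_smul, smul_eq_mul]
  have := Measure.integral_comp_mul_left
    (fun t : ℝ => Complex.exp (↑(-2 * Real.pi * t * (ξ / 2 ^ j)) * Complex.I) * g t) ((2 : ℝ) ^ j)
  rw [abs_of_pos (inv_pos.2 h2), ← smul_right_inj h2.ne', smul_smul, mul_inv_cancel₀ h2.ne', one_smul,
    ← integral_smul] at this
  rw [← this]
  refine integral_congr_ae (ae_of_all _ fun t => ?_)
  simp only [Complex.real_smul]
  have e : -2 * Real.pi * (2 ^ j * t) * (ξ / 2 ^ j) = -2 * Real.pi * t * ξ := by field_simp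
  rw [e]
  push_cast
  ring

theorem fourierInv_contract (g : ℝ → ℂ) (j : ℕ) (t : ℝ) :
    𝓕⁻ (fun ξ : ℝ => g (ξ / 2 ^ j)) t = (2 : ℂ) ^ j * 𝓕⁻ g ((2 : ℝ) ^ j * t) := by
  have h2 : (0 : ℝ) < 2 ^ j := by positivity
  simp only [Real.fourierInv_eq_fourier_neg, Real.fourier_real_eq_integral_exp_smul, smul_eq_mul]
  have := Measure.integral_comp_mul_left
    (fun ξ : ℝ => Complex.exp (↑(-2 * Real.pi * ξ * -t) * Complex.I) * g (ξ / 2 ^ j)) ((2 : ℝ) ^ j)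
  rw [abs_of_pos (inv_pos.2 h2), ← smul_right_inj h2.ne', smul_smul, mul_inv_cancel₀ h2.ne', one_smul]
    at this
  rw [← this, Complex.real_smul]
  push_cast
  congr 1
  refine integral_congr_ae (ae_of_all _ fun ξ => ?_)
  simp only
  rw [mul_div_cancel_left₀ _ h2.ne']
  congr 2
  ring

end FourierTensor

/-! ### The dual kernels -/

namespace LocalMeans

variable {L : ℕ} (K : LocalMeans L)

open MeasureTheory

/-- A smooth bump on the frequency side. -/
def bump : ContDiffBump (0 : ℝ) := ⟨3 / 5 * K.ε, 9 / 10 * K.ε, by have := K.ε_pos; positivity,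
  by have := K.ε_pos; linarith⟩

/-- A dyadic partition of unity. -/
def pou : ℕ → ℝ → ℝ
  | 0 => K.bump
  | j + 1 => fun ξ => K.bump (ξ / 2 / 2 ^ j) - K.bump (ξ / 2 ^ j)

/-- The sum telescopes. -/
theorem sum_pou (N : ℕ) (ξ : ℝ) : ∑ j ∈ Finset.range (N + 1), K.pou j ξ = K.bump (ξ / 2 ^ N) := by
  induction N with
  | zero => simp [pou]
  | succ N ih =>
    rw [Finset.sum_range_succ, ih, pow_succ', ← div_div]
    simp only [pou]
    ring

theorem fourier_Ψ₀_contDiff : ContDiff ℝ ∞ (𝓕 K.Ψ₀) := by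
  have := (𝓕 (K.compact₀.toSchwartzMap K.smooth₀)).smooth ⊤
  exact this

theorem fourier_Ψ₁_contDiff : ContDiff ℝ ∞ (𝓕 K.Ψ₁) := by
  have := (𝓕 (K.compact₁.toSchwartzMap K.smooth₁)).smooth ⊤
  exact this

/-- The Fourier transforms of the dual kernels of the two levels. -/
def dualBase (i : Fin 2) (ξ : ℝ) : ℂ :=
  if i = 0 then K.bump ξ / 𝓕 K.Ψ₀ ξ else (K.bump (ξ / 2) - K.bump ξ : ℝ) / 𝓕 K.Ψ₁ ξ

/-- The radii of `bump` are chosen for this: 3/5 exceeds 1/2 and 9/5 is below 2, so the annulus lies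
inside the region where the Fourier transform of Ψ₁ has no zero. Likewise 9/10 is below 1, which
serves Ψ₀. -/
theorem tsupport_bump_sub_subset : tsupport (fun ξ : ℝ => K.bump (ξ / 2) - K.bump ξ) ⊆
    {ξ | 3 / 5 * K.ε ≤ |ξ| ∧ |ξ| ≤ 9 / 5 * K.ε} := by
  have hε := K.ε_pos
  refine closure_minimal (fun ξ hξ => ?_) ?_
  · constructor
    · by_contra! h
      refine hξ ?_
      have h1 : K.bump ξ = 1 := K.bump.one_of_mem_closedBall (by
        rw [Metric.mem_closedBall, Real.dist_eq, sub_zero]; exact h.le)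
      have h2 : K.bump (ξ / 2) = 1 := K.bump.one_of_mem_closedBall (by
        rw [Metric.mem_closedBall, Real.dist_eq, sub_zero, abs_div, abs_two]
        change |ξ| / 2 ≤ 3 / 5 * K.ε
        linarith)
      simp [h1, h2]
    · by_contra! h
      refine hξ ?_
      have h1 : K.bump ξ = 0 := K.bump.zero_of_le_dist (by
        rw [Real.dist_eq, sub_zero]
        change 9 / 10 * K.ε ≤ |ξ|
        linarith)
      have h2 : K.bump (ξ / 2) = 0 := K.bump.zero_of_le_dist (by
        rw [Real.dist_eq, sub_zero, abs_div, abs_two]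
        change 9 / 10 * K.ε ≤ |ξ| / 2
        linarith)
      simp [h1, h2]
  · exact (isClosed_le continuous_const continuous_abs).inter
      (isClosed_le continuous_abs continuous_const)

theorem tsupport_bump_subset : tsupport K.bump ⊆ {ξ | |ξ| ≤ 9 / 10 * K.ε} := by
  rw [K.bump.tsupport_eq]
  intro ξ hξ
  rw [Metric.mem_closedBall, Real.dist_eq, sub_zero] at hξ
  exact hξ

theorem abs_le_of_dualBase_ne_zero {i : Fin 2} {ξ : ℝ} (h : K.dualBase i ξ ≠ 0) :
    |ξ| ≤ 9 / 5 * K.ε := by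
  have hε := K.ε_pos
  unfold dualBase at h
  split_ifs at h with hi
  · have h1 : ξ ∈ tsupport K.bump := subset_tsupport _ fun h0 => h (by simp [h0])
    have := K.tsupport_bump_subset h1
    simp only [Set.mem_ofPred_eq] at this
    linarith
  · have h1 : ξ ∈ tsupport (fun ξ : ℝ => K.bump (ξ / 2) - K.bump ξ) :=
      subset_tsupport _ fun h0 : K.bump (ξ / 2) - K.bump ξ = 0 => h (by rw [h0]; simp)
    exact (K.tsupport_bump_sub_subset h1).2

/-- Each point is either in the closed support of the numerator, where the denominator does not
vanish, or has a neighbourhood on which the quotient is zero. -/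
theorem dualBase_contDiff (i : Fin 2) : ContDiff ℝ ∞ (K.dualBase i) := by
  have hε := K.ε_pos
  have hb : ContDiff ℝ ∞ (fun ξ : ℝ => (K.bump ξ : ℂ)) :=
    Complex.ofRealCLM.contDiff.comp K.bump.contDiff
  have hb1 : ContDiff ℝ ∞ (fun ξ : ℝ => K.bump (ξ / 2) - K.bump ξ) :=
    (K.bump.contDiff.comp (contDiff_id.div_const 2)).sub K.bump.contDiff
  have hb1' : ContDiff ℝ ∞ (fun ξ : ℝ => ((K.bump (ξ / 2) - K.bump ξ : ℝ) : ℂ)) :=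
    Complex.ofRealCLM.contDiff.comp hb1
  rw [contDiff_iff_contDiffAt]
  intro x
  unfold dualBase
  split_ifs with hi
  · by_cases hx : x ∈ tsupport K.bump
    · have h1 := K.tsupport_bump_subset hx
      simp only [Set.mem_ofPred_eq] at h1
      simp only [div_eq_mul_inv]
      exact hb.contDiffAt.mul (K.fourier_Ψ₀_contDiff.contDiffAt.inv (K.fourier₀ x (by linarith)))
    · have : (fun ξ => (K.bump ξ : ℂ) / 𝓕 K.Ψ₀ ξ) =ᶠ[nhds x] fun _ => 0 := by
        filter_upwards [(isClosed_tsupport _).isOpen_compl.mem_nhds hx] with y hy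
        simp [image_eq_zero_of_notMem_tsupport hy]
      exact contDiffAt_const.congr_of_eventuallyEq this
  · by_cases hx : x ∈ tsupport (fun ξ : ℝ => K.bump (ξ / 2) - K.bump ξ)
    · have h1 := K.tsupport_bump_sub_subset hx
      simp only [div_eq_mul_inv _ (𝓕 K.Ψ₁ _)]
      exact hb1'.contDiffAt.mul (K.fourier_Ψ₁_contDiff.contDiffAt.inv
        (K.fourier₁ x (by linarith [h1.1]) (by linarith [h1.2])))
    · have : (fun ξ => ((K.bump (ξ / 2) - K.bump ξ : ℝ) : ℂ) / 𝓕 K.Ψ₁ ξ) =ᶠ[nhds x] fun _ => 0 := by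
        filter_upwards [(isClosed_tsupport _).isOpen_compl.mem_nhds hx] with y hy
        have : K.bump (y / 2) - K.bump y = 0 :=
          image_eq_zero_of_notMem_tsupport (f := fun ξ : ℝ => K.bump (ξ / 2) - K.bump ξ) hy
        rw [this]
        simp
      exact contDiffAt_const.congr_of_eventuallyEq this

theorem dualBase_hasCompactSupport (i : Fin 2) : HasCompactSupport (K.dualBase i) :=
  HasCompactSupport.intro (isCompact_closedBall (0 : ℝ) (9 / 5 * K.ε)) fun ξ hξ => by
    by_contra h
    refine hξ ?_
    rw [Metric.mem_closedBall, Real.dist_eq, sub_zero]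
    exact K.abs_le_of_dualBase_ne_zero h

/-- The dual kernels at the two base levels. -/
def dualSchwartz (i : Fin 2) : 𝓢(ℝ, ℂ) :=
  𝓕⁻ ((K.dualBase_hasCompactSupport i).toSchwartzMap (K.dualBase_contDiff i))

/-- The Fourier transforms of the dual kernels. -/
def dualHat : ℕ → ℝ → ℂ
  | 0 => K.dualBase 0
  | j + 1 => fun ξ => K.dualBase 1 (ξ / 2 ^ j)

/-- The dual kernels. -/
def dual : ℕ → ℝ → ℂ
  | 0 => K.dualSchwartz 0
  | j + 1 => fun t => (2 : ℂ) ^ j * K.dualSchwartz 1 ((2 : ℝ) ^ j * t)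

theorem fourierInv_dualHat (j : ℕ) : 𝓕⁻ (K.dualHat j) = K.dual j := by
  cases j with
  | zero =>
    have : K.dualHat 0 = ((K.dualBase_hasCompactSupport 0).toSchwartzMap
      (K.dualBase_contDiff 0) : ℝ → ℂ) := rfl
    rw [this, ← SchwartzMap.fourierInv_coe]
    rfl
  | succ j =>
    ext t
    simp only [dualHat, dual]
    rw [fourierInv_contract (K.dualBase 1)]
    congr 1
    rw [dualSchwartz, SchwartzMap.fourierInv_coe]
    rfl

theorem dualHat_contDiff (j : ℕ) : ContDiff ℝ ∞ (K.dualHat j) := by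
  cases j with
  | zero => exact K.dualBase_contDiff 0
  | succ j => exact (K.dualBase_contDiff 1).comp (contDiff_id.div_const _)

theorem abs_le_of_dualHat_ne_zero {j : ℕ} {ξ : ℝ} (h : K.dualHat j ξ ≠ 0) :
    |ξ| ≤ 9 / 5 * K.ε * 2 ^ j := by
  have hε := K.ε_pos
  cases j with
  | zero => simpa using K.abs_le_of_dualBase_ne_zero h
  | succ j =>
    have h1 := K.abs_le_of_dualBase_ne_zero h
    rw [abs_div, abs_of_pos (by positivity : (0 : ℝ) < 2 ^ j), div_le_iff₀ (by positivity)] at h1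
    refine h1.trans ?_
    gcongr
    · norm_num
    · omega

theorem dualHat_hasCompactSupport (j : ℕ) : HasCompactSupport (K.dualHat j) :=
  HasCompactSupport.intro (isCompact_closedBall (0 : ℝ) (9 / 5 * K.ε * 2 ^ j)) fun ξ hξ => by
    by_contra h
    refine hξ ?_
    rw [Metric.mem_closedBall, Real.dist_eq, sub_zero]
    exact K.abs_le_of_dualHat_ne_zero h

theorem fourier_kernel (j : ℕ) (ξ : ℝ) : 𝓕 (K.kernel (j + 1)) ξ = 𝓕 K.Ψ₁ (ξ / 2 ^ j) :=
  fourier_dilate K.Ψ₁ j ξ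

/-- The duality behind the reproducing formula. At zeros of the denominator the quotient is 0 by
convention, and there the partition function is 0 as well. -/
theorem dualHat_mul_fourier_kernel (j : ℕ) (ξ : ℝ) :
    K.dualHat j ξ * 𝓕 (K.kernel j) ξ = K.pou j ξ := by
  have hε := K.ε_pos
  cases j with
  | zero =>
    change K.dualBase 0 ξ * 𝓕 K.Ψ₀ ξ = K.bump ξ
    by_cases h : 𝓕 K.Ψ₀ ξ = 0
    · have hb : K.bump ξ = 0 := by
        by_contra hne
        have := K.tsupport_bump_subset (subset_tsupport _ hne)
        simp only [Set.mem_ofPred_eq] at this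
        exact K.fourier₀ ξ (by linarith) h
      simp [h, hb]
    · simp [dualBase, h]
  | succ j =>
    rw [fourier_kernel]
    simp only [dualHat, pou]
    rw [div_right_comm]
    generalize ξ / 2 ^ j = η
    by_cases h : 𝓕 K.Ψ₁ η = 0
    · have hb : K.bump (η / 2) - K.bump η = 0 := by
        by_contra hne
        have := K.tsupport_bump_sub_subset (subset_tsupport _ hne)
        exact K.fourier₁ η (by linarith [this.1]) (by linarith [this.2]) h
      rw [h, hb]
      simp
    · simp [dualBase, h]

/-- The tensor products of the dual kernels. -/
def tensorDual {d : ℕ} (m : Fin d → ℕ) (x : Space d) : ℂ := ∏ i, K.dual (m i) (x i)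

/-- The Fourier transforms of the tensor products of the dual kernels. -/
def tensorDualHat {d : ℕ} (m : Fin d → ℕ) : 𝓢(Space d, ℂ) :=
  HasCompactSupport.toSchwartzMap (f := fun ξ => ∏ i, K.dualHat (m i) (ξ i)) (by
    have hc : IsCompact (Set.univ.pi fun i : Fin d => tsupport (K.dualHat (m i))) :=
      isCompact_univ_pi fun i => K.dualHat_hasCompactSupport (m i)
    refine HasCompactSupport.intro
      (hc.image (PiLp.continuous_toLp 2 fun _ : Fin d => ℝ)) fun x hx => ?_
    by_contra h
    refine hx ⟨x.ofLp, fun i _ => subset_tsupport _ fun hi => h ?_, rfl⟩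
    exact Finset.prod_eq_zero (Finset.mem_univ i) hi)
    (contDiff_prod fun i _ => (K.dualHat_contDiff (m i)).comp (by fun_prop))

theorem tensorDualHat_apply {d : ℕ} (m : Fin d → ℕ) (ξ : Space d) :
    K.tensorDualHat m ξ = ∏ i, K.dualHat (m i) (ξ i) := rfl

theorem fourierInv_tensorDualHat {d : ℕ} (m : Fin d → ℕ) (x : Space d) :
    𝓕⁻ (K.tensorDualHat m) x = K.tensorDual m x := by
  rw [SchwartzMap.fourierInv_coe]
  have : ((K.tensorDualHat m : 𝓢(Space d, ℂ)) : Space d → ℂ) =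
      fun ξ => ∏ i, K.dualHat (m i) (ξ i) := rfl
  rw [this, fourierInv_tensor]
  simp only [fourierInv_dualHat]
  rfl

theorem fourier_tensorDualHat {d : ℕ} (m : Fin d → ℕ) (x : Space d) :
    𝓕 (K.tensorDualHat m) x = K.tensorDual m (-x) := by
  rw [← fourierInv_tensorDualHat, SchwartzMap.fourierInv_coe, Real.fourierInv_eq_fourier_neg,
    neg_neg, SchwartzMap.fourier_coe]

end LocalMeans

end Frolov

end

noncomputable section

namespace Frolov

/-! ### Supports of distributions -/

section Support

open scoped Manifold
open MeasureTheory

/-- Points outside the support only provide vanishing on small neighbourhoods. Compactness selects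
finitely many of them, and a smooth partition of unity splits φ into pieces on which T vanishes. -/
theorem apply_eq_zero_of_tsupport_subset_compl {V : Type*} [NormedAddCommGroup V]
    [InnerProductSpace ℝ V] [FiniteDimensional ℝ V] (T : 𝓢'(V, ℂ)) (φ : 𝓢(V, ℂ))
    (hc : HasCompactSupport φ) (h : tsupport φ ⊆ (Distribution.dsupport T)ᶜ) : T φ = 0 := by
  choose! U hU using fun x (hx : x ∈ tsupport φ) => (Distribution.notMem_dsupport_iff x).1 (h hx)
  obtain ⟨t, ht, hcov⟩ := hc.elim_nhds_subcover U
    (fun x hx => (hU x hx).2.1.mem_nhds (hU x hx).2.2)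
  obtain ⟨ρ, hρ⟩ := SmoothPartitionOfUnity.exists_isSubordinate 𝓘(ℝ, V) (isClosed_tsupport φ)
    (fun x : t => U x) (fun x => (hU x (ht x x.2)).2.1) (fun y hy => by
      obtain ⟨x, hx, hxy⟩ := Set.mem_iUnion₂.1 (hcov hy)
      exact Set.mem_iUnion.2 ⟨⟨x, hx⟩, hxy⟩)
  let ψ (x : t) : 𝓢(V, ℂ) := HasCompactSupport.toSchwartzMap (f := fun y => (ρ x y : ℂ) * φ y)
    hc.mul_left ((Complex.ofRealCLM.contDiff.comp (ρ x).contMDiff.contDiff).mul (φ.smooth ⊤))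
  have hψ : φ = ∑ x, ψ x := by
    ext y
    rw [_root_.sum_apply]
    change φ y = ∑ x, (ρ x y : ℂ) * φ y
    rw [← Finset.sum_mul]
    by_cases hy : y ∈ tsupport φ
    · have := ρ.sum_eq_one hy
      rw [finsum_eq_sum_of_fintype] at this
      rw [← Complex.ofReal_sum, this, Complex.ofReal_one, one_mul]
    · rw [image_eq_zero_of_notMem_tsupport hy, mul_zero]
  rw [hψ, map_sum]
  refine Finset.sum_eq_zero fun x _ => (hU x (ht x x.2)).1 _ (subset_trans ?_ (hρ x))
  refine closure_mono fun y hy h0 => hy ?_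
  change (ρ x y : ℂ) * φ y = 0
  rw [h0, Complex.ofReal_zero, zero_mul]

namespace LocalMeans

variable {L : ℕ} (K : LocalMeans L) {d : ℕ}

/-- Dilation by 2^j with j ≥ 0 shrinks supports, so one radius serves all levels. -/
theorem exists_kernel_eq_zero : ∃ R > 0, ∀ j t, R < |t| → K.kernel j t = 0 := by
  obtain ⟨R₀, h₀⟩ := K.compact₀.isCompact.isBounded.subset_closedBall (0 : ℝ)
  obtain ⟨R₁, h₁⟩ := K.compact₁.isCompact.isBounded.subset_closedBall (0 : ℝ)
  refine ⟨max 1 (max R₀ R₁), by positivity, fun j t ht => ?_⟩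
  by_contra hne
  simp only [max_lt_iff] at ht
  cases j with
  | zero =>
    have := h₀ (subset_tsupport _ hne)
    rw [Metric.mem_closedBall, Real.dist_eq, sub_zero] at this
    linarith
  | succ j =>
    have := h₁ (subset_tsupport _ (right_ne_zero_of_mul hne))
    rw [Metric.mem_closedBall, Real.dist_eq, sub_zero, abs_mul, abs_of_pos (by positivity)] at this
    have h2 : (1 : ℝ) ≤ 2 ^ j := one_le_pow₀ (by norm_num)
    nlinarith [abs_nonneg t]

/-- If a coordinate of z is large, the support of the kernel translated to z does not meet the cube.
The radius is the same for all levels m and all T, so later integrals in z run over a fixed box. -/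
theorem exists_abs_le_of_conv_ne_zero : ∃ R > 0, ∀ (T : 𝓢'(Space d, ℂ)),
    Distribution.dsupport T ⊆ closedCube d → ∀ (m : Fin d → ℕ) (z : Space d),
      K.conv m T z ≠ 0 → ∀ i, |z i| ≤ R := by
  obtain ⟨R, hR, h⟩ := K.exists_kernel_eq_zero
  refine ⟨R + 1, by positivity, fun T hT m z hz i => ?_⟩
  by_contra! hi
  refine hz (apply_eq_zero_of_tsupport_subset_compl T _ ?_ ?_)
  · exact (K.tensorKernel_hasCompactSupport m).comp_homeomorph (Homeomorph.subLeft z)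
  · have hcl : IsClosed {y : Space d | |z i - y i| ≤ R} :=
      isClosed_le (by fun_prop) continuous_const
    have hsub : tsupport (K.reflectedTranslate m z) ⊆ {y : Space d | |z i - y i| ≤ R} := by
      refine closure_minimal (fun y hy => ?_) hcl
      by_contra! hlt
      refine hy (Finset.prod_eq_zero (Finset.mem_univ i) (h _ _ ?_))
      change ¬ (|z i - y i| ≤ R) at hlt
      exact not_le.1 hlt
    intro y hy hyT
    have h1 := hT hyT i
    have h2 : |z i - y i| ≤ R := hsub hy
    have h3 : |z i| ≤ |z i - y i| + |y i| := by
      have := abs_add_le (z i - y i) (y i)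
      rwa [sub_add_cancel] at this
    have h4 : |y i| ≤ 1 := abs_le.2 ⟨by linarith [h1.1], h1.2⟩
    linarith

end LocalMeans

end Support

/-! ### The reproducing formula -/

/-- The cube of all `m ∈ ℕ₀^d` with entries up to `N`. -/
def levels (d N : ℕ) : Finset (Fin d → ℕ) := Fintype.piFinset fun _ => Finset.range (N + 1)

namespace LocalMeans

open MeasureTheory Filter Topology

variable {L : ℕ} (K : LocalMeans L) {d : ℕ}

/-- The reflected kernel `y ↦ Ψ_m (-y)`. -/
def kernelRefl (m : Fin d → ℕ) : 𝓢(Space d, ℂ) := K.reflectedTranslate m 0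

theorem kernelRefl_apply (m : Fin d → ℕ) (y : Space d) :
    K.kernelRefl m y = K.tensorKernel m (0 - y) := rfl

theorem translate_kernelRefl (m : Fin d → ℕ) (z : Space d) :
    translate (K.kernelRefl m) z = K.reflectedTranslate m z := by
  ext y
  rw [translate_apply, kernelRefl_apply, zero_sub, neg_sub]
  rfl

theorem conv_eq (m : Fin d → ℕ) (T : 𝓢'(Space d, ℂ)) (z : Space d) :
    K.conv m T z = T (translate (K.kernelRefl m) z) := by
  rw [translate_kernelRefl]
  rfl

theorem continuous_conv (m : Fin d → ℕ) (T : 𝓢'(Space d, ℂ)) : Continuous (K.conv m T) := by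
  have : K.conv m T = fun z => T (translate (K.kernelRefl m) z) := funext (K.conv_eq m T)
  rw [this]
  exact continuous_temperedDistribution_translate T _

/-- The reflected dual kernel. -/
def dualRefl (m : Fin d → ℕ) : 𝓢(Space d, ℂ) := 𝓕 (K.tensorDualHat m)

theorem dualRefl_apply (m : Fin d → ℕ) (y : Space d) :
    K.dualRefl m y = K.tensorDual m (-y) := K.fourier_tensorDualHat m y

theorem fourier_dualRefl (m : Fin d → ℕ) (ξ : Space d) :
    𝓕 (K.dualRefl m) ξ = K.tensorDualHat m (-ξ) := by
  have h : 𝓕⁻ (𝓕 (K.tensorDualHat m)) = K.tensorDualHat m :=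
    FourierTransform.fourierInv_fourier_eq _
  conv_rhs => rw [← h]
  rw [SchwartzMap.fourierInv_coe, Real.fourierInv_eq_fourier_neg, neg_neg, SchwartzMap.fourier_coe]
  rfl

theorem fourier_kernelRefl (m : Fin d → ℕ) (ξ : Space d) :
    𝓕 (K.kernelRefl m) ξ = ∏ i, 𝓕 (K.kernel (m i)) (-ξ i) := by
  rw [SchwartzMap.fourier_coe]
  have h1 : (K.kernelRefl m : Space d → ℂ) = fun y => ∏ i, (fun t => K.kernel (m i) (-t)) (y i) := by
    ext y
    rw [kernelRefl_apply, zero_sub]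
    rfl
  rw [h1, fourier_tensor fun i t => K.kernel (m i) (-t)]
  refine Finset.prod_congr rfl fun i _ => ?_
  rw [← Real.fourierInv_eq_fourier_neg, Real.fourierInv_eq_fourier_comp_neg]

theorem fourier_conv_kernelRefl_conv_dualRefl (m : Fin d → ℕ) (φ : 𝓢(Space d, ℂ)) (ξ : Space d) :
    𝓕 (Frolov.conv (K.kernelRefl m) (Frolov.conv (K.dualRefl m) φ)) ξ =
      (∏ i, K.pou (m i) (-ξ i) : ℝ) * 𝓕 φ ξ := by
  rw [fourier_conv, fourier_conv, fourier_kernelRefl, fourier_dualRefl, tensorDualHat_apply,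
    ← mul_assoc, ← Finset.prod_mul_distrib, Complex.ofReal_prod]
  congr 1
  refine Finset.prod_congr rfl fun i _ => ?_
  rw [mul_comm]
  exact K.dualHat_mul_fourier_kernel (m i) (-ξ i)

/-- On the Fourier side the sum over the cube of levels factors into coordinates and telescopes to
the product of bumps dilated by 2^N, a cutoff equal to 1 near the origin. Convergence there is
carried back by the inverse Fourier transform, which is continuous on Schwartz space. -/
theorem tendsto_sum_conv (φ : 𝓢(Space d, ℂ)) :
    Tendsto (fun N => ∑ m ∈ levels d N,
      Frolov.conv (K.kernelRefl m) (Frolov.conv (K.dualRefl m) φ)) atTop (𝓝 φ) := by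
  have hε := K.ε_pos
  have key : Tendsto (fun N => 𝓕 (∑ m ∈ levels d N,
      Frolov.conv (K.kernelRefl m) (Frolov.conv (K.dualRefl m) φ))) atTop (𝓝 (𝓕 φ)) := by
    refine tendsto_of_eq_cutoff_mul (χ := fun ξ : Space d => ((∏ i, K.bump (-ξ i) : ℝ) : ℂ))
      (r := 3 / 5 * K.ε) ?_ ?_ (by positivity) ?_ _ _ fun N ξ => ?_
    · have h1 : ContDiff ℝ ∞ fun ξ : Space d => ∏ i, K.bump (-ξ i) :=
        contDiff_prod fun i _ => K.bump.contDiff.comp (by fun_prop)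
      exact Complex.ofRealCLM.contDiff.comp h1
    · have hc : IsCompact (Set.univ.pi fun i : Fin d => Metric.closedBall (0 : ℝ) (9 / 10 * K.ε)) :=
        isCompact_univ_pi fun i => isCompact_closedBall _ _
      refine HasCompactSupport.intro
        (hc.image (PiLp.continuous_toLp 2 fun _ : Fin d => ℝ)) fun x hx => ?_
      by_contra h
      refine hx ⟨x.ofLp, fun i _ => ?_, rfl⟩
      by_contra hi
      refine h ?_
      rw [Finset.prod_eq_zero (Finset.mem_univ i), Complex.ofReal_zero]
      refine K.bump.zero_of_le_dist ?_
      rw [Metric.mem_closedBall, Real.dist_eq, sub_zero, not_le] at hi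
      rw [Real.dist_eq, sub_zero, abs_neg]
      exact hi.le
    · intro x hx
      rw [Finset.prod_eq_one, Complex.ofReal_one]
      intro i _
      refine K.bump.one_of_mem_closedBall ?_
      rw [Metric.mem_closedBall, Real.dist_eq, sub_zero, abs_neg]
      exact ((PiLp.norm_apply_le x i).trans hx.le)
    · have : ∀ s : Finset (Fin d → ℕ), 𝓕 (∑ m ∈ s,
          Frolov.conv (K.kernelRefl m) (Frolov.conv (K.dualRefl m) φ)) ξ = 
          ∑ m ∈ s, 𝓕 (Frolov.conv (K.kernelRefl m) (Frolov.conv (K.dualRefl m) φ)) ξ := by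
        intro s
        have := map_sum (FourierTransform.fourierCLM ℂ 𝓢(Space d, ℂ))
          (fun m => Frolov.conv (K.kernelRefl m) (Frolov.conv (K.dualRefl m) φ)) s
        simp only [FourierTransform.fourierCLM_apply] at this
        rw [this, _root_.sum_apply]
      rw [this]
      simp only [fourier_conv_kernelRefl_conv_dualRefl]
      rw [← Finset.sum_mul, ← Complex.ofReal_sum, levels,
        Finset.sum_prod_piFinset (Finset.range (N + 1)) fun i j => K.pou j (-ξ i)]
      simp only [sum_pou]
      congr 3
      ext i
      rw [PiLp.smul_apply, smul_eq_mul, div_eq_inv_mul, mul_neg]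
  have h2 := ((FourierTransform.fourierInvCLM ℂ 𝓢(Space d, ℂ)).continuous.tendsto (𝓕 φ)).comp key
  simp only [Function.comp_def, FourierTransform.fourierInvCLM_apply,
    FourierTransform.fourierInv_fourier_eq] at h2
  exact h2

/-- The weak form of T = ∑ Λ_m * (Ψ_m * T): T is applied to the approximation of φ and commuted with
the superposition of translates. -/
theorem tendsto_sum_integral_conv (T : 𝓢'(Space d, ℂ)) (φ : 𝓢(Space d, ℂ)) :
    Tendsto (fun N => ∑ m ∈ levels d N,
      ∫ z, K.conv m T z * ∫ y, K.tensorDual m (y - z) * φ y) atTop (𝓝 (T φ)) := by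
  have h := ((map_continuous T).tendsto φ).comp (K.tendsto_sum_conv φ)
  simp only [Function.comp_def, map_sum, temperedDistribution_conv, ← K.conv_eq, conv_apply,
    dualRefl_apply, neg_sub] at h
  exact h

end LocalMeans

end Frolov

end

noncomputable section

namespace Frolov

open MeasureTheory Filter Topology

/-! ### Levels -/

/-- The level `|m|₁` of a multi-index. -/
def level {d : ℕ} (m : Fin d → ℕ) : ℕ := ∑ i, m i

theorem monotone_levels (d : ℕ) : Monotone (levels d) := fun N M h m hm => by
  simp only [levels, Fintype.mem_piFinset, Finset.mem_range] at hm ⊢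
  exact fun i => (hm i).trans_le (by omega)

theorem tendsto_levels (d : ℕ) : Tendsto (levels d) atTop atTop :=
  tendsto_atTop_finset_of_monotone (monotone_levels d) fun m => ⟨∑ i, m i, by
    simp only [levels, Fintype.mem_piFinset, Finset.mem_range]
    exact fun i => Nat.lt_succ_of_le (Finset.single_le_sum (fun _ _ => Nat.zero_le _)
      (Finset.mem_univ i))⟩

theorem ofReal_two_rpow {d : ℕ} (s : ℝ) (m : Fin d → ℕ) :
    ENNReal.ofReal ((2 : ℝ) ^ (s * ∑ i, (m i : ℝ))) = (2 : ℝ≥0∞) ^ (s * level m) := by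
  rw [← ENNReal.ofReal_rpow_of_pos two_pos, ENNReal.ofReal_ofNat, level, Nat.cast_sum]

theorem summable_two_rpow_level {d : ℕ} {a : ℝ} (ha : 0 < a) :
    Summable fun m : Fin d → ℕ => (2 : ℝ) ^ (-a * level m) := by
  have h1 : ∀ m : Fin d → ℕ, (2 : ℝ) ^ (-a * level m) = ∏ i, ((2 : ℝ) ^ (-a)) ^ m i := fun m => by
    rw [Finset.prod_pow_eq_pow_sum, Real.rpow_mul (by norm_num), Real.rpow_natCast]
    rfl
  have h2 : (2 : ℝ) ^ (-a) < 1 := Real.rpow_lt_one_of_one_lt_of_neg (by norm_num) (by linarith)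
  have h3 : (0 : ℝ) ≤ (2 : ℝ) ^ (-a) := by positivity
  have h : ∑' m : Fin d → ℕ, ENNReal.ofReal ((2 : ℝ) ^ (-a * level m)) ≠ ⊤ := by
    simp only [h1]
    simp only [ENNReal.ofReal_prod_of_nonneg (fun i _ => pow_nonneg h3 _)]
    rw [tsum_fin_prod_eq_prod_tsum fun (_ : Fin d) j => ENNReal.ofReal (((2 : ℝ) ^ (-a)) ^ j)]
    exact ENNReal.prod_ne_top fun i _ => (summable_geometric_of_lt_one h3 h2).tsum_ofReal_ne_top
  have := ENNReal.summable_toReal h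
  simp only [ENNReal.toReal_ofReal (Real.rpow_nonneg zero_le_two _)] at this
  exact this

/-! ### The profile of the dual kernels -/

/-- The dilated Poisson-type kernel `2ʲ (1 + (2ʲ t)²)⁻¹`. -/
def profile (j : ℕ) (t : ℝ) : ℝ := 2 ^ j * (1 + (2 ^ j * t) ^ 2)⁻¹

theorem profile_nonneg (j : ℕ) (t : ℝ) : 0 ≤ profile j t := by unfold profile; positivity

theorem profile_le (j : ℕ) (t : ℝ) : profile j t ≤ 2 ^ j :=
  mul_le_of_le_one_right (by positivity) (inv_le_one_of_one_le₀ (by nlinarith [sq_nonneg (2 ^ j * t)]))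

theorem continuous_profile (j : ℕ) : Continuous (profile j) := by
  unfold profile
  exact continuous_const.mul (Continuous.inv₀ (by fun_prop) fun t => by positivity)

theorem lintegral_profile (j : ℕ) : ∫⁻ t, ENNReal.ofReal (profile j t) = ENNReal.ofReal Real.pi := by
  have h2 : (0 : ℝ) < 2 ^ j := by positivity
  have hi : Integrable (profile j) := (integrable_inv_one_add_sq.comp_mul_left' h2.ne').const_mul _
  rw [← ofReal_integral_eq_lintegral_ofReal hi (ae_of_all _ (profile_nonneg j))]
  unfold profile
  rw [integral_const_mul, Measure.integral_comp_mul_left (fun t : ℝ => (1 + t ^ 2)⁻¹),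
    integral_univ_inv_one_add_sq, abs_of_pos (inv_pos.2 h2), smul_eq_mul, mul_inv_cancel_left₀ h2.ne']

/-- The tensor products of the profiles. -/
def tensorProfile {d : ℕ} (m : Fin d → ℕ) (x : Space d) : ℝ := ∏ i, profile (m i) (x i)

section TensorProfile

variable {d : ℕ} (m : Fin d → ℕ)

theorem tensorProfile_le (x : Space d) : tensorProfile m x ≤ 2 ^ level m := by
  rw [level, ← Finset.prod_pow_eq_pow_sum]
  exact Finset.prod_le_prod (fun i _ => profile_nonneg _ _) fun i _ => profile_le _ _

theorem continuous_tensorProfile : Continuous (tensorProfile m) :=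
  continuous_finsetProd _ fun i _ => (continuous_profile _).comp (by fun_prop)

theorem lintegral_tensorProfile :
    ∫⁻ x, ENNReal.ofReal (tensorProfile m x) = ENNReal.ofReal Real.pi ^ d := by
  unfold tensorProfile
  simp only [ENNReal.ofReal_prod_of_nonneg (fun _ _ => profile_nonneg _ _)]
  rw [lintegral_space_prod (fun i t => ENNReal.ofReal (profile (m i) t))
    fun i => ENNReal.measurable_ofReal.comp (continuous_profile _).measurable]
  simp [lintegral_profile]

/-- Interpolation between the supremum 2^|m| and the L_1 norm π^d. -/
theorem lintegral_tensorProfile_rpow_le {q : ℝ} (hq : 1 ≤ q) (x : Space d) :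
    (∫⁻ z, ENNReal.ofReal (tensorProfile m (x - z)) ^ q) ^ (1 / q) ≤
      2 ^ ((1 - 1 / q) * level m) * (ENNReal.ofReal Real.pi ^ d) ^ (1 / q) := by
  have hq0 : 0 < q := by linarith
  rw [lintegral_sub_left_eq_self (fun z => ENNReal.ofReal (tensorProfile m z) ^ q) x]
  have h1 : ∀ z, ENNReal.ofReal (tensorProfile m z) ^ q ≤
      (2 : ℝ≥0∞) ^ ((q - 1) * level m) * ENNReal.ofReal (tensorProfile m z) := fun z => by
    have h2 : ENNReal.ofReal (tensorProfile m z) ≤ (2 : ℝ≥0∞) ^ (level m : ℝ) := by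
      refine (ENNReal.ofReal_le_ofReal (tensorProfile_le m z)).trans_eq ?_
      rw [ENNReal.ofReal_pow (by norm_num), ENNReal.ofReal_ofNat, ENNReal.rpow_natCast]
    calc ENNReal.ofReal (tensorProfile m z) ^ q
        = ENNReal.ofReal (tensorProfile m z) ^ (q - 1) * ENNReal.ofReal (tensorProfile m z) := by
          conv_lhs => rw [show q = (q - 1) + 1 by ring]
          rw [ENNReal.rpow_add_of_nonneg _ _ (by linarith) (by norm_num), ENNReal.rpow_one]
      _ ≤ ((2 : ℝ≥0∞) ^ (level m : ℝ)) ^ (q - 1) * ENNReal.ofReal (tensorProfile m z) := by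
          gcongr
      _ = _ := by rw [← ENNReal.rpow_mul, mul_comm (level m : ℝ)]
  refine (ENNReal.rpow_le_rpow (lintegral_mono h1) (by positivity)).trans_eq ?_
  rw [lintegral_const_mul' _ _ (by finiteness), lintegral_tensorProfile,
    ENNReal.mul_rpow_of_nonneg _ _ (by positivity), ← ENNReal.rpow_mul]
  congr 2
  field_simp

end TensorProfile

/-! ### Decay of the dual kernels -/

namespace LocalMeans

variable {L : ℕ} (K : LocalMeans L) {d : ℕ}

/-- Schwartz decay of order 4 pays both for the factor 1 + t² and for the profile. The constant 16 =
4² appears because the dual kernel of level j + 1 is dilated by 2^j but the profile by 2^(j+1). -/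
theorem exists_norm_dual_le :
    ∃ C > 0, ∀ j t, (1 + t ^ 2) * ‖K.dual j t‖ ≤ C * profile j t := by
  have h (i : Fin 2) : ∃ C > 0, ∀ t, (1 + t ^ 2) ^ 2 * ‖K.dualSchwartz i t‖ ≤ C := by
    refine ⟨_, lt_of_lt_of_le zero_lt_one (le_max_left 1 (2 ^ ((4, 0) : ℕ × ℕ).1 * ((Finset.Iic ((4, 0) : ℕ × ℕ)).sup
      fun m => SchwartzMap.seminorm ℝ m.1 m.2) (K.dualSchwartz i))), fun t => ?_⟩
    have := SchwartzMap.one_add_le_sup_seminorm_apply (𝕜 := ℝ) (m := (4, 0)) (k := 4) (n := 0)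
      le_rfl le_rfl (K.dualSchwartz i) t
    rw [norm_iteratedFDeriv_zero] at this
    refine le_trans ?_ (this.trans (le_max_right _ _))
    gcongr
    rw [Real.norm_eq_abs, show 4 = 2 * 2 from rfl, pow_mul]
    gcongr
    nlinarith [sq_abs t, abs_nonneg t]
  obtain ⟨C₀, hC₀, h₀⟩ := h 0
  obtain ⟨C₁, hC₁, h₁⟩ := h 1
  have key : ∀ x t D : ℝ, 0 ≤ D → 1 + t ^ 2 ≤ 1 + x ^ 2 → ∀ y : ℝ, 0 ≤ y → (1 + x ^ 2) ^ 2 * y ≤ D →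
      (1 + t ^ 2) * y ≤ D * (1 + x ^ 2)⁻¹ := fun x t D hD hxt y hy h => by
    rw [← div_eq_mul_inv, le_div_iff₀ (by positivity)]
    nlinarith [mul_le_mul_of_nonneg_right hxt hy, sq_nonneg x, sq_nonneg t, mul_nonneg hy (sq_nonneg x)]
  refine ⟨max C₀ (16 * C₁), by positivity, fun j t => ?_⟩
  cases j with
  | zero =>
    have := key t t C₀ hC₀.le le_rfl _ (norm_nonneg _) (h₀ t)
    simp only [dual, profile, pow_zero, one_mul]
    exact this.trans (by gcongr; exact le_max_left _ _)
  | succ j =>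
    have h2 : (1 : ℝ) ≤ 2 ^ j := one_le_pow₀ (by norm_num)
    have h3 := h₁ (2 ^ j * t)
    have := key (2 ^ (j + 1) * t) t (16 * C₁) (by positivity) (by
      rw [mul_pow]
      have : (1 : ℝ) ≤ (2 ^ (j + 1)) ^ 2 := one_le_pow₀ (one_le_pow₀ (by norm_num))
      nlinarith [sq_nonneg t]) _ (norm_nonneg (K.dualSchwartz 1 (2 ^ j * t))) (by
      refine le_trans ?_ (mul_le_mul_of_nonneg_left h3 (by norm_num : (0 : ℝ) ≤ 16))
      rw [← mul_assoc]
      gcongr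
      rw [show (16 : ℝ) = 4 ^ 2 by norm_num, ← mul_pow]
      refine pow_le_pow_left₀ (by positivity) ?_ 2
      rw [pow_succ (2 : ℝ) j]
      nlinarith [sq_nonneg (2 ^ j * t)])
    simp only [dual, profile, norm_mul, norm_pow, Complex.norm_ofNat]
    calc (1 + t ^ 2) * (2 ^ j * ‖K.dualSchwartz 1 (2 ^ j * t)‖)
        = 2 ^ j * ((1 + t ^ 2) * ‖K.dualSchwartz 1 (2 ^ j * t)‖) := by ring
      _ ≤ 2 ^ (j + 1) * (max C₀ (16 * C₁) * (1 + (2 ^ (j + 1) * t) ^ 2)⁻¹) := by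
          refine mul_le_mul (pow_le_pow_right₀ (by norm_num) (Nat.le_succ j))
            (this.trans ?_) (by positivity) (by positivity)
          gcongr
          exact le_max_right _ _
      _ = _ := by ring

theorem exists_weight_mul_norm_tensorDual_le (d : ℕ) : ∃ C > 0, ∀ (m : Fin d → ℕ) (x : Space d),
    weight x.ofLp * ‖K.tensorDual m x‖ ≤ C * tensorProfile m x := by
  obtain ⟨C, hC, h⟩ := K.exists_norm_dual_le
  refine ⟨C ^ d, by positivity, fun m x => ?_⟩
  have hd : C ^ d = ∏ _i : Fin d, C := by simp
  rw [tensorDual, tensorProfile, norm_prod, weight, hd, ← Finset.prod_mul_distrib,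
    ← Finset.prod_mul_distrib]
  exact Finset.prod_le_prod (fun i _ => by positivity) fun i _ => h _ _

theorem continuous_tensorDual (m : Fin d → ℕ) : Continuous (K.tensorDual m) := by
  have : K.tensorDual m = fun x : Space d => K.dualRefl m (-x) := by
    ext x; rw [dualRefl_apply, neg_neg]
  rw [this]
  exact (K.dualRefl m).continuous.comp continuous_neg

/-! ### Blocks of a distribution in the reproducing formula -/

/-- The function whose `L_p` norm is the norm of the mixed Sobolev space. -/
def square (s : ℝ) (T : 𝓢'(Space d, ℂ)) (z : Space d) : ℝ≥0∞ :=
  (∑' m : Fin d → ℕ, ((2 : ℝ≥0∞) ^ (s * level m) * ‖K.conv m T z‖ₑ) ^ (2 : ℝ)) ^ (1 / (2 : ℝ))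

theorem sobolevNorm_eq (s p : ℝ) (T : 𝓢'(Space d, ℂ)) :
    K.sobolevNorm s p T = (∫⁻ z, K.square s T z ^ p) ^ (1 / p) := by
  simp only [sobolevNorm, triebelLizorkinNorm, square, ofReal_two_rpow]

theorem enorm_conv_le_square (s : ℝ) (T : 𝓢'(Space d, ℂ)) (m : Fin d → ℕ) (z : Space d) :
    ‖K.conv m T z‖ₑ ≤ 2 ^ (-s * level m) * K.square s T z := by
  have h1 : (2 : ℝ≥0∞) ^ (s * level m) * ‖K.conv m T z‖ₑ ≤ K.square s T z := by
    have := ENNReal.rpow_le_rpow (ENNReal.le_tsum (f := fun m : Fin d → ℕ =>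
      ((2 : ℝ≥0∞) ^ (s * level m) * ‖K.conv m T z‖ₑ) ^ (2 : ℝ)) m)
      (by positivity : (0 : ℝ) ≤ 1 / 2)
    rw [← ENNReal.rpow_mul] at this
    norm_num at this
    rw [square]
    norm_num
    exact this
  refine le_trans (le_of_eq ?_) (mul_le_mul_right h1 _)
  rw [← mul_assoc, ← ENNReal.rpow_add _ _ (by norm_num) (by norm_num)]
  simp

theorem lintegral_conv_rpow_le {p : ℝ} (hp : 1 ≤ p) (s : ℝ) (T : 𝓢'(Space d, ℂ)) (m : Fin d → ℕ) :
    (∫⁻ z, ‖K.conv m T z‖ₑ ^ p) ^ (1 / p) ≤ 2 ^ (-s * level m) * K.sobolevNorm s p T := by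
  have hp0 : 0 < p := by linarith
  rw [sobolevNorm_eq]
  calc (∫⁻ z, ‖K.conv m T z‖ₑ ^ p) ^ (1 / p)
      ≤ (∫⁻ z, (2 ^ (-s * level m)) ^ p * K.square s T z ^ p) ^ (1 / p) := by
        refine ENNReal.rpow_le_rpow (lintegral_mono fun z => ?_) (by positivity)
        rw [← ENNReal.mul_rpow_of_nonneg _ _ hp0.le]
        exact ENNReal.rpow_le_rpow (K.enorm_conv_le_square s T m z) hp0.le
    _ = _ := by
        rw [lintegral_const_mul' _ _ (by finiteness), ENNReal.mul_rpow_of_nonneg _ _ (by positivity),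
          ← ENNReal.rpow_mul, mul_one_div_cancel hp0.ne', ENNReal.rpow_one]

/-- The block of level `m` in the reproducing formula. -/
def block (m : Fin d → ℕ) (T : 𝓢'(Space d, ℂ)) (x : Space d) : ℂ :=
  ∫ z, K.tensorDual m (x - z) * K.conv m T z

end LocalMeans

end Frolov

end

noncomputable section

namespace Frolov

open MeasureTheory Filter Topology

/-! ### Sums over admissible point sets -/

section Lattice

variable {d : ℕ}

/-- The constant `3ᵈ ∑_{a ∈ ℤᵈ} ∏ (1 + a_i²)⁻¹`. -/
def sumConst (d : ℕ) : ℝ≥0∞ :=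
  ∑' a : Fin d → ℤ, ENNReal.ofReal (3 ^ d * (weight fun i => (a i : ℝ))⁻¹)

theorem sumConst_ne_top (d : ℕ) : sumConst d ≠ ⊤ :=
  (summable_inv_weight_int.mul_left _).tsum_ofReal_ne_top

theorem inv_weight_le_floor (y : Fin d → ℝ) :
    (weight y)⁻¹ ≤ 3 ^ d * (weight fun i => (⌊y i⌋ : ℝ))⁻¹ := by
  have hd : (3 : ℝ) ^ d = ∏ _i : Fin d, (3 : ℝ) := by simp
  rw [weight, weight, ← Finset.prod_inv_distrib, ← Finset.prod_inv_distrib, hd,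
    ← Finset.prod_mul_distrib]
  refine Finset.prod_le_prod (fun i _ => by positivity) fun i _ => ?_
  rw [← div_eq_mul_inv, inv_eq_one_div, div_le_div_iff₀ (by positivity) (by positivity)]
  have h1 := Int.floor_le (y i)
  have h2 := Int.lt_floor_add_one (y i)
  nlinarith [sq_nonneg (y i + (y i - ⌊y i⌋)), sq_nonneg (y i - (y i - ⌊y i⌋))]

/-- Two points in the same translated unit cell differ by at most 1 in each coordinate, so the
product condition forces their first coordinates to differ by at least δ. Cutting the cell into M >
1/δ slabs in that coordinate leaves at most one point per slab, hence an injection into ℤ^d × {0,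
..., M-1}, and the sum is at most M copies of the sum over ℤ^d. -/
theorem tsum_inv_weight_le {ι : Type*} (hd : 1 ≤ d) (x : ι → Fin d → ℝ) {δ : ℝ} (hδ : 0 < δ)
    (hδ1 : δ ≤ 1) (hx : ∀ k l, k ≠ l → δ ≤ ∏ i, |x k i - x l i|) (v : Fin d → ℝ) :
    ∑' k, ENNReal.ofReal (weight (x k - v))⁻¹ ≤ ENNReal.ofReal (2 / δ) * sumConst d := by
  set M : ℕ := ⌊1 / δ⌋₊ + 1 with hM
  have hM1 : 1 / δ < M := by rw [hM]; push_cast; exact Nat.lt_floor_add_one _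
  have hM0 : (0 : ℝ) < M := lt_trans (by positivity) hM1
  have hM2 : (M : ℝ) ≤ 2 / δ := by
    rw [hM]; push_cast
    have := Nat.floor_le (by positivity : 0 ≤ 1 / δ)
    have h1 : 1 ≤ 1 / δ := by rw [le_div_iff₀ hδ]; linarith
    have h2 : 2 / δ = 1 / δ + 1 / δ := by ring
    linarith
  let i₀ : Fin d := ⟨0, hd⟩
  let c : ι → (Fin d → ℤ) × Fin M := fun k => (fun i => ⌊(x k - v) i⌋,
    ⟨⌊Int.fract ((x k - v) i₀) * M⌋₊, by
      rw [Nat.floor_lt (mul_nonneg (Int.fract_nonneg _) hM0.le)]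
      have := Int.fract_lt_one ((x k - v) i₀)
      nlinarith⟩)
  have hc : Function.Injective c := by
    intro k l hkl
    by_contra hne
    have h := hx k l hne
    have h1 : ∀ i, |x k i - x l i| ≤ 1 := fun i => by
      have := congrFun (congrArg Prod.fst hkl) i
      have := Int.abs_sub_lt_one_of_floor_eq_floor this
      simpa using this.le
    have h2 : |x k i₀ - x l i₀| < δ := by
      have e1 : ⌊(x k - v) i₀⌋ = ⌊(x l - v) i₀⌋ := congrFun (congrArg Prod.fst hkl) i₀
      have e2 : ⌊Int.fract ((x k - v) i₀) * M⌋₊ = ⌊Int.fract ((x l - v) i₀) * M⌋₊ := by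
        have := congrArg Prod.snd hkl
        simpa [c] using this
      have a1 := Nat.floor_le (mul_nonneg (Int.fract_nonneg ((x k - v) i₀)) hM0.le)
      have a2 := Nat.lt_floor_add_one (Int.fract ((x k - v) i₀) * M)
      have b1 := Nat.floor_le (mul_nonneg (Int.fract_nonneg ((x l - v) i₀)) hM0.le)
      have b2 := Nat.lt_floor_add_one (Int.fract ((x l - v) i₀) * M)
      rw [e2] at a1 a2
      have h3 : |Int.fract ((x k - v) i₀) - Int.fract ((x l - v) i₀)| * M < 1 := by
        have e : ∀ y : ℝ, |y| * M = |y * M| := fun y => by rw [abs_mul, abs_of_pos hM0]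
        rw [e, abs_lt]
        constructor <;> nlinarith
      have h4 : x k i₀ - x l i₀ = Int.fract ((x k - v) i₀) - Int.fract ((x l - v) i₀) := by
        have e3 := congrArg (fun a : ℤ => (a : ℝ)) e1
        simp only [Pi.sub_apply] at e3
        simp only [Int.fract, Pi.sub_apply]
        linarith
      rw [h4]
      rw [div_lt_iff₀ hδ] at hM1
      by_contra! hge
      nlinarith
    have h5 : ∏ i, |x k i - x l i| ≤ |x k i₀ - x l i₀| := by
      rw [← Finset.mul_prod_erase _ _ (Finset.mem_univ i₀)]
      exact mul_le_of_le_one_right (abs_nonneg _)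
        (Finset.prod_le_one (fun i _ => abs_nonneg _) fun i _ => h1 i)
    linarith
  calc ∑' k, ENNReal.ofReal (weight (x k - v))⁻¹
      ≤ ∑' k, (fun p : (Fin d → ℤ) × Fin M =>
          ENNReal.ofReal (3 ^ d * (weight fun i => (p.1 i : ℝ))⁻¹)) (c k) :=
        ENNReal.tsum_le_tsum fun k => ENNReal.ofReal_le_ofReal (inv_weight_le_floor _)
    _ ≤ ∑' p : (Fin d → ℤ) × Fin M, ENNReal.ofReal (3 ^ d * (weight fun i => (p.1 i : ℝ))⁻¹) :=
        ENNReal.tsum_comp_le_tsum_of_injective hc _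
    _ = M * sumConst d := by
        rw [ENNReal.tsum_prod', ENNReal.tsum_comm]
        simp [sumConst]
    _ ≤ _ := by
        gcongr
        rw [← ENNReal.ofReal_natCast]
        exact ENNReal.ofReal_le_ofReal hM2

/-- The lattice point `T_n k`. -/
def latticePoint (d n : ℕ) (k : Fin d → ℤ) : Space d :=
  WithLp.toLp 2 ((generator d n).mulVec fun i => (k i : ℝ))

theorem latticePoint_ofLp (n : ℕ) (k : Fin d → ℤ) :
    (latticePoint d n k).ofLp = (generator d n).mulVec fun i => (k i : ℝ) := rfl

theorem exists_div_le_prod_abs_latticePoint_sub (hd : 1 ≤ d) : ∃ c > 0, c ≤ 1 ∧ ∀ n : ℕ, 1 ≤ n →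
    ∀ k l : Fin d → ℤ, k ≠ l → c / n ≤ ∏ i, |latticePoint d n k i - latticePoint d n l i| := by
  obtain ⟨c, hc, h⟩ := exists_div_le_prod_abs_generator_mulVec hd
  refine ⟨min c 1, by positivity, min_le_right _ _, fun n hn k l hkl => ?_⟩
  refine le_trans ?_ ((h n hn (k - l) (sub_ne_zero.2 hkl)).trans_eq ?_)
  · gcongr
    exact min_le_left _ _
  · refine Finset.prod_congr rfl fun i _ => ?_
    congr 1
    rw [latticePoint_ofLp, latticePoint_ofLp, ← Pi.sub_apply, ← Matrix.mulVec_sub]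
    congr 1
    ext j
    simp

theorem latticePoint_injective (hd : 1 ≤ d) {n : ℕ} (hn : 1 ≤ n) :
    Function.Injective (latticePoint d n) := by
  obtain ⟨c, hc, -, h⟩ := exists_div_le_prod_abs_latticePoint_sub hd
  intro k l hkl
  by_contra hne
  have := h n hn k l hne
  rw [hkl] at this
  have h0 : ∏ i : Fin d, |latticePoint d n l i - latticePoint d n l i| = 0 :=
    Finset.prod_eq_zero (Finset.mem_univ ⟨0, hd⟩) (by simp)
  rw [h0] at this
  have : 0 < c / n := by positivity
  linarith

/-- The lattice is separated with δ = c/n, which costs the factor n. -/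
theorem exists_tsum_inv_weight_latticePoint_le (hd : 1 ≤ d) : ∃ C : ℝ≥0∞, C ≠ ⊤ ∧
    ∀ n : ℕ, 1 ≤ n → ∑' k, ENNReal.ofReal (weight (latticePoint d n k).ofLp)⁻¹ ≤ n * C := by
  obtain ⟨c, hc, hc1, h⟩ := exists_div_le_prod_abs_latticePoint_sub hd
  refine ⟨ENNReal.ofReal (2 / c) * sumConst d, by have := sumConst_ne_top d; finiteness,
    fun n hn => ?_⟩
  have hn0 : (1 : ℝ) ≤ n := by exact_mod_cast hn
  have := tsum_inv_weight_le hd (fun k => (latticePoint d n k).ofLp) (δ := c / n) (by positivity)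
    ((div_le_one (by positivity)).2 (by linarith)) (h n hn) 0
  simp only [sub_zero] at this
  refine this.trans_eq ?_
  rw [← mul_assoc, ← ENNReal.ofReal_natCast, ← ENNReal.ofReal_mul (by positivity)]
  congr 2
  field_simp

/-- Dilating the i-th coordinate by 2^(m_i) multiplies products of coordinate differences by 2^|m| ≥
c₀n. The dilated lattice is therefore separated with a δ independent of n and m, and the profile
becomes 2^|m| times the inverse weight. -/
theorem exists_tsum_tensorProfile_latticePoint_le (hd : 1 ≤ d) {c₀ : ℝ} (hc₀ : 0 < c₀) :
    ∃ C : ℝ≥0∞, C ≠ ⊤ ∧ ∀ n : ℕ, 1 ≤ n → ∀ m : Fin d → ℕ, c₀ * n ≤ 2 ^ level m → ∀ z : Space d,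
      ∑' k, ENNReal.ofReal (tensorProfile m (latticePoint d n k - z)) ≤ 2 ^ level m * C := by
  obtain ⟨c, hc, hc1, h⟩ := exists_div_le_prod_abs_latticePoint_sub hd
  set δ : ℝ := min 1 (c₀ * c) with hδ
  have hδ0 : 0 < δ := by positivity
  refine ⟨ENNReal.ofReal (2 / δ) * sumConst d, by have := sumConst_ne_top d; finiteness,
    fun n hn m hm z => ?_⟩
  have hn0 : (1 : ℝ) ≤ n := by exact_mod_cast hn
  have key := tsum_inv_weight_le hd (fun k i => 2 ^ m i * latticePoint d n k i) hδ0
    (min_le_left _ _) (fun k l hkl => by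
      simp only [← mul_sub, abs_mul, Finset.prod_mul_distrib]
      have h1 : ∏ i, |(2 : ℝ) ^ m i| = 2 ^ level m := by
        simp only [abs_pow, abs_two]
        exact Finset.prod_pow_eq_pow_sum _ _ _
      rw [h1]
      calc δ ≤ c₀ * c := min_le_right _ _
        _ = (c₀ * n) * (c / n) := by field_simp
        _ ≤ _ := mul_le_mul hm (h n hn k l hkl) (by positivity) (by positivity))
    (fun i => 2 ^ m i * z i)
  have e : ∀ k, ENNReal.ofReal (tensorProfile m (latticePoint d n k - z)) = 2 ^ level m *
      ENNReal.ofReal (weight ((fun i => 2 ^ m i * latticePoint d n k i) - fun i => 2 ^ m i * z i))⁻¹ :=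
    fun k => by
      have h2 : (2 : ℝ≥0∞) ^ level m = ENNReal.ofReal (2 ^ level m) := by
        rw [ENNReal.ofReal_pow (by norm_num), ENNReal.ofReal_ofNat]
      rw [h2, ← ENNReal.ofReal_mul (by positivity), level, ← Finset.prod_pow_eq_pow_sum, weight,
        ← Finset.prod_inv_distrib, ← Finset.prod_mul_distrib]
      congr 1
      refine Finset.prod_congr rfl fun i _ => ?_
      rw [profile, Pi.sub_apply, ← mul_sub]
      rfl
  simp only [e]
  rw [ENNReal.tsum_mul_left]
  gcongr

theorem finite_latticePoint_mem_closedCube (hd : 1 ≤ d) {n : ℕ} (hn : 1 ≤ n) :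
    {k | latticePoint d n k ∈ closedCube d}.Finite := by
  have hdet : IsUnit (generator d n).det := by
    rw [det_generator hd hn]
    exact isUnit_iff_ne_zero.2 (by positivity)
  set B := (generator d n)⁻¹
  set C : ℝ := ∑ i, ∑ j, |B i j| with hC
  refine (Set.finite_Icc (fun _ : Fin d => ⌊-C⌋) (fun _ => ⌈C⌉)).subset fun k hk => ?_
  have h1 : (fun i => (k i : ℝ)) = B.mulVec (latticePoint d n k).ofLp := by
    rw [latticePoint_ofLp, Matrix.mulVec_mulVec, Matrix.nonsing_inv_mul _ hdet, Matrix.one_mulVec]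
  have h2 : ∀ i, |(k i : ℝ)| ≤ C := fun i => by
    have e : (k i : ℝ) = ∑ j, B i j * latticePoint d n k j := congrFun h1 i
    rw [e]
    calc |∑ j, B i j * latticePoint d n k j| ≤ ∑ j, |B i j * latticePoint d n k j| :=
          Finset.abs_sum_le_sum_abs _ _
      _ ≤ ∑ j, |B i j| := Finset.sum_le_sum fun j _ => by
          have hkj : latticePoint d n k j ∈ Set.Icc (0 : ℝ) 1 := hk j
          rw [abs_mul, abs_of_nonneg hkj.1]
          exact mul_le_of_le_one_right (abs_nonneg _) hkj.2
      _ ≤ C := Finset.single_le_sum (f := fun i => ∑ j, |B i j|)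
          (fun i _ => Finset.sum_nonneg fun j _ => abs_nonneg _) (Finset.mem_univ i)
  refine ⟨fun i => ?_, fun i => ?_⟩
  · have := (abs_le.1 (h2 i)).1
    have h3 : (⌊-C⌋ : ℝ) ≤ k i := (Int.floor_le _).trans this
    exact_mod_cast h3
  · have := (abs_le.1 (h2 i)).2
    have h3 : (k i : ℝ) ≤ ⌈C⌉ := this.trans (Int.le_ceil _)
    exact_mod_cast h3

end Lattice

end Frolov

end

/-! ### Decay of the blocks and the continuous representative -/

noncomputable section

namespace Frolov

open MeasureTheory Filter Topology

/-- The box `[-R, R]ᵈ`. -/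
def box (d : ℕ) (R : ℝ) : Set (Space d) := {z | ∀ i, |z i| ≤ R}

theorem isCompact_box (d : ℕ) (R : ℝ) : IsCompact (box d R) := by
  have hc : IsCompact (Set.univ.pi fun _ : Fin d => Set.Icc (-R) R) :=
    isCompact_univ_pi fun _ => isCompact_Icc
  convert hc.image (PiLp.continuous_toLp 2 fun _ : Fin d => ℝ)
  ext x
  constructor
  · exact fun hx => ⟨x.ofLp, fun i _ => abs_le.1 (hx i), rfl⟩
  · rintro ⟨y, hy, rfl⟩ i
    exact abs_le.2 (hy i trivial)

namespace LocalMeans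

variable {L : ℕ} (K : LocalMeans L) {d : ℕ}

/-- For z in a fixed box, Peetre's inequality replaces the weight at x by the weight at x - z. -/
theorem exists_weight_mul_norm_tensorDual_sub_le (d : ℕ) (R : ℝ) : ∃ C > 0, ∀ (m : Fin d → ℕ)
    (x z : Space d), z ∈ box d R →
      weight x.ofLp * ‖K.tensorDual m (x - z)‖ ≤ C * tensorProfile m (x - z) := by
  obtain ⟨C, hC, h⟩ := K.exists_weight_mul_norm_tensorDual_le d
  refine ⟨2 ^ d * (1 + R ^ 2) ^ d * C, by positivity, fun m x z hz => ?_⟩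
  have h1 : weight z.ofLp ≤ (1 + R ^ 2) ^ d := by
    have hd : (1 + R ^ 2) ^ d = ∏ _i : Fin d, (1 + R ^ 2) := by simp
    rw [hd, weight]
    refine Finset.prod_le_prod (fun i _ => by positivity) fun i _ => ?_
    have := hz i
    rw [← sq_abs (z i)]
    gcongr
  have h2 := weight_add_le (x - z).ofLp z.ofLp
  rw [← WithLp.ofLp_add, sub_add_cancel] at h2
  have h3 := weight_pos (x - z).ofLp
  calc weight x.ofLp * ‖K.tensorDual m (x - z)‖
      ≤ (2 ^ d * weight (x - z).ofLp * (1 + R ^ 2) ^ d) * ‖K.tensorDual m (x - z)‖ := by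
        gcongr
        exact h2.trans (by gcongr)
    _ = 2 ^ d * (1 + R ^ 2) ^ d * (weight (x - z).ofLp * ‖K.tensorDual m (x - z)‖) := by ring
    _ ≤ 2 ^ d * (1 + R ^ 2) ^ d * (C * tensorProfile m (x - z)) := by
        exact mul_le_mul_of_nonneg_left (h m _) (by positivity)
    _ = _ := by ring

theorem exists_mem_box_of_conv_ne_zero (d : ℕ) : ∃ R > 0, ∀ (T : 𝓢'(Space d, ℂ)),
    Distribution.dsupport T ⊆ closedCube d → ∀ (m : Fin d → ℕ) (z : Space d),
      K.conv m T z ≠ 0 → z ∈ box d R := K.exists_abs_le_of_conv_ne_zero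

theorem hasCompactSupport_conv {T : 𝓢'(Space d, ℂ)} (hT : Distribution.dsupport T ⊆ closedCube d)
    (m : Fin d → ℕ) : HasCompactSupport (K.conv m T) := by
  obtain ⟨R, -, h⟩ := K.exists_mem_box_of_conv_ne_zero d
  refine HasCompactSupport.intro (isCompact_box d R) fun z hz => ?_
  by_contra hne
  exact hz (h T hT m z hne)

theorem integrable_conv {T : 𝓢'(Space d, ℂ)} (hT : Distribution.dsupport T ⊆ closedCube d)
    (m : Fin d → ℕ) : Integrable (K.conv m T) :=
  (K.continuous_conv m T).integrable_of_hasCompactSupport (K.hasCompactSupport_conv hT m)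

theorem exists_norm_tensorDual_le (m : Fin d → ℕ) : ∃ C, 0 ≤ C ∧ ∀ x, ‖K.tensorDual m x‖ ≤ C := by
  refine ⟨SchwartzMap.seminorm ℝ 0 0 (K.dualRefl m), apply_nonneg _ _, fun x => ?_⟩
  have := SchwartzMap.norm_le_seminorm ℝ (K.dualRefl m) (-x)
  rwa [dualRefl_apply, neg_neg] at this

theorem integrable_tensorDual (m : Fin d → ℕ) : Integrable (K.tensorDual m : Space d → ℂ) := by
  have := ((K.dualRefl m).integrable (μ := volume)).comp_neg
  simpa only [dualRefl_apply, neg_neg] using this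

theorem continuous_block {T : 𝓢'(Space d, ℂ)} (hT : Distribution.dsupport T ⊆ closedCube d)
    (m : Fin d → ℕ) : Continuous (K.block m T) := by
  obtain ⟨C, hC0, hC⟩ := K.exists_norm_tensorDual_le m
  have h1 := K.continuous_tensorDual m
  have h2 := K.continuous_conv m T
  refine continuous_of_dominated (bound := fun z => C * ‖K.conv m T z‖)
    (fun x => Continuous.aestronglyMeasurable (by fun_prop)) (fun x => ae_of_all _ fun z => ?_)
    ((K.integrable_conv hT m).norm.const_mul _) (ae_of_all _ fun z => by fun_prop)
  rw [norm_mul]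
  gcongr
  exact hC _

/-- The integral of a convolution is the product of the integrals. -/
theorem integral_block (T : 𝓢'(Space d, ℂ)) (hT : Distribution.dsupport T ⊆ closedCube d)
    (m : Fin d → ℕ) :
    ∫ x, K.block m T x = ∫ z, K.conv m T z * ∫ y : Space d, K.tensorDual m y := by
  have := integral_convolution (μ := (volume : Measure (Space d))) (ν := (volume : Measure (Space d)))
    (ContinuousLinearMap.mul ℂ ℂ) (K.integrable_conv hT m)
    (K.integrable_tensorDual m)
  rw [integral_mul_const]
  refine Eq.trans ?_ this
  refine integral_congr_ae (ae_of_all _ fun x => ?_)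
  simp only [block, convolution_def, ContinuousLinearMap.mul_apply']
  exact integral_congr_ae (ae_of_all _ fun z => mul_comm _ _)

theorem integral_conv_mul_integral {T : 𝓢'(Space d, ℂ)}
    (hT : Distribution.dsupport T ⊆ closedCube d) (m : Fin d → ℕ) (φ : 𝓢(Space d, ℂ)) :
    ∫ z, K.conv m T z * ∫ y, K.tensorDual m (y - z) * φ y = ∫ y, φ y * K.block m T y := by
  obtain ⟨C, hC0, hC⟩ := K.exists_norm_tensorDual_le m
  have h1 := K.continuous_tensorDual m
  simp only [block, ← integral_const_mul]
  rw [integral_integral_swap]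
  · refine integral_congr_ae (ae_of_all _ fun y => integral_congr_ae (ae_of_all _ fun z => ?_))
    simp only
    ring
  · have h := (K.integrable_conv hT m).mul_prod (φ.integrable (μ := volume))
    refine (h.bdd_mul (c := C) (f := fun p : Space d × Space d => K.tensorDual m (p.2 - p.1))
      (Continuous.aestronglyMeasurable (by fun_prop)) (ae_of_all _ fun p => hC _)).congr
      (ae_of_all _ fun p => ?_)
    simp only [Function.uncurry]
    ring

/-- Each block decays, with a bound by the Sobolev norm. -/
theorem exists_weight_mul_block_le (d : ℕ) {p : ℝ} (hp : 1 < p) : ∃ C : ℝ≥0∞, C ≠ ⊤ ∧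
    ∀ (s : ℝ) (T : 𝓢'(Space d, ℂ)), Distribution.dsupport T ⊆ closedCube d →
      ∀ (m : Fin d → ℕ) (x : Space d), ENNReal.ofReal (weight x.ofLp) * ‖K.block m T x‖ₑ ≤
        C * (2 ^ (-(s - 1 / p) * level m) * K.sobolevNorm s p T) := by
  obtain ⟨R, hR, hbox⟩ := K.exists_mem_box_of_conv_ne_zero d
  obtain ⟨C, hC, h⟩ := K.exists_weight_mul_norm_tensorDual_sub_le d R
  obtain ⟨q, hpq⟩ : ∃ q, p.HolderConjugate q := ⟨_, Real.HolderConjugate.conjExponent hp⟩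
  refine ⟨ENNReal.ofReal C * (ENNReal.ofReal Real.pi ^ d) ^ (1 / q), by
    have := hpq.symm.pos
    finiteness, fun s T hT m x => ?_⟩
  have hm := (continuous_tensorProfile m).measurable
  have hg := (K.continuous_conv m T).measurable
  calc ENNReal.ofReal (weight x.ofLp) * ‖K.block m T x‖ₑ
      ≤ ENNReal.ofReal (weight x.ofLp) * ∫⁻ z, ‖K.tensorDual m (x - z) * K.conv m T z‖ₑ := by
        gcongr
        exact enorm_integral_le_lintegral_enorm _
    _ = ∫⁻ z, ENNReal.ofReal (weight x.ofLp) * ‖K.tensorDual m (x - z) * K.conv m T z‖ₑ := by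
        rw [lintegral_const_mul' _ _ ENNReal.ofReal_ne_top]
    _ ≤ ∫⁻ z, ENNReal.ofReal C * (ENNReal.ofReal (tensorProfile m (x - z)) * ‖K.conv m T z‖ₑ) := by
        refine lintegral_mono fun z => ?_
        by_cases hz : K.conv m T z = 0
        · simp [hz]
        · rw [enorm_mul, ← mul_assoc, ← mul_assoc, ← ENNReal.ofReal_mul hC.le, ← ofReal_norm,
            ← ENNReal.ofReal_mul (weight_pos _).le]
          exact mul_le_mul' (ENNReal.ofReal_le_ofReal (h m x z (hbox T hT m z hz))) le_rfl
    _ = ENNReal.ofReal C * ∫⁻ z, ((fun z => ‖K.conv m T z‖ₑ) *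
          fun z => ENNReal.ofReal (tensorProfile m (x - z))) z := by
        rw [lintegral_const_mul' _ _ ENNReal.ofReal_ne_top]
        simp only [Pi.mul_apply, mul_comm]
    _ ≤ ENNReal.ofReal C * ((∫⁻ z, ‖K.conv m T z‖ₑ ^ p) ^ (1 / p) *
          (∫⁻ z, ENNReal.ofReal (tensorProfile m (x - z)) ^ q) ^ (1 / q)) := by
        gcongr
        exact ENNReal.lintegral_mul_le_Lp_mul_Lq _ hpq (by fun_prop) (by fun_prop)
    _ ≤ ENNReal.ofReal C * ((2 ^ (-s * level m) * K.sobolevNorm s p T) *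
          (2 ^ ((1 - 1 / q) * level m) * (ENNReal.ofReal Real.pi ^ d) ^ (1 / q))) := by
        gcongr
        · exact K.lintegral_conv_rpow_le hp.le s T m
        · exact lintegral_tensorProfile_rpow_le m hpq.symm.lt.le x
    _ = _ := by
        -- Here 1 - 1/q = 1/p: passing from L_p to the supremum norm costs 2^(|m|/p).
        have e : -(s - 1 / p) * (level m : ℝ) = -s * level m + (1 - 1 / q) * level m := by
          have := hpq.inv_add_inv_eq_one
          simp only [one_div]
          rw [← this]
          ring
        rw [e, ENNReal.rpow_add _ _ (by norm_num) (by norm_num)]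
        ring

variable {p s : ℝ}

/-- This is where s > 1/p is used: the block bounds 2^(-(s - 1/p)|m|) are summable over all m. -/
theorem exists_summable_norm_block_le (hp : 1 < p) (hs : 1 / p < s) {T : 𝓢'(Space d, ℂ)}
    (hT : T ∈ K.sobolevCube d s p) : ∃ u : (Fin d → ℕ) → ℝ, Summable u ∧ (∀ m, 0 ≤ u m) ∧
      ∀ m x, ‖K.block m T x‖ ≤ u m * (weight x.ofLp)⁻¹ := by
  obtain ⟨C, hC, h⟩ := K.exists_weight_mul_block_le d hp
  have hN : K.sobolevNorm s p T ≠ ⊤ := hT.1.ne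
  refine ⟨fun m => C.toReal * (2 ^ (-(s - 1 / p) * level m) * (K.sobolevNorm s p T).toReal),
    ((summable_two_rpow_level (by linarith)).mul_right _).mul_left _, fun m => by positivity,
    fun m x => ?_⟩
  have h1 := ENNReal.toReal_mono (by finiteness) (h s T hT.2 m x)
  rw [ENNReal.toReal_mul, ENNReal.toReal_ofReal (weight_pos _).le, toReal_enorm, ENNReal.toReal_mul,
    ENNReal.toReal_mul, ← ENNReal.toReal_rpow, ENNReal.toReal_ofNat] at h1
  rwa [← div_eq_mul_inv, le_div_iff₀ (weight_pos _), mul_comm]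

/-- The elements of the Sobolev space are bounded continuous functions. -/
theorem exists_isRepresentedBy (hp : 1 < p) (hs : 1 / p < s) {T : 𝓢'(Space d, ℂ)}
    (hT : T ∈ K.sobolevCube d s p) : ∃ f : Space d →ᵇ ℂ, IsRepresentedBy T f ∧
      ∀ x, HasSum (fun m => K.block m T x) (f x) := by
  obtain ⟨u, hu, hu0, h⟩ := K.exists_summable_norm_block_le hp hs hT
  have h' : ∀ m x, ‖K.block m T x‖ ≤ u m := fun m x =>
    (h m x).trans (mul_le_of_le_one_right (hu0 m) (inv_le_one_of_one_le₀ (one_le_weight _)))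
  have hsum : ∀ x, HasSum (fun m => K.block m T x) (∑' m, K.block m T x) := fun x =>
    (Summable.of_norm_bounded hu fun m => h' m x).hasSum
  let f : Space d →ᵇ ℂ := BoundedContinuousFunction.ofNormedAddCommGroup
    (fun x => ∑' m, K.block m T x) (continuous_tsum (fun m => K.continuous_block hT.2 m) hu h')
    (∑' m, u m) fun x => tsum_of_norm_bounded hu.hasSum fun m => h' m x
  refine ⟨f, fun φ => ?_, hsum⟩
  -- The reproducing formula converges along cubes of levels; absolute convergence identifies that
  -- limit with the integral against the sum of the blocks.
  refine tendsto_nhds_unique (K.tendsto_sum_integral_conv T φ) ?_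
  simp only [K.integral_conv_mul_integral hT.2]
  have hi : HasSum (fun m => ∫ y, φ y * K.block m T y) (∫ y, φ y * f y) := by
    have hm : ∀ m y, ‖φ y * K.block m T y‖ ≤ u m * ‖φ y‖ := fun m y => by
      rw [norm_mul, mul_comm]
      gcongr
      exact h' m y
    refine hasSum_integral_of_dominated_convergence (bound := fun m y => u m * ‖φ y‖)
      (fun m => Continuous.aestronglyMeasurable ?_) (fun m => ae_of_all _ fun y => hm m y)
      (ae_of_all _ fun y => hu.mul_right _) ?_ (ae_of_all _ fun y => (hsum y).mul_left _)
    · exact φ.continuous.mul (K.continuous_block hT.2 m)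
    · simp only [tsum_mul_right]
      exact (φ.integrable (μ := volume)).norm.const_mul _
  exact hi.comp (tendsto_levels d)

end LocalMeans

end Frolov

end

noncomputable section

namespace Frolov

open MeasureTheory Filter Topology

variable {d : ℕ}

/-! ### Continuous representatives -/

section Representatives

theorem eq_zero_of_integral_mul_eq_zero {f : Space d → ℂ} (hf : Continuous f) {U : Set (Space d)}
    (hU : IsOpen U) (h : ∀ φ : 𝓢(Space d, ℂ), HasCompactSupport φ → tsupport φ ⊆ U →
      ∫ x, φ x * f x = 0) : ∀ x ∈ U, f x = 0 := by
  have h1 : ∀ᵐ x, x ∈ U → f x = 0 := by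
    refine hU.ae_eq_zero_of_integral_contDiff_smul_eq_zero
      (hf.locallyIntegrable.locallyIntegrableOn U) fun g hg hc hgU => ?_
    have hcc : HasCompactSupport fun x => (g x : ℂ) := hc.comp_left Complex.ofReal_zero
    have hsub : tsupport (fun x => (g x : ℂ)) ⊆ tsupport g :=
      closure_mono fun x hx (h0 : g x = 0) => hx (by simp [h0])
    have := h (hcc.toSchwartzMap (Complex.ofRealCLM.contDiff.comp hg)) hcc (hsub.trans hgU)
    refine Eq.trans ?_ this
    refine integral_congr_ae (ae_of_all _ fun x => ?_)
    exact Complex.real_smul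
  have h2 : f =ᵐ[volume.restrict U] fun _ => 0 := (ae_restrict_iff' hU.measurableSet).2 h1
  exact Measure.eqOn_open_of_ae_eq h2 hU hf.continuousOn continuousOn_const

theorem IsRepresentedBy.unique {T : 𝓢'(Space d, ℂ)} {f g : Space d →ᵇ ℂ}
    (hf : IsRepresentedBy T f) (hg : IsRepresentedBy T g) (x : Space d) : f x = g x := by
  refine sub_eq_zero.1 (eq_zero_of_integral_mul_eq_zero (f := fun x => f x - g x)
    (f.continuous.sub g.continuous) isOpen_univ (fun φ _ _ => ?_) x trivial)
  have hi : ∀ f : Space d →ᵇ ℂ, Integrable fun x => φ x * f x := fun f =>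
    ((φ.integrable (μ := volume)).bdd_mul f.continuous.aestronglyMeasurable
      (ae_of_all _ f.norm_coe_le_norm)).congr (ae_of_all _ fun x => mul_comm _ _)
  simp only [mul_sub]
  rw [integral_sub (hi f) (hi g), ← hf φ, ← hg φ, sub_self]

theorem isClosed_closedCube : IsClosed (closedCube d) := by
  have : closedCube d = ⋂ i, {x : Space d | x i ∈ Set.Icc (0 : ℝ) 1} := by
    ext x; simp only [Set.mem_iInter]; rfl
  rw [this]
  exact isClosed_iInter fun i => isClosed_Icc.preimage (by fun_prop)

/-- The representative vanishes off the closed cube. A point on an upper face is a limit of points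
outside the cube, so continuity makes it vanish there too, and the half-open cube in the cubature
formula loses nothing. -/
theorem IsRepresentedBy.mem_halfOpenCube {T : 𝓢'(Space d, ℂ)} {f : Space d →ᵇ ℂ}
    (hf : IsRepresentedBy T f) (hT : Distribution.dsupport T ⊆ closedCube d) {x : Space d}
    (hx : f x ≠ 0) : x ∈ halfOpenCube d := by
  have h0 : ∀ x ∈ (closedCube d)ᶜ, f x = 0 := eq_zero_of_integral_mul_eq_zero f.continuous
    isClosed_closedCube.isOpen_compl fun φ hc hφ => by
      rw [← hf φ]
      exact apply_eq_zero_of_tsupport_subset_compl T φ hc (hφ.trans (Set.compl_subset_compl.2 hT))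
  have hxc : x ∈ closedCube d := by
    by_contra hxc
    exact hx (h0 x hxc)
  intro i
  refine ⟨(hxc i).1, lt_of_le_of_ne (hxc i).2 fun h1 => hx ?_⟩
  let c : ℝ → Space d := fun t => x + t • EuclideanSpace.single i 1
  have hc : Continuous fun t => f (c t) := f.continuous.comp (by fun_prop)
  have hcl : IsClosed {t | f (c t) = 0} := isClosed_eq hc continuous_const
  have hsub : Set.Ioi (0 : ℝ) ⊆ {t | f (c t) = 0} := fun t ht => h0 _ fun hmem => by
    have h2 := (hmem i).2
    have h3 : (c t) i = x i + t := by simp [c]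
    have : (0 : ℝ) < t := ht
    rw [h3, h1] at h2
    linarith
  have h4 : (0 : ℝ) ∈ {t | f (c t) = 0} := by
    refine hcl.closure_subset_iff.2 hsub ?_
    rw [closure_Ioi]
    exact Set.self_mem_Ici
  have h5 : f (c 0) = 0 := h4
  simpa [c] using h5

theorem setIntegral_closedCube_eq_integral {f : Space d → ℂ}
    (hf : ∀ x, f x ≠ 0 → x ∈ halfOpenCube d) : ∫ x in closedCube d, f x = ∫ x, f x := by
  refine setIntegral_eq_integral_of_forall_compl_eq_zero fun x hx => ?_
  by_contra hne
  exact hx fun i => ⟨(hf x hne i).1, (hf x hne i).2.le⟩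

/-- As f vanishes off the half-open cube, the sum may run over the whole lattice, which is what
Poisson summation needs. -/
theorem cubature_eq_tsum (hd : 1 ≤ d) {n : ℕ} (hn : 1 ≤ n) {f : Space d → ℂ}
    (hf : ∀ x, f x ≠ 0 → x ∈ halfOpenCube d) :
    cubature d n f = 1 / (n : ℂ) * ∑' k, f (latticePoint d n k) := by
  have h1 : lattice d n = Set.range (latticePoint d n) := by
    ext x
    constructor
    · rintro ⟨k, rfl⟩
      exact ⟨k, rfl⟩
    · rintro ⟨k, rfl⟩
      exact ⟨k, rfl⟩
  rw [cubature, finsum_mem_inter_support_eq f (lattice d n ∩ halfOpenCube d)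
    (Set.range (latticePoint d n)) ?_, finsum_mem_range (latticePoint_injective hd hn), tsum_eq_finsum]
  · refine (finite_latticePoint_mem_closedCube hd hn).subset fun k hk i => ?_
    have := hf _ hk i
    exact ⟨this.1, this.2.le⟩
  · rw [h1, Set.inter_assoc]
    congr 1
    exact Set.inter_eq_right.2 fun x hx => hf x hx

theorem integrable_inv_weight_space : Integrable fun x : Space d => (weight x.ofLp)⁻¹ :=
  ((PiLp.volume_preserving_toLp (Fin d)).integrable_comp_emb
    (MeasurableEquiv.toLp 2 (Fin d → ℝ)).measurableEmbedding).1 integrable_inv_weight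

theorem summable_inv_weight_latticePoint (hd : 1 ≤ d) {n : ℕ} (hn : 1 ≤ n) :
    Summable fun k => (weight (latticePoint d n k).ofLp)⁻¹ := by
  obtain ⟨C, hC, h⟩ := exists_tsum_inv_weight_latticePoint_le hd
  have h1 : ∑' k, ENNReal.ofReal (weight (latticePoint d n k).ofLp)⁻¹ ≠ ⊤ :=
    ((h n hn).trans_lt (by finiteness)).ne
  have := ENNReal.summable_toReal h1
  simpa only [ENNReal.toReal_ofReal (inv_nonneg.2 (weight_pos _).le)] using this

end Representatives

/-! ### The error functional on a block -/

namespace LocalMeans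

variable {L : ℕ} (K : LocalMeans L)

/-- The error of the lattice rule for the function `x ↦ Λ_m (x - z)`, with `Λ_m` the dual kernel. -/
def latticeError (n : ℕ) (m : Fin d → ℕ) (z : Space d) : ℂ :=
  (∫ y : Space d, K.tensorDual m y) -
    1 / (n : ℂ) * ∑' k, K.tensorDual m (latticePoint d n k - z)

/-- The integral in z and the lattice sum may be exchanged: Ψ_m * T is supported in a fixed box,
where the translates of Λ_m at the lattice points are dominated by the summable inverse weights. The
integral of Λ_m(· - z) does not depend on z. -/
theorem integral_block_sub_tsum (hd : 1 ≤ d) {n : ℕ} (hn : 1 ≤ n) {T : 𝓢'(Space d, ℂ)}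
    (hT : Distribution.dsupport T ⊆ closedCube d) (m : Fin d → ℕ) :
    (∫ x, K.block m T x) - 1 / (n : ℂ) * ∑' k, K.block m T (latticePoint d n k) =
      ∫ z, K.conv m T z * K.latticeError n m z := by
  obtain ⟨R, hR, hbox⟩ := K.exists_mem_box_of_conv_ne_zero d
  obtain ⟨C, hC, h⟩ := K.exists_weight_mul_norm_tensorDual_sub_le d R
  obtain ⟨Cg, hCg⟩ := (K.hasCompactSupport_conv hT m).exists_bound_of_continuous
    (K.continuous_conv m T)
  have hCg0 : 0 ≤ Cg := (norm_nonneg _).trans (hCg 0)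
  have hc1 := K.continuous_tensorDual m
  have hc2 := K.continuous_conv m T
  set w : (Fin d → ℤ) → ℝ := fun k => (weight (latticePoint d n k).ofLp)⁻¹ with hw
  have hws : Summable w := summable_inv_weight_latticePoint hd hn
  set F : (Fin d → ℤ) → Space d → ℂ :=
    fun k z => K.tensorDual m (latticePoint d n k - z) * K.conv m T z with hF
  have hb : ∀ k z, ‖F k z‖ ≤ C * 2 ^ level m * w k * ‖K.conv m T z‖ := fun k z => by
    by_cases hz : K.conv m T z = 0
    · simp [hF, hz]
    · have h1 := h m (latticePoint d n k) z (hbox T hT m z hz)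
      have h2 := tensorProfile_le m (latticePoint d n k - z)
      rw [hF, norm_mul]
      refine mul_le_mul_of_nonneg_right ?_ (norm_nonneg _)
      rw [hw, ← div_eq_mul_inv, le_div_iff₀ (weight_pos _), mul_comm]
      exact h1.trans (mul_le_mul_of_nonneg_left h2 hC.le)
  have hFc : ∀ k, Continuous (F k) := fun k => by rw [hF]; fun_prop
  have hS : ∀ z, Summable fun k => F k z := fun z =>
    Summable.of_norm_bounded ((hws.mul_left _).mul_right _) fun k => hb k z
  have hsum : HasSum (fun k => ∫ z, F k z) (∫ z, ∑' k, F k z) := by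
    refine hasSum_integral_of_dominated_convergence
      (bound := fun k z => C * 2 ^ level m * w k * ‖K.conv m T z‖)
      (fun k => (hFc k).aestronglyMeasurable) (fun k => ae_of_all _ fun z => hb k z)
      (ae_of_all _ fun z => (hws.mul_left _).mul_right _) ?_ (ae_of_all _ fun z => (hS z).hasSum)
    simp only [tsum_mul_right]
    exact (K.integrable_conv hT m).norm.const_mul _
  have hblock : ∀ k, K.block m T (latticePoint d n k) = ∫ z, F k z := fun k => rfl
  have hFF : Continuous fun z => ∑' k, F k z := continuous_tsum hFc (hws.mul_left (C * 2 ^ level m) |>.mul_right Cg)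
    fun k z => (hb k z).trans (mul_le_mul_of_nonneg_left (hCg z) (by
      have : 0 ≤ w k := inv_nonneg.2 (weight_pos _).le
      positivity))
  have hFi : Integrable fun z => ∑' k, F k z := hFF.integrable_of_hasCompactSupport <|
    (K.hasCompactSupport_conv hT m).mono' fun z hz => subset_tsupport _ fun h0 => hz (by
      simp [hF, h0])
  rw [K.integral_block T hT m]
  simp only [hblock]
  rw [hsum.tsum_eq, ← integral_const_mul, ← integral_sub ((K.integrable_conv hT m).mul_const _)
    (hFi.const_mul _)]
  refine integral_congr_ae (ae_of_all _ fun z => ?_)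
  simp only [latticeError, hF, tsum_mul_right]
  ring

variable {p s : ℝ}

/-- Both the integral and the lattice sum may be taken block by block, since the blocks are bounded
by a summable sequence times a weight that is integrable and summable on the lattice. -/
theorem hasSum_integral_conv_mul_latticeError (hd : 1 ≤ d) {n : ℕ} (hn : 1 ≤ n) (hp : 1 < p)
    (hs : 1 / p < s) {T : 𝓢'(Space d, ℂ)} (hT : T ∈ K.sobolevCube d s p) {f : Space d →ᵇ ℂ}
    (hf : IsRepresentedBy T f) : HasSum (fun m => ∫ z, K.conv m T z * K.latticeError n m z)
      ((∫ x in closedCube d, f x) - cubature d n f) := by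
  obtain ⟨u, hu, hu0, h⟩ := K.exists_summable_norm_block_le hp hs hT
  have hfs : ∀ x, HasSum (fun m => K.block m T x) (f x) := by
    obtain ⟨g, hg, hgs⟩ := K.exists_isRepresentedBy hp hs hT
    intro x
    rw [hf.unique hg x]
    exact hgs x
  have hf0 : ∀ x, f x ≠ 0 → x ∈ halfOpenCube d := fun x hx => hf.mem_halfOpenCube hT.2 hx
  simp only [← K.integral_block_sub_tsum hd hn hT.2]
  rw [setIntegral_closedCube_eq_integral hf0, cubature_eq_tsum hd hn hf0]
  refine HasSum.sub ?_ (HasSum.mul_left _ ?_)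
  · refine hasSum_integral_of_dominated_convergence (bound := fun m x => u m * (weight x.ofLp)⁻¹)
      (fun m => (K.continuous_block hT.2 m).aestronglyMeasurable)
      (fun m => ae_of_all _ fun x => h m x) (ae_of_all _ fun x => hu.mul_right _) ?_
      (ae_of_all _ fun x => hfs x)
    simp only [tsum_mul_right]
    exact integrable_inv_weight_space.const_mul _
  · have hws := summable_inv_weight_latticePoint hd hn
    have hprod : Summable fun q : (Fin d → ℕ) × (Fin d → ℤ) =>
        K.block q.1 T (latticePoint d n q.2) :=
      Summable.of_norm_bounded (hu.mul_of_nonneg hws hu0 fun k => inv_nonneg.2 (weight_pos _).le)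
        fun q => h q.1 _
    have h1 := hprod.prod.hasSum
    have h2 : ∑' k, f (latticePoint d n k) = ∑' k, ∑' m, K.block m T (latticePoint d n k) :=
      tsum_congr fun k => (hfs _).tsum_eq.symm
    rw [h2, Summable.tsum_comm (f := fun m k => K.block m T (latticePoint d n k)) hprod]
    exact h1

end LocalMeans

end Frolov

end

noncomputable section

namespace Frolov

open MeasureTheory Filter Topology

variable {d : ℕ}

/-! ### The error of the lattice rule for the dual kernels -/

theorem integral_comp_mulVec {A : Matrix (Fin d) (Fin d) ℝ} (hA : A.det ≠ 0)
    {G : (Fin d → ℝ) → ℂ} (hG : Continuous G) :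
    ∫ u, G (A.mulVec u) = (|A.det⁻¹| : ℝ) * ∫ v, G v := by
  have h := Real.map_matrix_volume_pi_eq_smul_volume_pi hA
  have h1 : Continuous (Matrix.toLin' A) := LinearMap.continuous_of_finiteDimensional _
  have h2 := integral_map (μ := volume) h1.measurable.aemeasurable hG.aestronglyMeasurable
  rw [h, integral_smul_measure, ENNReal.toReal_ofReal (abs_nonneg _), Complex.real_smul] at h2
  rw [h2]
  rfl

namespace LocalMeans

variable {L : ℕ} (K : LocalMeans L)

theorem fourier_tensorDual (m : Fin d → ℕ) (ξ : Space d) :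
    𝓕 (K.tensorDual m : Space d → ℂ) ξ = K.tensorDualHat m ξ := by
  have : (K.tensorDual m : Space d → ℂ) = (𝓕⁻ (K.tensorDualHat m) : 𝓢(Space d, ℂ)) := by
    ext x
    exact (K.fourierInv_tensorDualHat m x).symm
  rw [this, ← SchwartzMap.fourier_coe, FourierTransform.fourier_fourierInv_eq]

theorem integral_fourierChar_mul_tensorDual_sub (m : Fin d → ℕ) (z y : Space d) :
    ∫ x : Space d, ((Real.fourierChar (-inner ℝ x y) : Circle) : ℂ) * K.tensorDual m (x - z) =
      ((Real.fourierChar (-inner ℝ z y) : Circle) : ℂ) * K.tensorDualHat m y := by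
  rw [← fourier_tensorDual, Real.fourier_eq, ← integral_add_right_eq_self _ z, ← integral_const_mul]
  refine integral_congr_ae (ae_of_all _ fun x => ?_)
  simp only [add_sub_cancel_right, Circle.smul_def, smul_eq_mul]
  rw [← mul_assoc, ← Circle.coe_mul, ← AddChar.map_add_eq_mul, inner_add_left]
  congr 4
  ring

/-- Schwartz decay of order 2d beats the tensor weight. The constant depends on A, m and z; it only
serves to justify Poisson summation. -/
theorem exists_norm_tensorDual_mulVec_sub_le (A : Matrix (Fin d) (Fin d) ℝ) (hA : IsUnit A.det)
    (m : Fin d → ℕ) (z : Space d) : ∃ C, ∀ u : Fin d → ℝ,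
      ‖K.tensorDual m (WithLp.toLp 2 (A.mulVec u) - z)‖ ≤ C * (weight u)⁻¹ := by
  set B : Space d →L[ℝ] (Fin d → ℝ) := ((Matrix.toLin' A⁻¹).comp
    (WithLp.linearEquiv 2 ℝ (Fin d → ℝ)).toLinearMap).toContinuousLinearMap with hB
  obtain ⟨C, hC0, hC⟩ := exists_one_add_pow_mul_le (K.dualRefl m) (2 * d) 0
  have hw : ∀ u : Fin d → ℝ, weight u ≤ (1 + ‖u‖) ^ (2 * d) := fun u => by
    have hd : (1 + ‖u‖) ^ (2 * d) = ∏ _i : Fin d, (1 + ‖u‖) ^ 2 := by simp [pow_mul]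
    rw [hd, weight]
    refine Finset.prod_le_prod (fun i _ => by positivity) fun i _ => ?_
    have h1 := norm_le_pi_norm u i
    rw [Real.norm_eq_abs] at h1
    nlinarith [sq_abs (u i), abs_nonneg (u i)]
  refine ⟨((1 + ‖B‖) * (1 + ‖z‖)) ^ (2 * d) * C, fun u => ?_⟩
  rw [← div_eq_mul_inv, le_div_iff₀ (weight_pos _)]
  set x : Space d := WithLp.toLp 2 (A.mulVec u) - z with hx
  have h1 : u = B (x + z) := by
    rw [hx, sub_add_cancel]
    change u = A⁻¹.mulVec (A.mulVec u)
    rw [Matrix.mulVec_mulVec, Matrix.nonsing_inv_mul _ hA, Matrix.one_mulVec]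
  have h2 : 1 + ‖u‖ ≤ (1 + ‖B‖) * (1 + ‖z‖) * (1 + ‖x‖) := by
    have a1 := B.le_opNorm (x + z)
    rw [← h1] at a1
    have a2 := norm_add_le x z
    have a3 : ‖B‖ * ‖x + z‖ ≤ ‖B‖ * (‖x‖ + ‖z‖) := by gcongr
    nlinarith [norm_nonneg x, norm_nonneg z, norm_nonneg B, mul_nonneg (norm_nonneg x) (norm_nonneg z),
      mul_nonneg (norm_nonneg B) (mul_nonneg (norm_nonneg x) (norm_nonneg z))]
  have h3 := hC (-x)
  rw [norm_iteratedFDeriv_zero, dualRefl_apply, neg_neg, norm_neg] at h3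
  calc ‖K.tensorDual m x‖ * weight u
      ≤ ‖K.tensorDual m x‖ * ((1 + ‖B‖) * (1 + ‖z‖) * (1 + ‖x‖)) ^ (2 * d) := by
        gcongr
        exact (hw u).trans (by gcongr)
    _ = ((1 + ‖B‖) * (1 + ‖z‖)) ^ (2 * d) * ((1 + ‖x‖) ^ (2 * d) * ‖K.tensorDual m x‖) := by
        rw [mul_pow _ (1 + ‖x‖)]; ring
    _ ≤ _ := by gcongr

/-- By Poisson summation the error only sees the Fourier transform of Λ_m at the nonzero points y of
the dual lattice. On the support of that transform ∏ |y_i| ≤ (9ε/5)^d 2^|m|, whereas admissibility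
of the dual lattice gives ∏ |y_i| ≥ cn. -/
theorem exists_latticeError_eq_zero (hd : 1 ≤ d) : ∃ c₀ > 0, ∀ n : ℕ, 1 ≤ n → ∀ (m : Fin d → ℕ)
    (z : Space d), (2 : ℝ) ^ level m < c₀ * n → K.latticeError n m z = 0 := by
  obtain ⟨c, hc, h⟩ := exists_mul_le_prod_abs_of_generator_transpose_mulVec hd
  have hε := K.ε_pos
  refine ⟨c / (9 / 5 * K.ε) ^ d, by positivity, fun n hn m z hm => ?_⟩
  have hn0 : (0 : ℝ) < n := by exact_mod_cast hn
  set A := generator d n with hA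
  have hdet : A.det = (n : ℝ)⁻¹ := det_generator hd hn
  have hdet0 : A.det ≠ 0 := by rw [hdet]; positivity
  have hunit : IsUnit A.det := isUnit_iff_ne_zero.2 hdet0
  have hc1 := K.continuous_tensorDual m
  have hAc : Continuous fun u : Fin d → ℝ => A.mulVec u :=
    LinearMap.continuous_of_finiteDimensional (Matrix.toLin' A)
  have hBc : Continuous fun u : Fin d → ℝ => A⁻¹.mulVec u :=
    LinearMap.continuous_of_finiteDimensional (Matrix.toLin' A⁻¹)
  have htoLp : Continuous (WithLp.toLp 2 : (Fin d → ℝ) → Space d) :=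
    PiLp.continuous_toLp 2 fun _ : Fin d => ℝ
  set F : (Fin d → ℝ) → ℂ := fun u => K.tensorDual m (WithLp.toLp 2 (A.mulVec u) - z) with hF
  have hFc : Continuous F := hc1.comp ((htoLp.comp hAc).sub continuous_const)
  obtain ⟨C, hC⟩ := K.exists_norm_tensorDual_mulVec_sub_le A hunit m z
  have hP := tsum_int_eq_integral hFc hC fun k hk => by
    set y : Space d := WithLp.toLp 2 (A⁻¹.transpose.mulVec fun i => (k i : ℝ)) with hy
    have hyk : A.transpose.mulVec y.ofLp = fun i => (k i : ℝ) := by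
      change A.transpose.mulVec (A⁻¹.transpose.mulVec fun i => (k i : ℝ)) = _
      rw [Matrix.mulVec_mulVec, ← Matrix.transpose_mul, Matrix.nonsing_inv_mul _ hunit,
        Matrix.transpose_one, Matrix.one_mulVec]
    have hin : ∀ u : Fin d → ℝ, ∑ i, (k i : ℝ) * u i = inner ℝ (WithLp.toLp 2 (A.mulVec u)) y := by
      intro u
      have e1 : inner ℝ (WithLp.toLp 2 (A.mulVec u)) y = A.mulVec u ⬝ᵥ y.ofLp := by
        rw [PiLp.inner_apply]
        simp [dotProduct, mul_comm]
      rw [e1, dotProduct_comm, Matrix.dotProduct_mulVec, ← Matrix.mulVec_transpose, hyk]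
      rfl
    simp only [hin, hF]
    have hG : Continuous fun v : Fin d → ℝ => ((Real.fourierChar (-inner ℝ (WithLp.toLp 2 v) y) : Circle) : ℂ) *
        K.tensorDual m (WithLp.toLp 2 v - z) := by
      refine Continuous.mul ?_ (hc1.comp (htoLp.sub continuous_const))
      exact continuous_subtype_val.comp (Real.continuous_fourierChar.comp
        (Continuous.neg (htoLp.inner continuous_const)))
    rw [integral_comp_mulVec hdet0 hG]
    rw [← integral_space fun x : Space d => ((Real.fourierChar (-inner ℝ x y) : Circle) : ℂ) *
      K.tensorDual m (x - z), K.integral_fourierChar_mul_tensorDual_sub]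
    have hzero : K.tensorDualHat m y = 0 := by
      by_contra hne
      rw [tensorDualHat_apply] at hne
      have h1 : ∀ i, |y i| ≤ 9 / 5 * K.ε * 2 ^ m i := fun i =>
        K.abs_le_of_dualHat_ne_zero ((Finset.prod_ne_zero_iff.1 hne) i (Finset.mem_univ i))
      have h2 : ∏ i, |y i| ≤ (9 / 5 * K.ε) ^ d * 2 ^ level m := by
        have e : (9 / 5 * K.ε) ^ d * 2 ^ level m = ∏ i, (9 / 5 * K.ε * 2 ^ m i) := by
          rw [Finset.prod_mul_distrib, level, Finset.prod_pow_eq_pow_sum]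
          simp
        rw [e]
        exact Finset.prod_le_prod (fun i _ => abs_nonneg _) fun i _ => h1 i
      have hy0 : y.ofLp ≠ 0 := fun h0 => hk (by
        rw [h0, Matrix.mulVec_zero] at hyk
        ext i
        have := congrFun hyk i
        simp only [Pi.zero_apply] at this
        exact_mod_cast this.symm)
      have h3 := h n hn y.ofLp hy0 ⟨k, hyk⟩
      rw [div_mul_eq_mul_div, lt_div_iff₀ (by positivity)] at hm
      linarith
    rw [hzero]
    simp
  have hI : ∫ u, F u = n * ∫ y : Space d, K.tensorDual m y := by
    rw [hF, integral_comp_mulVec hdet0 (G := fun v => K.tensorDual m (WithLp.toLp 2 v - z))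
      (hc1.comp (htoLp.sub continuous_const)), ← integral_space fun x : Space d => K.tensorDual m (x - z),
      integral_sub_right_eq_self, hdet, inv_inv, abs_of_pos hn0]
    simp
  have hnc : (n : ℂ) ≠ 0 := by exact_mod_cast hn0.ne'
  have hT : ∑' k, K.tensorDual m (latticePoint d n k - z) = ∫ u, F u := hP
  rw [latticeError, hT, hI]
  field_simp
  ring

/-- Bounds for the error of the lattice rule for the dual kernels. -/
theorem exists_latticeError_bound (hd : 1 ≤ d) (R : ℝ) : ∃ c₀ > 0, ∃ C : ℝ≥0∞, C ≠ ⊤ ∧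
    ∀ n : ℕ, 1 ≤ n → ∃ E : (Fin d → ℕ) → Space d → ℝ≥0∞, (∀ m, Measurable (E m)) ∧
      (∀ m z, ‖K.latticeError n m z‖ₑ ≤ E m z) ∧
      (∀ m z, (2 : ℝ) ^ level m < c₀ * n → E m z = 0) ∧
      (∀ m z, E m z ≤ C * (2 ^ level m / n)) ∧
      ∀ m, ∫⁻ z in box d R, E m z ≤ C := by
  obtain ⟨c₀, hc₀, h0⟩ := K.exists_latticeError_eq_zero hd
  obtain ⟨C₁, hC₁, h1⟩ := K.exists_weight_mul_norm_tensorDual_le d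
  obtain ⟨C₂, hC₂, h2⟩ := K.exists_weight_mul_norm_tensorDual_sub_le d R
  obtain ⟨C₃, hC₃, h3⟩ := exists_tsum_tensorProfile_latticePoint_le hd hc₀
  obtain ⟨C₄, hC₄, h4⟩ := exists_tsum_inv_weight_latticePoint_le hd
  set A : ℝ≥0∞ := ENNReal.ofReal C₁ * ENNReal.ofReal Real.pi ^ d with hA
  have hAt : A ≠ ⊤ := by finiteness
  have hvol : volume (box d R) ≠ ⊤ := (isCompact_box d R).measure_lt_top.ne
  have h1' : ∀ (m : Fin d → ℕ) (x : Space d),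
      ‖K.tensorDual m x‖ₑ ≤ ENNReal.ofReal C₁ * ENNReal.ofReal (tensorProfile m x) := fun m x => by
    rw [← ENNReal.ofReal_mul hC₁.le, ← ofReal_norm]
    refine ENNReal.ofReal_le_ofReal (le_trans ?_ (h1 m x))
    exact le_mul_of_one_le_left (norm_nonneg _) (one_le_weight _)
  refine ⟨c₀, hc₀, (A * ENNReal.ofReal c₀⁻¹ + ENNReal.ofReal C₁ * C₃) +
    (A * volume (box d R) + C₄ * (ENNReal.ofReal C₂ * ENNReal.ofReal Real.pi ^ d)), by finiteness,
    fun n hn => ?_⟩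
  have hn0 : (0 : ℝ) < n := by exact_mod_cast hn
  have hnE : (n : ℝ≥0∞) ≠ 0 := by exact_mod_cast (by omega : n ≠ 0)
  have hmeas : ∀ m : Fin d → ℕ, Measurable fun z : Space d =>
      A + (n : ℝ≥0∞)⁻¹ * ∑' k, ‖K.tensorDual m (latticePoint d n k - z)‖ₑ := fun m => by
    have hc := K.continuous_tensorDual m
    refine (Measurable.const_mul (Measurable.tsum fun k => ?_) _).const_add _
    exact (hc.comp (continuous_const.sub continuous_id)).enorm.measurable
  -- The triangle inequality gives the majorant, set to zero where the error is known to vanish. On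
  -- the remaining levels 2^|m| ≥ c₀n, which is the condition for the uniform bound of the lattice
  -- sum.
  refine ⟨fun m z => if (2 : ℝ) ^ level m < c₀ * n then 0 else
    A + (n : ℝ≥0∞)⁻¹ * ∑' k, ‖K.tensorDual m (latticePoint d n k - z)‖ₑ, fun m => ?_,
    fun m z => ?_, fun m z hm => if_pos hm, fun m z => ?_, fun m => ?_⟩
  · dsimp only
    split_ifs
    · exact measurable_const
    · exact hmeas m
  · dsimp only
    split_ifs with hm
    · rw [h0 n hn m z hm]
      simp
    · refine (enorm_sub_le).trans (add_le_add ?_ ?_)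
      · refine (enorm_integral_le_lintegral_enorm _).trans ((lintegral_mono (h1' m)).trans_eq ?_)
        rw [lintegral_const_mul' _ _ ENNReal.ofReal_ne_top, lintegral_tensorProfile]
      · rw [enorm_mul]
        gcongr
        · rw [one_div, enorm_inv (by exact_mod_cast hn0.ne')]
          gcongr
          rw [← ofReal_norm, Complex.norm_natCast, ENNReal.ofReal_natCast]
        · exact enorm_tsum_le_tsum_enorm
  · dsimp only
    split_ifs with hm
    · exact zero_le
    · rw [not_lt] at hm
      refine le_trans ?_ (mul_le_mul' le_self_add le_rfl)
      rw [add_mul]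
      refine add_le_add ?_ ?_
      -- The contribution of the integral is a constant, and 1 ≤ c₀⁻¹ 2^|m|/n on these levels.
      · rw [mul_assoc]
        refine le_mul_of_one_le_right' ?_
        have e : (2 : ℝ≥0∞) ^ level m / n = ENNReal.ofReal (2 ^ level m / n) := by
          rw [ENNReal.ofReal_div_of_pos hn0, ENNReal.ofReal_pow (by norm_num), ENNReal.ofReal_ofNat,
            ENNReal.ofReal_natCast]
        rw [e, ← ENNReal.ofReal_mul (by positivity), ENNReal.one_le_ofReal, inv_mul_eq_div,
          one_le_div hc₀, le_div_iff₀ hn0]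
        exact hm
      · rw [ENNReal.div_eq_inv_mul, mul_left_comm]
        gcongr
        refine (ENNReal.tsum_le_tsum fun k => h1' m _).trans ?_
        rw [ENNReal.tsum_mul_left, mul_assoc, mul_comm C₃]
        gcongr
        exact h3 n hn m hm z
  · have hle : ∫⁻ z in box d R,
        (A + (n : ℝ≥0∞)⁻¹ * ∑' k, ‖K.tensorDual m (latticePoint d n k - z)‖ₑ) ≤
        A * volume (box d R) + C₄ * (ENNReal.ofReal C₂ * ENNReal.ofReal Real.pi ^ d) := by
      rw [lintegral_add_left measurable_const, setLIntegral_const]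
      refine add_le_add le_rfl ?_
      rw [lintegral_const_mul' _ _ (by finiteness), lintegral_tsum fun k => by
        have hc := K.continuous_tensorDual m
        exact (hc.comp (continuous_const.sub continuous_id)).enorm.measurable.aemeasurable]
      have hk : ∀ k, ∫⁻ z in box d R, ‖K.tensorDual m (latticePoint d n k - z)‖ₑ ≤
          ENNReal.ofReal (weight (latticePoint d n k).ofLp)⁻¹ *
            (ENNReal.ofReal C₂ * ENNReal.ofReal Real.pi ^ d) := fun k => by
        calc ∫⁻ z in box d R, ‖K.tensorDual m (latticePoint d n k - z)‖ₑ
            ≤ ∫⁻ z in box d R, ENNReal.ofReal (weight (latticePoint d n k).ofLp)⁻¹ *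
                (ENNReal.ofReal C₂ * ENNReal.ofReal (tensorProfile m (latticePoint d n k - z))) := by
              refine setLIntegral_mono_ae' (isCompact_box d R).measurableSet
                (ae_of_all _ fun z hz => ?_)
              rw [← ENNReal.ofReal_mul hC₂.le, ← ENNReal.ofReal_mul (inv_nonneg.2 (weight_pos _).le),
                ← ofReal_norm]
              refine ENNReal.ofReal_le_ofReal ?_
              rw [inv_mul_eq_div, le_div_iff₀ (weight_pos _), mul_comm]
              exact h2 m _ z hz
          _ ≤ ∫⁻ z, ENNReal.ofReal (weight (latticePoint d n k).ofLp)⁻¹ *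
                (ENNReal.ofReal C₂ * ENNReal.ofReal (tensorProfile m (latticePoint d n k - z))) :=
              setLIntegral_le_lintegral _ _
          _ = _ := by
              rw [lintegral_const_mul' _ _ ENNReal.ofReal_ne_top,
                lintegral_const_mul' _ _ ENNReal.ofReal_ne_top,
                lintegral_sub_left_eq_self fun z => ENNReal.ofReal (tensorProfile m z),
                lintegral_tensorProfile]
      -- The inverse weights of the lattice points sum to at most C₄ n, so the factor 1/n cancels.
      calc (n : ℝ≥0∞)⁻¹ * ∑' k, ∫⁻ z in box d R, ‖K.tensorDual m (latticePoint d n k - z)‖ₑ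
          ≤ (n : ℝ≥0∞)⁻¹ * (n * C₄ * (ENNReal.ofReal C₂ * ENNReal.ofReal Real.pi ^ d)) := by
            gcongr
            refine (ENNReal.tsum_le_tsum hk).trans ?_
            rw [ENNReal.tsum_mul_right]
            exact mul_le_mul' (h4 n hn) le_rfl
        _ = _ := by
            rw [mul_assoc (n : ℝ≥0∞), ENNReal.inv_mul_cancel_left hnE (by finiteness)]
    dsimp only
    split_ifs
    · simp
    · exact hle.trans le_add_self

end LocalMeans

end Frolov

end

noncomputable section

namespace Frolov

open MeasureTheory Filter Topology

variable {d : ℕ}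

/-! ### Counting multi-indices -/

section Counting

/-- Given the level, a multi-index is determined by its last d - 1 entries, each at most a. -/
theorem card_filter_level_le (F : Finset (Fin d → ℕ)) (a : ℕ) :
    (F.filter fun m => level m = a).card ≤ (a + 1) ^ (d - 1) := by
  cases d with
  | zero =>
    rw [Nat.zero_sub, pow_zero]
    exact Finset.card_le_one.2 fun x _ y _ => Subsingleton.elim x y
  | succ d =>
    have h : (F.filter fun m => level m = a).card ≤
        (Fintype.piFinset fun _ : Fin d => Finset.range (a + 1)).card := by
      refine Finset.card_le_card_of_injOn (fun m => Fin.tail m) (fun m hm => ?_) fun m hm m' hm' h => ?_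
      · have h1 : level m = a := (Finset.mem_filter.1 hm).2
        refine Fintype.mem_piFinset.2 fun i => Finset.mem_range.2 (Nat.lt_succ_of_le ?_)
        rw [← h1, level]
        exact Finset.single_le_sum (f := m) (fun _ _ => Nat.zero_le _) (Finset.mem_univ i.succ)
      · have h1 : level m = a := (Finset.mem_filter.1 hm).2
        have h2 : level m' = a := (Finset.mem_filter.1 hm').2
        rw [level, Fin.sum_univ_succ] at h1 h2
        have h3 : ∑ i : Fin d, m i.succ = ∑ i : Fin d, m' i.succ :=
          Finset.sum_congr rfl fun i _ => congrFun h i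
        rw [← Fin.cons_self_tail m, ← Fin.cons_self_tail m']
        simp only at h
        rw [h, show m 0 = m' 0 by omega]
    simpa using h

theorem sum_level_sub_le (F : Finset (Fin d → ℕ)) (b : ℕ) (w : ℕ → ℝ≥0∞) :
    ∑ m ∈ F with b ≤ level m, w (level m - b) ≤
      ∑' i : ℕ, ((b + i + 1) ^ (d - 1) : ℕ) * w i := by
  set F' := F.filter fun m => b ≤ level m with hF'
  rw [← Finset.sum_fiberwise_of_maps_to (s := F') (t := F'.image fun m => level m - b)
    (g := fun m => level m - b) fun m hm => Finset.mem_image_of_mem _ hm]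
  refine le_trans (Finset.sum_le_sum fun i _ => ?_) (ENNReal.sum_le_tsum _)
  rw [Finset.sum_congr rfl (g := fun _ => w i) fun m hm => by rw [(Finset.mem_filter.1 hm).2],
    Finset.sum_const, nsmul_eq_mul]
  gcongr
  refine le_trans (Finset.card_le_card fun m hm => ?_) (card_filter_level_le F (b + i))
  simp only [hF', Finset.mem_filter] at hm ⊢
  exact ⟨hm.1.1, by omega⟩

/-- The sum `∑ (i + 1)^(d - 1) 2^(-δ i)`. -/
def geomSum (d : ℕ) (δ : ℝ) : ℝ≥0∞ := ∑' i : ℕ, ((i + 1) ^ (d - 1) : ℕ) * (2 : ℝ≥0∞) ^ (-δ * i)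

theorem geomSum_ne_top (d : ℕ) {δ : ℝ} (hδ : 0 < δ) : geomSum d δ ≠ ⊤ := by
  set r : ℝ := 2 ^ (-δ) with hr
  have hr0 : 0 < r := by positivity
  have hr1 : r < 1 := Real.rpow_lt_one_of_one_lt_of_neg (by norm_num) (by linarith)
  have h1 : Summable fun i : ℕ => ((i + 1 : ℕ) : ℝ) ^ (d - 1) * r ^ (i + 1) :=
    (summable_nat_add_iff 1).2 (summable_pow_mul_geometric_of_norm_lt_one (d - 1) (r := r)
      (by rwa [Real.norm_of_nonneg hr0.le]))
  have h2 := h1.mul_right r⁻¹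
  have h3 : geomSum d δ = ∑' i : ℕ, ENNReal.ofReal (((i + 1 : ℕ) : ℝ) ^ (d - 1) * r ^ (i + 1) * r⁻¹) := by
    refine tsum_congr fun i => ?_
    rw [pow_succ, ← mul_assoc, mul_inv_cancel_right₀ hr0.ne', ENNReal.ofReal_mul (by positivity), hr,
      ← Real.rpow_natCast (2 ^ (-δ)), ← Real.rpow_mul (by norm_num),
      ← ENNReal.ofReal_rpow_of_pos two_pos, ENNReal.ofReal_ofNat, ← Nat.cast_pow,
      ENNReal.ofReal_natCast]
  rw [h3]
  exact h2.tsum_ofReal_ne_top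

/-- The approximate number of multi-indices on the level `ℓ`. -/
def levelCount (d ℓ : ℕ) : ℕ := (ℓ + 1) ^ (d - 1)

theorem one_le_levelCount (d ℓ : ℕ) : 1 ≤ levelCount d ℓ := Nat.one_le_pow _ _ (by omega)

/-- Since ℓ + i + 1 ≤ (ℓ + 1)(i + 1), the number of multi-indices on level ℓ + i splits into the
count for ℓ and a polynomial in i, which the geometric factor absorbs. -/
theorem sum_two_rpow_level_le (F : Finset (Fin d → ℕ)) (ℓ : ℕ) (δ : ℝ) :
    ∑ m ∈ F with ℓ ≤ level m, (2 : ℝ≥0∞) ^ (-δ * (level m - ℓ : ℕ)) ≤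
      levelCount d ℓ * geomSum d δ := by
  refine (sum_level_sub_le F ℓ fun i => (2 : ℝ≥0∞) ^ (-δ * i)).trans ?_
  rw [geomSum, ← ENNReal.tsum_mul_left]
  refine ENNReal.tsum_le_tsum fun i => ?_
  rw [← mul_assoc, levelCount, ← Nat.cast_mul, ← mul_pow]
  gcongr
  nlinarith

/-- The logarithm of the number of multi-indices. -/
def logCount (d ℓ : ℕ) : ℕ := Nat.log 2 (levelCount d ℓ)

/-- From ℓ + 1 ≤ 2^ℓ the logarithm of the count is at most (d - 1)ℓ, so starting at the level ℓ +
`logCount d ℓ` instead of ℓ changes counts only by a factor depending on d. -/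
theorem logCount_add_one_le (hd : 1 ≤ d) (ℓ i : ℕ) :
    ℓ + logCount d ℓ + i + 1 ≤ d * (ℓ + 1) * (i + 1) := by
  obtain ⟨d, rfl⟩ : ∃ e, d = e + 1 := ⟨d - 1, by omega⟩
  have h1 : logCount (d + 1) ℓ ≤ d * ℓ := by
    have h2 : levelCount (d + 1) ℓ ≤ 2 ^ (d * ℓ) := by
      rw [mul_comm, pow_mul]
      exact Nat.pow_le_pow_left (Nat.lt_two_pow_self) _
    exact (Nat.log_mono_right h2).trans_eq (Nat.log_pow (by norm_num) _)
  nlinarith [Nat.zero_le (d * ℓ * i), Nat.zero_le (ℓ * i), Nat.zero_le (d * i)]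

theorem sum_two_rpow_level_high_le (hd : 1 ≤ d) (F : Finset (Fin d → ℕ)) (ℓ : ℕ) (δ : ℝ) :
    ∑ m ∈ F with ℓ + logCount d ℓ ≤ level m,
      (2 : ℝ≥0∞) ^ (-δ * (level m - (ℓ + logCount d ℓ) : ℕ)) ≤
      (d ^ (d - 1) : ℕ) * levelCount d ℓ * geomSum d δ := by
  refine (sum_level_sub_le F (ℓ + logCount d ℓ) fun i => (2 : ℝ≥0∞) ^ (-δ * i)).trans ?_
  rw [geomSum, ← ENNReal.tsum_mul_left]
  refine ENNReal.tsum_le_tsum fun i => ?_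
  rw [← mul_assoc, levelCount, ← Nat.cast_mul, ← Nat.cast_mul, ← mul_pow, ← mul_pow]
  gcongr
  exact logCount_add_one_le hd ℓ i

theorem sum_two_rpow_level_low_le (hd : 1 ≤ d) (F : Finset (Fin d → ℕ)) (ℓ : ℕ) (δ : ℝ) :
    ∑ m ∈ F with ℓ ≤ level m ∧ level m < ℓ + logCount d ℓ,
      (2 : ℝ≥0∞) ^ (δ * (level m - ℓ : ℕ)) ≤
      (d ^ (d - 1) : ℕ) * levelCount d ℓ * ∑ j ∈ Finset.range (logCount d ℓ), (2 : ℝ≥0∞) ^ (δ * j) := by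
  have h := sum_level_sub_le (F.filter fun m => level m < ℓ + logCount d ℓ) ℓ
    fun i => if i < logCount d ℓ then (2 : ℝ≥0∞) ^ (δ * i) else 0
  rw [Finset.filter_filter] at h
  have e : ∑ m ∈ F with ℓ ≤ level m ∧ level m < ℓ + logCount d ℓ,
      (2 : ℝ≥0∞) ^ (δ * (level m - ℓ : ℕ)) = ∑ m ∈ F with level m < ℓ + logCount d ℓ ∧ ℓ ≤ level m,
      if level m - ℓ < logCount d ℓ then (2 : ℝ≥0∞) ^ (δ * (level m - ℓ : ℕ)) else 0 := by
    refine Finset.sum_congr (by simp only [and_comm]) fun m hm => ?_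
    rw [if_pos]
    have := (Finset.mem_filter.1 hm).2
    omega
  rw [e]
  refine h.trans ?_
  rw [tsum_eq_sum (s := Finset.range (logCount d ℓ)) fun i hi => by
    rw [if_neg (by simpa using hi), mul_zero], Finset.mul_sum]
  refine Finset.sum_le_sum fun j hj => ?_
  have hj' := Finset.mem_range.1 hj
  rw [if_pos hj', levelCount, ← Nat.cast_mul, ← mul_pow]
  gcongr
  have := logCount_add_one_le hd ℓ 0
  nlinarith

end Counting

/-! ### Square functions of level-wise bounded functions -/

section LevelBound

theorem lintegral_Lp_sum_le {ι X : Type*} [MeasurableSpace X] {μ : Measure X} (F : Finset ι)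
    {f : ι → X → ℝ≥0∞} (hf : ∀ i, Measurable (f i)) {t : ℝ} (ht : 1 ≤ t) :
    (∫⁻ z, (∑ i ∈ F, f i z) ^ t ∂μ) ^ (1 / t) ≤ ∑ i ∈ F, (∫⁻ z, f i z ^ t ∂μ) ^ (1 / t) := by
  classical
  have ht0 : 0 < t := by linarith
  induction F using Finset.induction_on with
  | empty => simp [ht0]
  | insert i F hi ih =>
    simp only [Finset.sum_insert hi]
    refine le_trans ?_ (add_le_add le_rfl ih)
    exact ENNReal.lintegral_Lp_add_le (hf i).aemeasurable
      (Finset.measurable_sum F fun i _ => hf i).aemeasurable ht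

theorem rpow_sum_le_sum_rpow {ι : Type*} (F : Finset ι) (f : ι → ℝ≥0∞) {t : ℝ} (ht : 0 < t)
    (ht1 : t ≤ 1) : (∑ i ∈ F, f i) ^ t ≤ ∑ i ∈ F, f i ^ t := by
  classical
  induction F using Finset.induction_on with
  | empty => simp [ht]
  | insert i F hi ih =>
    simp only [Finset.sum_insert hi]
    exact (ENNReal.rpow_add_le_add_rpow _ _ ht.le ht1).trans (add_le_add le_rfl ih)

variable {X : Type*} [MeasurableSpace X]

/-- Functions `E_m` vanishing below the level `ℓ`, of bounded `L_1`-norm, and with supremum norm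
growing as `2^(|m| - ℓ)`. -/
structure LevelBound (μ : Measure X) (E : (Fin d → ℕ) → X → ℝ≥0∞) (C : ℝ≥0∞) (ℓ : ℕ) : Prop where
  measurable : ∀ m, Measurable (E m)
  eq_zero : ∀ m z, level m < ℓ → E m z = 0
  le : ∀ m z, ℓ ≤ level m → E m z ≤ C * 2 ^ (level m - ℓ)
  lintegral_le : ∀ m, ∫⁻ z, E m z ∂μ ≤ C

/-- The weighted square function. -/
def levelSquare (s : ℝ) (E : (Fin d → ℕ) → X → ℝ≥0∞) (F : Finset (Fin d → ℕ)) (z : X) : ℝ≥0∞ :=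
  (∑ m ∈ F, ((2 : ℝ≥0∞) ^ (-s * level m) * E m z) ^ (2 : ℝ)) ^ (1 / (2 : ℝ))

variable {μ : Measure X} {E : (Fin d → ℕ) → X → ℝ≥0∞} {C : ℝ≥0∞} {ℓ : ℕ}

theorem LevelBound.measurable_levelSquare (h : LevelBound μ E C ℓ) (s : ℝ)
    (F : Finset (Fin d → ℕ)) : Measurable (levelSquare s E F) :=
  (Finset.measurable_sum F fun m _ => ((h.measurable m).const_mul _).pow_const _).pow_const _

/-- Interpolation: E^r is at most the (r-1)-th power of its supremum times E, and E has bounded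
integral. -/
theorem LevelBound.lintegral_rpow_le (h : LevelBound μ E C ℓ) {m : Fin d → ℕ} (hm : ℓ ≤ level m)
    {r : ℝ} (hr : 1 ≤ r) (s : ℝ) : ∫⁻ z, ((2 : ℝ≥0∞) ^ (-s * level m) * E m z) ^ r ∂μ ≤
      (C * 2 ^ (-s * ℓ)) ^ r * 2 ^ (-(s * r - r + 1) * (level m - ℓ : ℕ)) := by
  have hr0 : 0 < r := by linarith
  obtain ⟨j, hj⟩ := Nat.exists_eq_add_of_le hm
  have hle : ∀ z, E m z ^ r ≤ (C * 2 ^ j) ^ (r - 1) * E m z := fun z => by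
    conv_lhs => rw [show r = (r - 1) + 1 by ring]
    rw [ENNReal.rpow_add_of_nonneg _ _ (by linarith) (by norm_num), ENNReal.rpow_one]
    have := h.le m z hm
    rw [hj, Nat.add_sub_cancel_left] at this
    gcongr
  calc ∫⁻ z, ((2 : ℝ≥0∞) ^ (-s * level m) * E m z) ^ r ∂μ
      ≤ ∫⁻ z, ((2 : ℝ≥0∞) ^ (-s * level m)) ^ r * (C * 2 ^ j) ^ (r - 1) * E m z ∂μ := by
        refine lintegral_mono fun z => ?_
        rw [ENNReal.mul_rpow_of_nonneg _ _ hr0.le, mul_assoc]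
        gcongr
        exact hle z
    _ = ((2 : ℝ≥0∞) ^ (-s * level m)) ^ r * (C * 2 ^ j) ^ (r - 1) * ∫⁻ z, E m z ∂μ :=
        lintegral_const_mul _ (h.measurable m)
    _ ≤ ((2 : ℝ≥0∞) ^ (-s * level m)) ^ r * (C * 2 ^ j) ^ (r - 1) * C := by
        gcongr
        exact h.lintegral_le m
    _ = C ^ (r - 1 + 1) * (((2 : ℝ≥0∞) ^ (-s * level m)) ^ r * (2 ^ (j : ℝ)) ^ (r - 1)) := by
        rw [ENNReal.rpow_add_of_nonneg _ _ (by linarith) (by norm_num), ENNReal.rpow_one,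
          ENNReal.mul_rpow_of_nonneg _ _ (by linarith), ENNReal.rpow_natCast]
        ring
    _ = _ := by
        rw [hj, Nat.add_sub_cancel_left, ENNReal.mul_rpow_of_nonneg _ _ hr0.le, mul_assoc,
          sub_add_cancel]
        simp only [← ENNReal.rpow_mul]
        rw [← ENNReal.rpow_add _ _ (by norm_num) (by norm_num),
          ← ENNReal.rpow_add _ _ (by norm_num) (by norm_num)]
        congr 2
        push_cast
        ring

theorem LevelBound.lintegral_rpow_eq_zero (h : LevelBound μ E C ℓ) {m : Fin d → ℕ}
    (hm : ¬ ℓ ≤ level m) {r : ℝ} (hr : 0 < r) (s : ℝ) :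
    ∫⁻ z, ((2 : ℝ≥0∞) ^ (-s * level m) * E m z) ^ r ∂μ = 0 := by
  simp [h.eq_zero m _ (not_le.1 hm), hr]

/-- The bound for exponents `q ≤ r`, `2 ≤ r`, by Minkowski's inequality. -/
theorem LevelBound.lintegral_levelSquare_le (h : LevelBound μ E C ℓ) (s : ℝ)
    (F : Finset (Fin d → ℕ)) {q r : ℝ} (hq : 0 < q) (hqr : q ≤ r) (hr : 2 ≤ r) :
    (∫⁻ z, levelSquare s E F z ^ q ∂μ) ^ (1 / q) ≤ μ Set.univ ^ (1 / q - 1 / r) * (C * 2 ^ (-s * ℓ) *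
      (∑ m ∈ F with ℓ ≤ level m, (2 : ℝ≥0∞) ^ (-(2 * (s - 1 + 1 / r)) * (level m - ℓ : ℕ)))
        ^ (1 / (2 : ℝ))) := by
  have hr0 : 0 < r := by linarith
  -- On a finite measure space the exponent q may be raised to r.
  have h1 := eLpNorm'_le_eLpNorm'_mul_rpow_measure_univ (μ := μ) hq hqr
    (h.measurable_levelSquare s F).aestronglyMeasurable
  simp only [eLpNorm', enorm_eq_self] at h1
  refine h1.trans ?_
  rw [mul_comm]
  gcongr
  have h2 : (∫⁻ z, levelSquare s E F z ^ r ∂μ) ^ (1 / r) =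
      ((∫⁻ z, (∑ m ∈ F, ((2 : ℝ≥0∞) ^ (-s * level m) * E m z) ^ (2 : ℝ)) ^ (r / 2) ∂μ) ^ (1 / (r / 2)))
        ^ (1 / (2 : ℝ)) := by
    simp only [levelSquare, ← ENNReal.rpow_mul]
    congr 1
    · congr 1
      ext z
      congr 1
      ring
    · field_simp
  rw [h2]
  -- The triangle inequality in L_(r/2) for the squares, available because r ≥ 2.
  have h3 := lintegral_Lp_sum_le (μ := μ) F
    (fun m => ((h.measurable m).const_mul ((2 : ℝ≥0∞) ^ (-s * level m))).pow_const (2 : ℝ))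
    (by linarith : 1 ≤ r / 2)
  have h4 : ∑ m ∈ F, (∫⁻ z, (((2 : ℝ≥0∞) ^ (-s * level m) * E m z) ^ (2 : ℝ)) ^ (r / 2) ∂μ) ^ (1 / (r / 2)) ≤
      (C * 2 ^ (-s * ℓ)) ^ (2 : ℝ) *
        ∑ m ∈ F with ℓ ≤ level m, (2 : ℝ≥0∞) ^ (-(2 * (s - 1 + 1 / r)) * (level m - ℓ : ℕ)) := by
    rw [Finset.mul_sum, Finset.sum_filter]
    refine Finset.sum_le_sum fun m _ => ?_
    simp only [← ENNReal.rpow_mul _ 2 (r / 2), mul_div_cancel₀ r (two_ne_zero)]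
    split_ifs with hm
    · refine (ENNReal.rpow_le_rpow (h.lintegral_rpow_le hm (by linarith) s) (by positivity)).trans_eq ?_
      rw [ENNReal.mul_rpow_of_nonneg _ _ (by positivity)]
      simp only [← ENNReal.rpow_mul]
      congr 2
      · field_simp
      · field_simp
    · rw [h.lintegral_rpow_eq_zero hm hr0, ENNReal.zero_rpow_of_pos (by positivity)]
  refine (ENNReal.rpow_le_rpow (h3.trans h4) (by norm_num)).trans_eq ?_
  rw [ENNReal.mul_rpow_of_nonneg _ _ (by norm_num), ← ENNReal.rpow_mul]
  norm_num

/-- The bound for exponents `q ≤ 2`. -/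
theorem LevelBound.lintegral_levelSquare_le_of_le_two (h : LevelBound μ E C ℓ) (s : ℝ)
    (F : Finset (Fin d → ℕ)) {q : ℝ} (hq : 1 ≤ q) (hq2 : q ≤ 2) :
    (∫⁻ z, levelSquare s E F z ^ q ∂μ) ^ (1 / q) ≤ C * 2 ^ (-s * ℓ) *
      (∑ m ∈ F with ℓ ≤ level m, (2 : ℝ≥0∞) ^ (-(s * q - q + 1) * (level m - ℓ : ℕ))) ^ (1 / q) := by
  have hq0 : 0 < q := by linarith
  have h1 : ∀ z, levelSquare s E F z ^ q ≤ ∑ m ∈ F, ((2 : ℝ≥0∞) ^ (-s * level m) * E m z) ^ q :=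
    fun z => by
      rw [levelSquare, ← ENNReal.rpow_mul]
      -- The power q/2 ≤ 1 is subadditive; equivalently, the ℓ_2 norm is at most the ℓ_q norm.
      refine (rpow_sum_le_sum_rpow F _ (by positivity) (by linarith)).trans_eq ?_
      refine Finset.sum_congr rfl fun m _ => ?_
      rw [← ENNReal.rpow_mul]
      congr 1
      ring
  have h2 : ∫⁻ z, levelSquare s E F z ^ q ∂μ ≤ (C * 2 ^ (-s * ℓ)) ^ q *
      ∑ m ∈ F with ℓ ≤ level m, (2 : ℝ≥0∞) ^ (-(s * q - q + 1) * (level m - ℓ : ℕ)) := by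
    refine (lintegral_mono h1).trans ?_
    rw [lintegral_finsetSum _ fun m _ => ((h.measurable m).const_mul _).pow_const _, Finset.mul_sum,
      Finset.sum_filter]
    refine Finset.sum_le_sum fun m _ => ?_
    split_ifs with hm
    · exact h.lintegral_rpow_le hm hq s
    · rw [h.lintegral_rpow_eq_zero hm hq0]
  refine (ENNReal.rpow_le_rpow h2 (by positivity)).trans_eq ?_
  rw [ENNReal.mul_rpow_of_nonneg _ _ (by positivity), ← ENNReal.rpow_mul, mul_one_div_cancel hq0.ne',
    ENNReal.rpow_one]

end LevelBound

end Frolov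

end

noncomputable section

namespace Frolov

open MeasureTheory Filter Topology

variable {d : ℕ}

/-! ### Bounds for the square functions -/

section LevelBound

theorem levelSquare_le_add {X : Type*} (s : ℝ) (E : (Fin d → ℕ) → X → ℝ≥0∞) (F : Finset (Fin d → ℕ)) (b : ℕ)
    (z : X) : levelSquare s E F z ≤ levelSquare s E (F.filter fun m => level m < b) z +
      levelSquare s E (F.filter fun m => b ≤ level m) z := by
  simp only [levelSquare]
  refine le_trans (le_of_eq ?_) (ENNReal.rpow_add_le_add_rpow _ _ (by norm_num) (by norm_num))
  rw [← Finset.sum_filter_add_sum_filter_not F fun m => level m < b]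
  simp only [not_lt]

variable {X : Type*} [MeasurableSpace X] (μ : Measure X) [IsFiniteMeasure μ]

/-- With r = max(q, 2) the sum over levels decays like 2^(-2(s - 1 + 1/r)j). The exponent is
positive because of s > 1/2 when r = 2 and because of s > 1 - 1/q when r = q, so only the count of
the first level remains. -/
theorem exists_lintegral_levelSquare_le_of_half_lt {C : ℝ≥0∞} (hC : C ≠ ⊤) {s q : ℝ} (hq : 1 < q)
    (hs : 1 / 2 < s) (hsq : 0 < s - 1 + 1 / q) : ∃ C' : ℝ≥0∞, C' ≠ ⊤ ∧
      ∀ (ℓ : ℕ) (E : (Fin d → ℕ) → X → ℝ≥0∞), LevelBound μ E C ℓ → ∀ F,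
        (∫⁻ z, levelSquare s E F z ^ q ∂μ) ^ (1 / q) ≤
          C' * (2 ^ (-s * ℓ) * (levelCount d ℓ : ℝ≥0∞) ^ (1 / (2 : ℝ))) := by
  set r := max q 2 with hr
  have hqr : q ≤ r := le_max_left _ _
  have hr0 : 0 < r := by linarith
  have hδ : 0 < 2 * (s - 1 + 1 / r) := by
    rcases max_choice q 2 with h | h <;> rw [hr, h] <;> linarith
  have hg := geomSum_ne_top d hδ
  have hqr' : 0 ≤ 1 / q - 1 / r := sub_nonneg.2 (one_div_le_one_div_of_le (by linarith) hqr)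
  refine ⟨μ Set.univ ^ (1 / q - 1 / r) * (C * geomSum d (2 * (s - 1 + 1 / r)) ^ (1 / (2 : ℝ))),
    by finiteness, fun ℓ E h F => ?_⟩
  refine (h.lintegral_levelSquare_le s F (by linarith) hqr (le_max_right _ _)).trans ?_
  rw [mul_assoc (μ Set.univ ^ (1 / q - 1 / r))]
  refine mul_le_mul' le_rfl ?_
  refine (mul_le_mul_right (ENNReal.rpow_le_rpow (sum_two_rpow_level_le F ℓ _)
    (by norm_num : (0 : ℝ) ≤ 1 / 2)) _).trans_eq ?_
  rw [ENNReal.mul_rpow_of_nonneg _ _ (by norm_num)]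
  ring

/-- The levels are split at ℓ + A, where 2^A is comparable to the count P of level ℓ. Below, the L_2
estimate gives the displayed finite sum. Above, the ℓ_q estimate decays with rate η = q(s - 1 + 1/q)
> 0 and totals (2^(-ηA) P)^(1/q), of order P^((1-η)/q) = P^(1-s). -/
theorem exists_lintegral_levelSquare_le_of_le_half (hd : 1 ≤ d) {C : ℝ≥0∞} (hC : C ≠ ⊤) {s q : ℝ}
    (hq : 1 < q) (hq2 : q ≤ 2) (hsq : 0 < s - 1 + 1 / q) : ∃ C' : ℝ≥0∞, C' ≠ ⊤ ∧
      ∀ (ℓ : ℕ) (E : (Fin d → ℕ) → X → ℝ≥0∞), LevelBound μ E C ℓ → ∀ F,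
        (∫⁻ z, levelSquare s E F z ^ q ∂μ) ^ (1 / q) ≤ C' * (2 ^ (-s * ℓ) *
          ((levelCount d ℓ * ∑ j ∈ Finset.range (logCount d ℓ), (2 : ℝ≥0∞) ^ ((1 - 2 * s) * j)) ^
            (1 / (2 : ℝ)) + (levelCount d ℓ : ℝ≥0∞) ^ (1 - s))) := by
  have hq0 : 0 < q := by linarith
  set η := s * q - q + 1 with hη
  have hη0 : 0 < η := by
    have e : η = q * (s - 1 + 1 / q) := by rw [hη]; field_simp
    rw [e]; positivity
  set D : ℝ≥0∞ := ((d ^ (d - 1) : ℕ) : ℝ≥0∞) with hD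
  have hDt : D ≠ ⊤ := ENNReal.natCast_ne_top _
  have hg := geomSum_ne_top d hη0
  have hqr' : 0 ≤ 1 / q - 1 / 2 := sub_nonneg.2 (one_div_le_one_div_of_le (by linarith) hq2)
  set C₁ : ℝ≥0∞ := μ Set.univ ^ (1 / q - 1 / 2) * (C * D ^ (1 / (2 : ℝ))) with hC₁
  set C₂ : ℝ≥0∞ := C * (2 ^ η * D * geomSum d η) ^ (1 / q) with hC₂
  have hC₁t : C₁ ≠ ⊤ := by finiteness
  have hC₂t : C₂ ≠ ⊤ := by finiteness
  refine ⟨C₁ + C₂, by finiteness, fun ℓ E h F => ?_⟩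
  set A := logCount d ℓ with hA
  set P : ℝ≥0∞ := (levelCount d ℓ : ℝ≥0∞) with hP
  have hP1 : 1 ≤ P := by rw [hP]; exact_mod_cast one_le_levelCount d ℓ
  have hP0 : P ≠ 0 := (zero_lt_one.trans_le hP1).ne'
  have hPt : P ≠ ⊤ := ENNReal.natCast_ne_top _
  set F₁ := F.filter fun m => level m < ℓ + A with hF₁
  set F₂ := F.filter fun m => ℓ + A ≤ level m with hF₂
  have hlow : (∫⁻ z, levelSquare s E F₁ z ^ q ∂μ) ^ (1 / q) ≤ C₁ * (2 ^ (-s * ℓ) *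
      (P * ∑ j ∈ Finset.range A, (2 : ℝ≥0∞) ^ ((1 - 2 * s) * j)) ^ (1 / (2 : ℝ))) := by
    refine (h.lintegral_levelSquare_le s F₁ hq0 hq2 le_rfl).trans ?_
    have e : -(2 * (s - 1 + 1 / 2)) = 1 - 2 * s := by ring
    rw [e, hC₁, mul_assoc (μ Set.univ ^ (1 / q - 1 / 2))]
    refine mul_le_mul' le_rfl ?_
    have h1 : ∑ m ∈ F₁ with ℓ ≤ level m, (2 : ℝ≥0∞) ^ ((1 - 2 * s) * (level m - ℓ : ℕ)) ≤
        D * (P * ∑ j ∈ Finset.range A, (2 : ℝ≥0∞) ^ ((1 - 2 * s) * j)) := by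
      have := sum_two_rpow_level_low_le hd F ℓ (1 - 2 * s)
      rw [hF₁, Finset.filter_filter]
      simp only [and_comm (a := level _ < _)]
      refine this.trans_eq (mul_assoc _ _ _)
    refine (mul_le_mul_right (ENNReal.rpow_le_rpow h1 (by norm_num : (0 : ℝ) ≤ 1 / 2)) _).trans_eq ?_
    rw [ENNReal.mul_rpow_of_nonneg _ _ (by norm_num)]
    ring
  have hhigh : (∫⁻ z, levelSquare s E F₂ z ^ q ∂μ) ^ (1 / q) ≤ C₂ * (2 ^ (-s * ℓ) * P ^ (1 - s)) := by
    refine (h.lintegral_levelSquare_le_of_le_two s F₂ hq.le hq2).trans ?_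
    have h1 : ∑ m ∈ F₂ with ℓ ≤ level m, (2 : ℝ≥0∞) ^ (-η * (level m - ℓ : ℕ)) ≤
        2 ^ (-η * A) * (D * P * geomSum d η) := by
      have h2 : F₂.filter (fun m => ℓ ≤ level m) = F₂ := Finset.filter_true_of_mem fun m hm => by
        have := (Finset.mem_filter.1 hm).2
        omega
      rw [h2]
      refine le_trans (le_of_eq ?_) (mul_le_mul_right (sum_two_rpow_level_high_le hd F ℓ η) _)
      rw [Finset.mul_sum]
      refine Finset.sum_congr rfl fun m hm => ?_
      have h3 := (Finset.mem_filter.1 hm).2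
      rw [← ENNReal.rpow_add _ _ (by norm_num) (by norm_num)]
      congr 1
      rw [Nat.cast_sub (by omega), Nat.cast_sub h3]
      push_cast
      ring
    -- The integer logarithm satisfies P < 2^(A+1), which is the origin of the factor 2^η.
    have h4 : (2 : ℝ≥0∞) ^ (-η * A) ≤ 2 ^ η * P ^ (-η) := by
      have h5 : P ≤ 2 * 2 ^ A := by
        have := Nat.lt_pow_succ_log_self (by norm_num : 1 < 2) (levelCount d ℓ)
        rw [pow_succ'] at this
        rw [hP]
        exact_mod_cast this.le
      have h6 : (2 : ℝ≥0∞) ^ (-η * A) = ((2 ^ A)⁻¹) ^ η := by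
        rw [← ENNReal.rpow_natCast, ← ENNReal.rpow_neg, ← ENNReal.rpow_mul]
        congr 1
        ring
      rw [h6, ENNReal.rpow_neg, ← ENNReal.inv_rpow, ← ENNReal.mul_rpow_of_nonneg _ _ hη0.le]
      gcongr
      rw [← div_eq_mul_inv, ENNReal.le_div_iff_mul_le (Or.inl hP0) (Or.inl hPt), mul_comm,
        ← div_eq_mul_inv, ENNReal.div_le_iff (by positivity) (by finiteness)]
      exact h5
    have h7 : (∑ m ∈ F₂ with ℓ ≤ level m, (2 : ℝ≥0∞) ^ (-η * (level m - ℓ : ℕ))) ^ (1 / q) ≤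
        (2 ^ η * D * geomSum d η) ^ (1 / q) * P ^ (1 - s) := by
      calc _ ≤ ((2 ^ η * D * geomSum d η) * (P ^ (-η) * P)) ^ (1 / q) := by
            refine ENNReal.rpow_le_rpow (h1.trans ?_) (by positivity)
            refine (mul_le_mul_left h4 _).trans_eq ?_
            ring
        _ = _ := by
            rw [ENNReal.mul_rpow_of_nonneg _ _ (by positivity)]
            congr 1
            have e : P ^ (-η) * P = P ^ (-η + 1) := by
              rw [ENNReal.rpow_add _ _ hP0 hPt, ENNReal.rpow_one]
            rw [e, ← ENNReal.rpow_mul]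
            congr 1
            rw [hη]
            field_simp
            ring
    refine (mul_le_mul_right h7 _).trans_eq ?_
    rw [hC₂]
    ring
  calc (∫⁻ z, levelSquare s E F z ^ q ∂μ) ^ (1 / q)
      ≤ (∫⁻ z, (levelSquare s E F₁ + levelSquare s E F₂) z ^ q ∂μ) ^ (1 / q) := by
        refine ENNReal.rpow_le_rpow (lintegral_mono fun z => ?_) (by positivity)
        exact ENNReal.rpow_le_rpow (levelSquare_le_add s E F (ℓ + A) z) hq0.le
    _ ≤ _ := ENNReal.lintegral_Lp_add_le (h.measurable_levelSquare s F₁).aemeasurable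
        (h.measurable_levelSquare s F₂).aemeasurable hq.le
    _ ≤ _ := add_le_add hlow hhigh
    _ ≤ (C₁ + C₂) * (2 ^ (-s * ℓ) * (P * ∑ j ∈ Finset.range A, (2 : ℝ≥0∞) ^ ((1 - 2 * s) * j)) ^
          (1 / (2 : ℝ))) + (C₁ + C₂) * (2 ^ (-s * ℓ) * P ^ (1 - s)) := by
        gcongr
        · exact le_self_add
        · exact le_add_self
    _ = _ := by ring

/-- The growing geometric sum of the low levels is dominated by its end, 2^((1-2s)A) ≤ P^(1-2s), and
(P · P^(1-2s))^(1/2) = P^(1-s) matches the high levels. -/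
theorem exists_lintegral_levelSquare_le_of_lt_half (hd : 1 ≤ d) {C : ℝ≥0∞} (hC : C ≠ ⊤) {s q : ℝ}
    (hq : 1 < q) (hq2 : q ≤ 2) (hs : s < 1 / 2) (hsq : 0 < s - 1 + 1 / q) : ∃ C' : ℝ≥0∞, C' ≠ ⊤ ∧
      ∀ (ℓ : ℕ) (E : (Fin d → ℕ) → X → ℝ≥0∞), LevelBound μ E C ℓ → ∀ F,
        (∫⁻ z, levelSquare s E F z ^ q ∂μ) ^ (1 / q) ≤
          C' * (2 ^ (-s * ℓ) * (levelCount d ℓ : ℝ≥0∞) ^ (1 - s)) := by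
  obtain ⟨C', hC', h⟩ := exists_lintegral_levelSquare_le_of_le_half μ hd hC hq hq2 hsq
  set δ := 1 - 2 * s with hδ
  have hδ0 : 0 < δ := by linarith
  have hg := geomSum_ne_top d hδ0
  refine ⟨C' * (geomSum d δ ^ (1 / (2 : ℝ)) + 1), by finiteness, fun ℓ E hE F => ?_⟩
  refine (h ℓ E hE F).trans ?_
  set A := logCount d ℓ with hA
  set P : ℝ≥0∞ := (levelCount d ℓ : ℝ≥0∞) with hP
  have hP1 : 1 ≤ P := by rw [hP]; exact_mod_cast one_le_levelCount d ℓ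
  have hP0 : P ≠ 0 := (zero_lt_one.trans_le hP1).ne'
  have hPt : P ≠ ⊤ := ENNReal.natCast_ne_top _
  have h1 : ∑ j ∈ Finset.range A, (2 : ℝ≥0∞) ^ (δ * j) ≤ P ^ δ * geomSum d δ := by
    have h2 : (2 : ℝ≥0∞) ^ (δ * A) ≤ P ^ δ := by
      rw [mul_comm, ENNReal.rpow_mul, ENNReal.rpow_natCast]
      gcongr
      have := Nat.pow_log_le_self 2 (Nat.one_le_iff_ne_zero.1 (one_le_levelCount d ℓ))
      rw [hP]
      exact_mod_cast this
    rw [← Finset.sum_range_reflect]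
    calc ∑ j ∈ Finset.range A, (2 : ℝ≥0∞) ^ (δ * (A - 1 - j : ℕ))
        ≤ ∑ j ∈ Finset.range A, 2 ^ (δ * A) * ((((j + 1) ^ (d - 1) : ℕ) : ℝ≥0∞) * 2 ^ (-δ * j)) := by
          refine Finset.sum_le_sum fun j hj => ?_
          have hj' := Finset.mem_range.1 hj
          have h3 : (1 : ℝ≥0∞) ≤ ((j + 1) ^ (d - 1) : ℕ) := by
            exact_mod_cast Nat.one_le_pow _ _ (by omega)
          calc (2 : ℝ≥0∞) ^ (δ * (A - 1 - j : ℕ)) ≤ 2 ^ (δ * A) * (1 * 2 ^ (-δ * j)) := by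
                rw [one_mul, ← ENNReal.rpow_add _ _ (by norm_num) (by norm_num)]
                refine ENNReal.rpow_le_rpow_of_exponent_le (by norm_num) ?_
                rw [Nat.cast_sub (by omega), Nat.cast_sub (by omega)]
                push_cast
                nlinarith
            _ ≤ _ := by gcongr
      _ = 2 ^ (δ * A) * ∑ j ∈ Finset.range A, (((j + 1) ^ (d - 1) : ℕ) : ℝ≥0∞) * 2 ^ (-δ * j) := by
          rw [Finset.mul_sum]
      _ ≤ _ := mul_le_mul' h2 (ENNReal.sum_le_tsum _)
  have h4 : (P * ∑ j ∈ Finset.range A, (2 : ℝ≥0∞) ^ (δ * j)) ^ (1 / (2 : ℝ)) ≤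
      geomSum d δ ^ (1 / (2 : ℝ)) * P ^ (1 - s) := by
    calc _ ≤ (geomSum d δ * (P * P ^ δ)) ^ (1 / (2 : ℝ)) := by
          refine ENNReal.rpow_le_rpow ((mul_le_mul_right h1 _).trans_eq ?_) (by norm_num)
          ring
      _ = _ := by
          rw [ENNReal.mul_rpow_of_nonneg _ _ (by norm_num)]
          congr 1
          have e : P * P ^ δ = P ^ (1 + δ) := by
            rw [ENNReal.rpow_add _ _ hP0 hPt, ENNReal.rpow_one]
          rw [e, ← ENNReal.rpow_mul]
          congr 1
          rw [hδ]
          ring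
  calc _ ≤ C' * (2 ^ (-s * ℓ) * (geomSum d δ ^ (1 / (2 : ℝ)) * P ^ (1 - s) + P ^ (1 - s))) := by
        gcongr
    _ = _ := by ring

/-- Every low level contributes equally, which leaves the square root of their number. -/
theorem exists_lintegral_levelSquare_le_of_eq_half (hd : 1 ≤ d) {C : ℝ≥0∞} (hC : C ≠ ⊤) {s q : ℝ}
    (hq : 1 < q) (hq2 : q ≤ 2) (hs : s = 1 / 2) (hsq : 0 < s - 1 + 1 / q) : ∃ C' : ℝ≥0∞, C' ≠ ⊤ ∧
      ∀ (ℓ : ℕ) (E : (Fin d → ℕ) → X → ℝ≥0∞), LevelBound μ E C ℓ → ∀ F,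
        (∫⁻ z, levelSquare s E F z ^ q ∂μ) ^ (1 / q) ≤
          C' * (2 ^ (-s * ℓ) * (levelCount d ℓ : ℝ≥0∞) ^ (1 / (2 : ℝ))) *
            ((logCount d ℓ : ℝ≥0∞) ^ (1 / (2 : ℝ)) + 1) := by
  obtain ⟨C', hC', h⟩ := exists_lintegral_levelSquare_le_of_le_half μ hd hC hq hq2 hsq
  refine ⟨C', hC', fun ℓ E hE F => (h ℓ E hE F).trans_eq ?_⟩
  have e1 : 1 - 2 * s = 0 := by rw [hs]; norm_num
  have e2 : 1 - s = 1 / 2 := by rw [hs]; norm_num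
  simp only [e1, e2, zero_mul, ENNReal.rpow_zero, Finset.sum_const, Finset.card_range, nsmul_eq_mul,
    mul_one]
  rw [ENNReal.mul_rpow_of_nonneg _ _ (by norm_num)]
  ring

end LevelBound

namespace LocalMeans

variable {L : ℕ} (K : LocalMeans L) {p s : ℝ}

/-! ### The worst-case error -/

theorem measurable_square (s : ℝ) (T : 𝓢'(Space d, ℂ)) : Measurable (K.square s T) :=
  (Measurable.tsum fun m => ((K.continuous_conv m T).enorm.measurable.const_mul _).pow_const
    _).pow_const _

/-- Duality: Cauchy-Schwarz in m splits the weights 2^(s|m|) and 2^(-s|m|) between the local means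
and the errors, and Hölder in z produces the Sobolev norm and the dual square function. -/
theorem worstCaseError_le (hd : 1 ≤ d) {n : ℕ} (hn : 1 ≤ n) (hs : 1 / p < s) {q : ℝ}
    (hpq : p.HolderConjugate q) {R : ℝ} (hR : ∀ (T : 𝓢'(Space d, ℂ)),
      Distribution.dsupport T ⊆ closedCube d → ∀ (m : Fin d → ℕ) (z : Space d),
        K.conv m T z ≠ 0 → z ∈ box d R)
    {E : (Fin d → ℕ) → Space d → ℝ≥0∞} (hEm : ∀ m, Measurable (E m))
    (hE : ∀ m z, ‖K.latticeError n m z‖ₑ ≤ E m z) {B : ℝ≥0∞}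
    (hB : ∀ F, (∫⁻ z in box d R, levelSquare s E F z ^ q) ^ (1 / q) ≤ B) :
    worstCaseError n (K.sobolevCube d s p) (K.sobolevNorm s p) ≤ B := by
  refine iSup₂_le fun T f => iSup_le fun hT => iSup₂_le fun hN hf => ?_
  have hsum := K.hasSum_integral_conv_mul_latticeError hd hn hpq.lt hs hT hf
  -- It suffices to bound the finite partial sums uniformly.
  refine le_of_tendsto hsum.enorm (Eventually.of_forall fun F => ?_)
  have hg : ∀ m, Measurable fun z => ‖K.conv m T z‖ₑ := fun m => (K.continuous_conv m T).enorm.measurable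
  have hG : Measurable (levelSquare s E F) :=
    (Finset.measurable_sum F fun m _ => ((hEm m).const_mul _).pow_const _).pow_const _
  have hpt : ∀ z, ∑ m ∈ F, ‖K.conv m T z‖ₑ * E m z ≤ K.square s T z * levelSquare s E F z := by
    intro z
    have h1 : ∀ m : Fin d → ℕ, ‖K.conv m T z‖ₑ * E m z =
        ((2 : ℝ≥0∞) ^ (s * level m) * ‖K.conv m T z‖ₑ) * (2 ^ (-s * level m) * E m z) := fun m => by
      have : (2 : ℝ≥0∞) ^ (s * level m) * 2 ^ (-s * level m) = 1 := by
        rw [← ENNReal.rpow_add _ _ (by norm_num) (by norm_num)]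
        simp
      rw [mul_mul_mul_comm, this, one_mul]
    simp only [h1]
    refine (ENNReal.inner_le_Lp_mul_Lq F _ _ Real.HolderConjugate.two_two).trans ?_
    rw [levelSquare, square]
    gcongr
    exact ENNReal.sum_le_tsum _
  calc ‖∑ m ∈ F, ∫ z, K.conv m T z * K.latticeError n m z‖ₑ
      ≤ ∑ m ∈ F, ‖∫ z, K.conv m T z * K.latticeError n m z‖ₑ := enorm_sum_le _ _
    _ ≤ ∑ m ∈ F, ∫⁻ z in box d R, ‖K.conv m T z‖ₑ * E m z := by
        refine Finset.sum_le_sum fun m _ => ?_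
        rw [← setIntegral_eq_integral_of_forall_compl_eq_zero (s := box d R) fun z hz => by
          have : K.conv m T z = 0 := by
            by_contra hne
            exact hz (hR T hT.2 m z hne)
          rw [this, zero_mul]]
        refine (enorm_integral_le_lintegral_enorm _).trans (lintegral_mono fun z => ?_)
        rw [enorm_mul]
        exact mul_le_mul_right (hE m z) _
    _ = ∫⁻ z in box d R, ∑ m ∈ F, ‖K.conv m T z‖ₑ * E m z :=
        (lintegral_finsetSum F fun m _ => (hg m).mul (hEm m)).symm
    _ ≤ ∫⁻ z in box d R, (K.square s T * levelSquare s E F) z := lintegral_mono hpt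
    _ ≤ (∫⁻ z in box d R, K.square s T z ^ p) ^ (1 / p) *
          (∫⁻ z in box d R, levelSquare s E F z ^ q) ^ (1 / q) :=
        ENNReal.lintegral_mul_le_Lp_mul_Lq _ hpq (K.measurable_square s T).aemeasurable hG.aemeasurable
    _ ≤ 1 * B := by
        refine mul_le_mul' ?_ (hB F)
        refine le_trans ?_ hN
        rw [sobolevNorm_eq]
        exact ENNReal.rpow_le_rpow (setLIntegral_le_lintegral _ _) hpq.one_div_nonneg
    _ = B := one_mul B

/-- The errors of the lattice rule for the dual kernels satisfy the level bounds with `2^ℓ ~ n`. -/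
theorem exists_levelBound (hd : 1 ≤ d) : ∃ R c₀ : ℝ, 0 < c₀ ∧ ∃ C : ℝ≥0∞, C ≠ ⊤ ∧
    (∀ (T : 𝓢'(Space d, ℂ)), Distribution.dsupport T ⊆ closedCube d → ∀ (m : Fin d → ℕ)
      (z : Space d), K.conv m T z ≠ 0 → z ∈ box d R) ∧
    ∀ n : ℕ, 1 ≤ n → ∃ ℓ : ℕ, (2 : ℝ) ^ ℓ ≤ max (c₀ * n) 1 ∧ max (c₀ * n) 1 < 2 ^ (ℓ + 1) ∧
      ∃ E : (Fin d → ℕ) → Space d → ℝ≥0∞, LevelBound (volume.restrict (box d R)) E C ℓ ∧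
        ∀ m z, ‖K.latticeError n m z‖ₑ ≤ E m z := by
  obtain ⟨R, -, hR⟩ := K.exists_mem_box_of_conv_ne_zero d
  obtain ⟨c₀, hc₀, C, hC, h⟩ := K.exists_latticeError_bound hd R
  refine ⟨R, c₀, hc₀, C * ENNReal.ofReal (c₀ + 1), by finiteness, hR, fun n hn => ?_⟩
  have hn1 : (1 : ℝ) ≤ n := by exact_mod_cast hn
  obtain ⟨E, hm, hle, h0, h1, h2⟩ := h n hn
  -- The maximum with 1 covers the small n with c₀n < 1, for which ℓ = 0 and there is no level below
  -- ℓ.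
  obtain ⟨ℓ, hℓ1, hℓ2⟩ := exists_nat_pow_near (le_max_right (c₀ * n) 1) (one_lt_two)
  refine ⟨ℓ, hℓ1, hℓ2, E, ⟨hm, fun m z hmℓ => h0 m z ?_, fun m z hmℓ => (h1 m z).trans ?_,
    fun m => (h2 m).trans ?_⟩, hle⟩
  · have h3 : (2 : ℝ) ^ level m < 2 ^ ℓ := pow_lt_pow_right₀ (by norm_num) hmℓ
    have h4 : (1 : ℝ) ≤ 2 ^ level m := one_le_pow₀ (by norm_num)
    rcases le_max_iff.1 hℓ1 with h | h <;> linarith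
  · rw [mul_assoc]
    gcongr
    obtain ⟨j, hj⟩ := Nat.exists_eq_add_of_le hmℓ
    have h3 : (2 : ℝ) ^ ℓ ≤ (c₀ + 1) * n := hℓ1.trans (max_le (by nlinarith) (by nlinarith))
    have e : (2 : ℝ≥0∞) ^ level m / n = ENNReal.ofReal (2 ^ level m / n) := by
      rw [ENNReal.ofReal_div_of_pos (by linarith), ENNReal.ofReal_pow (by norm_num),
        ENNReal.ofReal_ofNat, ENNReal.ofReal_natCast]
    have e' : (2 : ℝ≥0∞) ^ (level m - ℓ) = ENNReal.ofReal (2 ^ (level m - ℓ)) := by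
      rw [ENNReal.ofReal_pow (by norm_num), ENNReal.ofReal_ofNat]
    rw [e, e', ← ENNReal.ofReal_mul (by positivity)]
    refine ENNReal.ofReal_le_ofReal ?_
    rw [div_le_iff₀ (by linarith), hj, Nat.add_sub_cancel_left, pow_add]
    have : (0 : ℝ) < 2 ^ j := by positivity
    nlinarith
  · refine le_mul_of_one_le_right' ?_
    rw [ENNReal.one_le_ofReal]
    linarith

end LocalMeans

end Frolov

end

noncomputable section

namespace Frolov

variable {d : ℕ}

/-! ### The upper bounds -/

section Asymptotics

/-- For n ≥ 2 the logarithm is at least log 2 > 0, so additive constants in ℓ log 2 ≤ log(c₀ + 1) +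
log n can be absorbed. -/
theorem exists_two_rpow_le_and_level_le {c₀ s : ℝ} (hc₀ : 0 < c₀) (hs : 0 < s) : ∃ C : ℝ, 1 ≤ C ∧
    ∀ n ℓ : ℕ, 2 ≤ n → (2 : ℝ) ^ ℓ ≤ max (c₀ * n) 1 → max (c₀ * n) 1 < 2 ^ (ℓ + 1) →
      (2 : ℝ) ^ (-s * ℓ) ≤ C * (n : ℝ) ^ (-s) ∧ (ℓ : ℝ) + 1 ≤ C * Real.log n := by
  have hl2 : 0 < Real.log 2 := Real.log_pos (by norm_num)
  have hlc : 0 < Real.log (c₀ + 1) := Real.log_pos (by linarith)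
  set B : ℝ := (Real.log (c₀ + 1) / Real.log 2 + 1) / Real.log 2 + 1 / Real.log 2 with hB
  refine ⟨max 1 (max ((c₀ / 2) ^ (-s)) B), le_max_left _ _, fun n ℓ hn h1 h2 => ?_⟩
  have hn2 : (2 : ℝ) ≤ n := by exact_mod_cast hn
  have hln : Real.log 2 ≤ Real.log n := Real.log_le_log (by norm_num) hn2
  constructor
  · have h3 : c₀ / 2 * n ≤ 2 ^ ℓ := by
      have := (le_max_left _ _).trans h2.le
      rw [pow_succ] at this
      linarith
    calc (2 : ℝ) ^ (-s * ℓ) = (2 ^ ℓ) ^ (-s) := by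
          rw [← Real.rpow_natCast, ← Real.rpow_mul (by norm_num), mul_comm]
      _ ≤ (c₀ / 2 * n) ^ (-s) :=
          Real.rpow_le_rpow_of_nonpos (by positivity) h3 (by linarith)
      _ = (c₀ / 2) ^ (-s) * (n : ℝ) ^ (-s) := Real.mul_rpow (by positivity) (by positivity)
      _ ≤ _ := by
          gcongr
          exact (le_max_left _ _).trans (le_max_right _ _)
  · have h3 : (2 : ℝ) ^ ℓ ≤ (c₀ + 1) * n := h1.trans (max_le (by nlinarith) (by nlinarith))
    have h4 := Real.log_le_log (by positivity) h3
    rw [Real.log_pow, Real.log_mul (by positivity) (by positivity)] at h4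
    have h5 : (ℓ : ℝ) ≤ (Real.log (c₀ + 1) / Real.log 2 + 1) / Real.log 2 * Real.log n := by
      rw [div_mul_eq_mul_div, le_div_iff₀ hl2, add_mul, one_mul]
      refine h4.trans (add_le_add ?_ le_rfl)
      rw [div_mul_eq_mul_div, le_div_iff₀ hl2]
      exact mul_le_mul_of_nonneg_left hln hlc.le
    have h6 : 1 ≤ 1 / Real.log 2 * Real.log n := by
      rw [div_mul_eq_mul_div, le_div_iff₀ hl2]
      linarith
    calc (ℓ : ℝ) + 1 ≤ B * Real.log n := by rw [hB, add_mul]; linarith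
      _ ≤ _ := by
          gcongr
          exact (le_max_right _ _).trans (le_max_right _ _)

theorem exists_two_rpow_mul_levelCount_rpow_le (hd : 1 ≤ d) {c₀ s : ℝ} (hc₀ : 0 < c₀) (hs : 0 < s)
    {y : ℝ} (hy : 0 ≤ y) : ∃ C : ℝ, 0 < C ∧
    ∀ n ℓ : ℕ, 2 ≤ n → (2 : ℝ) ^ ℓ ≤ max (c₀ * n) 1 → max (c₀ * n) 1 < 2 ^ (ℓ + 1) →
      (2 : ℝ≥0∞) ^ (-s * ℓ) * (levelCount d ℓ : ℝ≥0∞) ^ y ≤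
        ENNReal.ofReal (C * ((n : ℝ) ^ (-s) * Real.log n ^ (((d : ℝ) - 1) * y))) := by
  obtain ⟨C, hC, h⟩ := exists_two_rpow_le_and_level_le hc₀ hs
  refine ⟨C * C ^ (((d : ℝ) - 1) * y), by positivity, fun n ℓ hn h1 h2 => ?_⟩
  obtain ⟨h3, h4⟩ := h n ℓ hn h1 h2
  have hn2 : (2 : ℝ) ≤ n := by exact_mod_cast hn
  have hlog : 0 ≤ Real.log n := Real.log_nonneg (by linarith)
  have hd1 : (0 : ℝ) ≤ (d : ℝ) - 1 := by
    have : (1 : ℝ) ≤ d := by exact_mod_cast hd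
    linarith
  have e1 : (2 : ℝ≥0∞) ^ (-s * ℓ) = ENNReal.ofReal ((2 : ℝ) ^ (-s * ℓ)) := by
    rw [← ENNReal.ofReal_rpow_of_pos two_pos, ENNReal.ofReal_ofNat]
  have e2 : (levelCount d ℓ : ℝ≥0∞) ^ y = ENNReal.ofReal (((ℓ : ℝ) + 1) ^ (((d : ℝ) - 1) * y)) := by
    rw [Real.rpow_mul (by positivity), ← Nat.cast_pred (by omega), Real.rpow_natCast,
      ← ENNReal.ofReal_rpow_of_nonneg (by positivity) hy, levelCount]
    congr 1
    rw [← ENNReal.ofReal_natCast]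
    push_cast
    rfl
  rw [e1, e2, ← ENNReal.ofReal_mul (by positivity)]
  refine ENNReal.ofReal_le_ofReal ?_
  calc (2 : ℝ) ^ (-s * ℓ) * ((ℓ : ℝ) + 1) ^ (((d : ℝ) - 1) * y)
      ≤ (C * (n : ℝ) ^ (-s)) * (C * Real.log n) ^ (((d : ℝ) - 1) * y) := by
        gcongr
    _ = _ := by
        rw [Real.mul_rpow (by positivity) hlog]
        ring

/-- The count is polynomial in ℓ, hence its logarithm is of order log ℓ, at most of order log log n.
The restriction n ≥ 3 makes log log n bounded below by a positive number, which absorbs the summand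
1. -/
theorem exists_logCount_rpow_add_one_le {c₀ : ℝ} (hc₀ : 0 < c₀) : ∃ C : ℝ, 0 < C ∧
    ∀ n ℓ : ℕ, 3 ≤ n → (2 : ℝ) ^ ℓ ≤ max (c₀ * n) 1 → max (c₀ * n) 1 < 2 ^ (ℓ + 1) →
      (logCount d ℓ : ℝ≥0∞) ^ (1 / (2 : ℝ)) + 1 ≤
        ENNReal.ofReal (C * Real.sqrt (Real.log (Real.log n))) := by
  obtain ⟨C, hC, h⟩ := exists_two_rpow_le_and_level_le hc₀ one_pos
  have hl2 : 0 < Real.log 2 := Real.log_pos (by norm_num)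
  have hl3 : 1 < Real.log 3 := by
    rw [Real.lt_log_iff_exp_lt (by norm_num)]
    exact Real.exp_one_lt_three
  set b := Real.log (Real.log 3) with hb
  have hb0 : 0 < b := Real.log_pos hl3
  have hCl : 0 ≤ Real.log C := Real.log_nonneg hC
  set a : ℝ := ((d - 1 : ℕ) : ℝ) / Real.log 2 * (Real.log C / b + 1) with ha
  have ha0 : 0 ≤ a := by positivity
  refine ⟨Real.sqrt a + (Real.sqrt b)⁻¹, by positivity, fun n ℓ hn h1 h2 => ?_⟩
  obtain ⟨-, h4⟩ := h n ℓ (by omega) h1 h2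
  have hn3 : (3 : ℝ) ≤ n := by exact_mod_cast hn
  have hln : Real.log 3 ≤ Real.log n := Real.log_le_log (by norm_num) hn3
  set LL := Real.log (Real.log n) with hLL
  have hbL : b ≤ LL := Real.log_le_log (by linarith) hln
  have h5 : (logCount d ℓ : ℝ) ≤ a * LL := by
    have h6 : (2 : ℝ) ^ logCount d ℓ ≤ ((ℓ : ℝ) + 1) ^ (d - 1) := by
      have := Nat.pow_log_le_self 2 (Nat.one_le_iff_ne_zero.1 (one_le_levelCount d ℓ))
      exact_mod_cast this
    have h7 := Real.log_le_log (by positivity) h6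
    rw [Real.log_pow, Real.log_pow] at h7
    have h8 : Real.log (ℓ + 1) ≤ Real.log C + LL := by
      rw [hLL, ← Real.log_mul (by positivity) (by linarith)]
      exact Real.log_le_log (by positivity) h4
    have h9 : Real.log C ≤ Real.log C / b * LL := by
      rw [div_mul_eq_mul_div, le_div_iff₀ hb0]
      exact mul_le_mul_of_nonneg_left hbL hCl
    rw [ha, mul_assoc, div_mul_eq_mul_div, le_div_iff₀ hl2]
    refine h7.trans (mul_le_mul_of_nonneg_left ?_ (by positivity))
    rw [add_mul, one_mul]
    linarith
  have e : (logCount d ℓ : ℝ≥0∞) ^ (1 / (2 : ℝ)) + 1 =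
      ENNReal.ofReal (Real.sqrt (logCount d ℓ) + 1) := by
    rw [ENNReal.ofReal_add (by positivity) (by norm_num), ENNReal.ofReal_one, Real.sqrt_eq_rpow,
      ← ENNReal.ofReal_rpow_of_nonneg (by positivity) (by norm_num), ENNReal.ofReal_natCast]
  rw [e]
  refine ENNReal.ofReal_le_ofReal ?_
  rw [add_mul, ← Real.sqrt_mul ha0]
  refine add_le_add (Real.sqrt_le_sqrt h5) ?_
  rw [inv_mul_eq_div, le_div_iff₀ (by positivity), one_mul]
  exact Real.sqrt_le_sqrt hbL

end Asymptotics

namespace LocalMeans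

variable {L : ℕ} (K : LocalMeans L) {p s : ℝ}

theorem exists_conjugate (hp : 1 < p) (hs : 1 / p < s) : ∃ q, p.HolderConjugate q ∧ 1 < q ∧
    0 < s - 1 + 1 / q := by
  have h := Real.HolderConjugate.conjExponent hp
  refine ⟨_, h, h.symm.lt, ?_⟩
  have := h.inv_add_inv_eq_one
  simp only [one_div] at hs ⊢
  linarith

theorem exists_worstCaseError_le_of_half_lt (hd : 1 ≤ d) (hp : 1 < p) (hs : 1 / p < s)
    (hs2 : 1 / 2 < s) : ∃ C : ℝ, 0 < C ∧ ∀ n : ℕ, 2 ≤ n →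
      worstCaseError n (K.sobolevCube d s p) (K.sobolevNorm s p) ≤
        ENNReal.ofReal (C * ((n : ℝ) ^ (-s) * Real.log n ^ (((d : ℝ) - 1) / 2))) := by
  obtain ⟨q, hpq, hq, hsq⟩ := exists_conjugate hp hs
  obtain ⟨R, c₀, hc₀, C, hC, hR, h⟩ := K.exists_levelBound hd
  have hfin : MeasureTheory.IsFiniteMeasure (MeasureTheory.volume.restrict (box d R)) :=
    MeasureTheory.isFiniteMeasure_restrict.2 (isCompact_box d R).measure_lt_top.ne
  obtain ⟨C₁, hC₁, h₁⟩ := exists_lintegral_levelSquare_le_of_half_lt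
    (MeasureTheory.volume.restrict (box d R)) hC hq hs2 hsq
  obtain ⟨C₂, hC₂, h₂⟩ := exists_two_rpow_mul_levelCount_rpow_le hd hc₀ (by linarith : 0 < s)
    (by norm_num : (0 : ℝ) ≤ 1 / 2)
  refine ⟨(C₁.toReal + 1) * C₂, by positivity, fun n hn => ?_⟩
  obtain ⟨ℓ, hℓ1, hℓ2, E, hE, hEl⟩ := h n (by omega)
  refine (K.worstCaseError_le hd (by omega) hs hpq hR hE.measurable hEl (h₁ ℓ E hE)).trans ?_
  rw [mul_assoc, ENNReal.ofReal_mul (by positivity)]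
  refine mul_le_mul' ?_ ((h₂ n ℓ hn hℓ1 hℓ2).trans_eq (by rw [mul_one_div]))
  exact ENNReal.le_ofReal_iff_toReal_le hC₁ (by positivity) |>.2 (by linarith)

theorem exists_worstCaseError_le_of_lt_half (hd : 1 ≤ d) (hp : 1 < p) (hs : 1 / p < s)
    (hs2 : s < 1 / 2) : ∃ C : ℝ, 0 < C ∧ ∀ n : ℕ, 2 ≤ n →
      worstCaseError n (K.sobolevCube d s p) (K.sobolevNorm s p) ≤
        ENNReal.ofReal (C * ((n : ℝ) ^ (-s) * Real.log n ^ (((d : ℝ) - 1) * (1 - s)))) := by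
  obtain ⟨q, hpq, hq, hsq⟩ := exists_conjugate hp hs
  have hs0 : 0 < s := lt_trans (by positivity) hs
  -- From s > 1/p = 1 - 1/q and s < 1/2 it follows that 1/q > 1/2.
  have hq2 : q ≤ 2 := by
    have h1 : 1 / 2 < 1 / q := by linarith
    exact (lt_of_one_div_lt_one_div (by linarith) h1).le
  obtain ⟨R, c₀, hc₀, C, hC, hR, h⟩ := K.exists_levelBound hd
  have hfin : MeasureTheory.IsFiniteMeasure (MeasureTheory.volume.restrict (box d R)) :=
    MeasureTheory.isFiniteMeasure_restrict.2 (isCompact_box d R).measure_lt_top.ne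
  obtain ⟨C₁, hC₁, h₁⟩ := exists_lintegral_levelSquare_le_of_lt_half
    (MeasureTheory.volume.restrict (box d R)) hd hC hq hq2 hs2 hsq
  obtain ⟨C₂, hC₂, h₂⟩ := exists_two_rpow_mul_levelCount_rpow_le hd hc₀ hs0
    (by linarith : 0 ≤ 1 - s)
  refine ⟨(C₁.toReal + 1) * C₂, by positivity, fun n hn => ?_⟩
  obtain ⟨ℓ, hℓ1, hℓ2, E, hE, hEl⟩ := h n (by omega)
  refine (K.worstCaseError_le hd (by omega) hs hpq hR hE.measurable hEl (h₁ ℓ E hE)).trans ?_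
  rw [mul_assoc, ENNReal.ofReal_mul (by positivity)]
  refine mul_le_mul' ?_ (h₂ n ℓ hn hℓ1 hℓ2)
  exact ENNReal.le_ofReal_iff_toReal_le hC₁ (by positivity) |>.2 (by linarith)

theorem exists_worstCaseError_le_of_eq_half (hd : 1 ≤ d) (hp : 1 < p) (hs : 1 / p < s)
    (hs2 : s = 1 / 2) : ∃ C : ℝ, 0 < C ∧ ∀ n : ℕ, 3 ≤ n →
      worstCaseError n (K.sobolevCube d s p) (K.sobolevNorm s p) ≤
        ENNReal.ofReal (C * ((n : ℝ) ^ (-s) * Real.log n ^ (((d : ℝ) - 1) / 2) *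
          Real.sqrt (Real.log (Real.log n)))) := by
  obtain ⟨q, hpq, hq, hsq⟩ := exists_conjugate hp hs
  have hs0 : 0 < s := lt_trans (by positivity) hs
  have hq2 : q ≤ 2 := by
    have h1 : 1 / 2 < 1 / q := by linarith
    exact (lt_of_one_div_lt_one_div (by linarith) h1).le
  obtain ⟨R, c₀, hc₀, C, hC, hR, h⟩ := K.exists_levelBound hd
  have hfin : MeasureTheory.IsFiniteMeasure (MeasureTheory.volume.restrict (box d R)) :=
    MeasureTheory.isFiniteMeasure_restrict.2 (isCompact_box d R).measure_lt_top.ne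
  obtain ⟨C₁, hC₁, h₁⟩ := exists_lintegral_levelSquare_le_of_eq_half
    (MeasureTheory.volume.restrict (box d R)) hd hC hq hq2 hs2 hsq
  obtain ⟨C₂, hC₂, h₂⟩ := exists_two_rpow_mul_levelCount_rpow_le hd hc₀ hs0
    (by norm_num : (0 : ℝ) ≤ 1 / 2)
  obtain ⟨C₃, hC₃, h₃⟩ := exists_logCount_rpow_add_one_le hc₀
  refine ⟨(C₁.toReal + 1) * C₂ * C₃, by positivity, fun n hn => ?_⟩
  have hn3 : (3 : ℝ) ≤ n := by exact_mod_cast hn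
  have hlog : 0 ≤ Real.log n := Real.log_nonneg (by linarith)
  obtain ⟨ℓ, hℓ1, hℓ2, E, hE, hEl⟩ := h n (by omega)
  refine (K.worstCaseError_le hd (by omega) hs hpq hR hE.measurable hEl (h₁ ℓ E hE)).trans ?_
  have e : (C₁.toReal + 1) * C₂ * C₃ * ((n : ℝ) ^ (-s) * Real.log n ^ (((d : ℝ) - 1) / 2) *
      Real.sqrt (Real.log (Real.log n))) = (C₁.toReal + 1) *
      (C₂ * ((n : ℝ) ^ (-s) * Real.log n ^ (((d : ℝ) - 1) / 2))) *
        (C₃ * Real.sqrt (Real.log (Real.log n))) := by ring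
  rw [e, ENNReal.ofReal_mul (by positivity), ENNReal.ofReal_mul (by positivity)]
  refine mul_le_mul' (mul_le_mul' ?_ ((h₂ n ℓ (by omega) hℓ1 hℓ2).trans_eq (by rw [mul_one_div])))
    (h₃ n ℓ hn hℓ1 hℓ2)
  exact ENNReal.le_ofReal_iff_toReal_le hC₁ (by positivity) |>.2 (by linarith)

end LocalMeans

end Frolov

end

noncomputable section

namespace Frolov

/-! ### Vanishing moments and the decay of local means of smooth functions -/

section Moments

open MeasureTheory

/-- The moments annihilate the Taylor polynomial of G of degree L, so only the remainder, controlled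
by the derivative of order L + 1, is integrated against Ψ. -/
theorem exists_norm_integral_mul_le_of_moments {Ψ : ℝ → ℂ} (hΨ : Continuous Ψ)
    (hc : HasCompactSupport Ψ) {L : ℕ} (hm : ∀ α ≤ L, ∫ u : ℝ, (u : ℂ) ^ α * Ψ u = 0) :
    ∃ C > 0, ∀ (G : ℝ → ℂ) (D : ℝ), ContDiff ℝ ∞ G → (∀ u, ‖iteratedDeriv (L + 1) G u‖ ≤ D) →
      ‖∫ u, Ψ u * G u‖ ≤ C * D := by
  obtain ⟨R₀, h₀⟩ := hc.isCompact.isBounded.subset_closedBall (0 : ℝ)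
  set R := max R₀ 1 with hR
  have hR0 : 0 < R := by positivity
  have hsupp : ∀ u, u ∉ Set.Icc (-R) R → Ψ u = 0 := fun u hu => by
    by_contra hne
    have := h₀ (subset_tsupport _ hne)
    rw [Metric.mem_closedBall, Real.dist_eq, sub_zero] at this
    exact hu (abs_le.1 (this.trans (le_max_left _ _)))
  have hint : ∀ g : ℝ → ℂ, Continuous g → Integrable fun u => Ψ u * g u := fun g hg =>
    (hΨ.mul hg).integrable_of_hasCompactSupport hc.mul_right
  have hint' : ∀ α : ℕ, Integrable fun u : ℝ => (u : ℂ) ^ α * Ψ u := fun α => by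
    simpa only [mul_comm] using hint (fun u => (u : ℂ) ^ α) (by fun_prop)
  -- The Taylor expansion is taken at the left end -R of an interval containing the support; the
  -- binomial theorem moves the vanishing moments to that centre.
  have hshift : ∀ α ≤ L, ∫ u, Ψ u * ((u + R : ℝ) : ℂ) ^ α = 0 := fun α hα => by
    have h : ∀ u : ℝ, Ψ u * ((u + R : ℝ) : ℂ) ^ α = ∑ k ∈ Finset.range (α + 1),
        ((u : ℂ) ^ k * Ψ u) * ((R : ℂ) ^ (α - k) * (α.choose k : ℂ)) := fun u => by
      rw [Complex.ofReal_add, add_pow, Finset.mul_sum]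
      exact Finset.sum_congr rfl fun k _ => by ring
    simp_rw [h]
    rw [integral_finsetSum _ fun k _ => (hint' k).mul_const _]
    refine Finset.sum_eq_zero fun k hk => ?_
    rw [integral_mul_const, hm k (by have := Finset.mem_range.1 hk; omega), zero_mul]
  have hab : -R ≤ R := by linarith
  refine ⟨(∫ u, ‖Ψ u‖) * (2 * R) ^ (L + 1) + 1, by positivity, fun G D hG hD => ?_⟩
  have hD0 : 0 ≤ D := (norm_nonneg _).trans (hD 0)
  set P : ℝ → ℂ := taylorWithinEval G L (Set.Icc (-R) R) (-R) with hP
  have hP' : ∀ u, P u = ∑ k ∈ Finset.range (L + 1), ((u + R : ℝ) : ℂ) ^ k *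
      (((k.factorial : ℝ)⁻¹ : ℝ) * iteratedDerivWithin k G (Set.Icc (-R) R) (-R)) := fun u => by
    rw [hP, taylor_within_apply]
    refine Finset.sum_congr rfl fun k _ => ?_
    rw [Complex.real_smul, sub_neg_eq_add]
    push_cast
    ring
  have hPc : Continuous P := by
    rw [show P = _ from funext hP']
    fun_prop
  have hPint : ∫ u, Ψ u * P u = 0 := by
    simp_rw [hP', Finset.mul_sum, ← mul_assoc (Ψ _)]
    rw [integral_finsetSum _ fun k _ => (hint _ (by fun_prop)).mul_const _]
    refine Finset.sum_eq_zero fun k hk => ?_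
    rw [integral_mul_const, hshift k (by have := Finset.mem_range.1 hk; omega), zero_mul]
  have hrem : ∀ u, ‖Ψ u * (G u - P u)‖ ≤ ‖Ψ u‖ * (D * (2 * R) ^ (L + 1)) := fun u => by
    by_cases hu : u ∈ Set.Icc (-R) R
    · rw [norm_mul]
      refine mul_le_mul_of_nonneg_left ?_ (norm_nonneg _)
      refine (taylor_mean_remainder_bound hab (hG.of_le (by exact_mod_cast le_top)).contDiffOn hu
        (C := D) fun y hy => ?_).trans ?_
      · rw [iteratedDerivWithin_eq_iteratedDeriv (uniqueDiffOn_Icc (by linarith))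
          (hG.of_le (by exact_mod_cast le_top)).contDiffAt hy]
        exact hD y
      · refine (div_le_self (mul_nonneg hD0 (pow_nonneg (by linarith [hu.1]) _))
          (by exact_mod_cast Nat.one_le_iff_ne_zero.2 (Nat.factorial_ne_zero L))).trans ?_
        exact mul_le_mul_of_nonneg_left
          (pow_le_pow_left₀ (by linarith [hu.1]) (by linarith [hu.2]) _) hD0
    · rw [hsupp u hu]; simp
  calc ‖∫ u, Ψ u * G u‖ = ‖∫ u, Ψ u * (G u - P u)‖ := by
        simp_rw [mul_sub]
        rw [integral_sub (hint G hG.continuous) (hint P hPc), hPint, sub_zero]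
    _ ≤ ∫ u, ‖Ψ u‖ * (D * (2 * R) ^ (L + 1)) :=
        norm_integral_le_of_norm_le
          ((hΨ.integrable_of_hasCompactSupport hc).norm.mul_const _) (.of_forall hrem)
    _ = (∫ u, ‖Ψ u‖) * (2 * R) ^ (L + 1) * D := by rw [integral_mul_const]; ring
    _ ≤ _ := mul_le_mul_of_nonneg_right (by linarith) hD0

namespace LocalMeans

variable {L : ℕ} (K : LocalMeans L)

/-- The α-th derivative of the Fourier transform at the origin is, up to a nonzero factor, the α-th
moment. -/
theorem integral_pow_mul_eq_zero {α : ℕ} (hα : α ≤ L) : ∫ u : ℝ, (u : ℂ) ^ α * K.Ψ₁ u = 0 := by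
  have hint : ∀ n : ℕ, Integrable fun x : ℝ => x ^ n • K.Ψ₁ x := fun n =>
    Continuous.integrable_of_hasCompactSupport (f := fun x : ℝ => x ^ n • K.Ψ₁ x)
      ((continuous_id.pow n).smul K.smooth₁.continuous)
      (K.compact₁.smul_left (f := fun x : ℝ => x ^ n))
  have h := congrFun (Real.iteratedDeriv_fourier (N := ⊤) (n := α) (fun n _ => hint n) le_top) 0
  rw [K.moments α hα, Real.fourier_real_eq] at h
  have h2 : ∀ v : ℝ, Real.fourierChar (-(v * 0)) •
      ((-2 * (Real.pi : ℂ) * Complex.I * v) ^ α • K.Ψ₁ v) =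
        (-2 * (Real.pi : ℂ) * Complex.I) ^ α * ((v : ℂ) ^ α * K.Ψ₁ v) := fun v => by
    rw [mul_zero, neg_zero, AddChar.map_zero_eq_one, one_smul, smul_eq_mul, mul_pow, mul_assoc]
  simp_rw [h2] at h
  rw [integral_const_mul] at h
  refine (mul_eq_zero.1 h.symm).resolve_left (pow_ne_zero _ ?_)
  simp [Real.pi_ne_zero, Complex.I_ne_zero]

theorem integral_kernel_succ_mul (j : ℕ) (B : ℝ → ℂ) (t : ℝ) :
    ∫ y, K.kernel (j + 1) (t - y) * B y = ∫ u, K.Ψ₁ u * B (t - (2 ^ j)⁻¹ * u) := by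
  have h1 : ∫ y, K.kernel (j + 1) (t - y) * B y = ∫ y, K.kernel (j + 1) y * B (t - y) := by
    rw [← integral_sub_left_eq_self (fun y => K.kernel (j + 1) y * B (t - y)) volume t]
    simp
  have h2 := Measure.integral_comp_mul_left
    (fun u => K.Ψ₁ u * B (t - (2 ^ j)⁻¹ * u)) ((2 : ℝ) ^ j)
  rw [h1]
  have h3 : ∀ y : ℝ, K.kernel (j + 1) y * B (t - y) =
      (2 : ℂ) ^ j * (K.Ψ₁ (2 ^ j * y) * B (t - (2 ^ j)⁻¹ * (2 ^ j * y))) := fun y => by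
    rw [inv_mul_cancel_left₀ (by positivity), kernel, mul_assoc]
  simp_rw [h3]
  rw [integral_const_mul, h2, abs_of_pos (by positivity), Complex.real_smul]
  push_cast
  rw [mul_inv_cancel_left₀ (pow_ne_zero _ two_ne_zero)]

/-- For k ≤ m the truncated difference is 0 and the L_1 norm of the kernel suffices. For k > m,
rescaling to level 0 contracts the derivative of B of order L + 1 by 2^(-(k-1)(L+1)), and the
moments apply. -/
theorem exists_norm_integral_kernel_mul_le (A : ℝ) : ∃ C > 0, ∀ (k m : ℕ) (B : ℝ → ℂ) (t : ℝ),
    ContDiff ℝ ∞ B → (∀ y, ‖B y‖ ≤ 1) →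
    (∀ y, ‖iteratedDeriv (L + 1) B y‖ ≤ A * (2 ^ m) ^ (L + 1)) →
      ‖∫ y, K.kernel k (t - y) * B y‖ ≤ C * ((2 ^ (k - m)) ^ (L + 1))⁻¹ := by
  obtain ⟨C, hC, h⟩ := exists_norm_integral_mul_le_of_moments K.smooth₁.continuous K.compact₁
    (fun α hα => K.integral_pow_mul_eq_zero hα)
  have hi0 : Integrable K.Ψ₀ := K.smooth₀.continuous.integrable_of_hasCompactSupport K.compact₀
  have hi1 : Integrable K.Ψ₁ := K.smooth₁.continuous.integrable_of_hasCompactSupport K.compact₁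
  have hc1 : ∀ Ψ : ℝ → ℂ, Integrable Ψ → ∀ G : ℝ → ℂ, (∀ y, ‖G y‖ ≤ 1) →
      ‖∫ u, Ψ u * G u‖ ≤ ∫ u, ‖Ψ u‖ := fun Ψ hΨ G hG =>
    norm_integral_le_of_norm_le hΨ.norm (.of_forall fun u => by
      rw [norm_mul]; exact mul_le_of_le_one_right (norm_nonneg _) (hG u))
  refine ⟨(∫ u, ‖K.Ψ₀ u‖) + (∫ u, ‖K.Ψ₁ u‖) + C * |A| * 2 ^ (L + 1) + 1, by positivity,
    fun k m B t hB hB1 hBL => ?_⟩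
  have hn0 : 0 ≤ ∫ u, ‖K.Ψ₀ u‖ := by positivity
  have hn1 : 0 ≤ ∫ u, ‖K.Ψ₁ u‖ := by positivity
  have hA : 0 ≤ C * |A| * 2 ^ (L + 1) := by positivity
  cases k with
  | zero =>
    simp only [kernel, Nat.zero_sub, pow_zero, one_pow, inv_one, mul_one]
    have := hc1 (fun y => K.Ψ₀ (t - y)) (hi0.comp_sub_left t) B hB1
    rw [integral_sub_left_eq_self (fun y => ‖K.Ψ₀ y‖) volume t] at this
    linarith
  | succ j =>
    rw [K.integral_kernel_succ_mul]
    rcases le_or_gt (j + 1) m with hj | hj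
    · rw [Nat.sub_eq_zero_of_le hj, pow_zero, one_pow, inv_one, mul_one]
      have := hc1 K.Ψ₁ hi1 (fun u => B (t - (2 ^ j)⁻¹ * u)) (fun y => hB1 _)
      linarith
    · have hBd : ContDiff ℝ ∞ fun u : ℝ => B (t - u) := hB.comp (contDiff_const.sub contDiff_id)
      refine (h (fun u => B (t - (2 ^ j)⁻¹ * u)) (((2 ^ j)⁻¹) ^ (L + 1) * (A * (2 ^ m) ^ (L + 1)))
        (hB.comp (contDiff_const.sub (contDiff_const.mul contDiff_id))) fun u => ?_).trans ?_
      · rw [iteratedDeriv_comp_const_smul (f := fun u => B (t - u))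
          (hBd.of_le (by exact_mod_cast le_top)), iteratedDeriv_comp_const_sub]
        dsimp only
        rw [norm_smul, norm_smul, norm_pow, norm_pow, norm_neg, norm_one, one_pow, one_mul,
          Real.norm_of_nonneg (by positivity)]
        exact mul_le_mul_of_nonneg_left (hBL _) (by positivity)
      · obtain ⟨r, rfl⟩ : ∃ r, j = m + r := ⟨j - m, by omega⟩
        rw [show m + r + 1 - m = r + 1 by omega]
        have h1 : C * (((2 ^ (m + r))⁻¹) ^ (L + 1) * (A * (2 ^ m) ^ (L + 1))) =
            C * A * 2 ^ (L + 1) * ((2 ^ (r + 1)) ^ (L + 1))⁻¹ := by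
          rw [pow_add (2 : ℝ) m r, pow_add (2 : ℝ) r 1, pow_one, inv_pow, mul_pow, mul_pow]
          field_simp
        rw [h1]
        refine mul_le_mul_of_nonneg_right ?_ (by positivity)
        have : C * A * 2 ^ (L + 1) ≤ C * |A| * 2 ^ (L + 1) := by
          gcongr
          exact le_abs_self A
        linarith

end LocalMeans

end Moments

end Frolov

end

noncomputable section

namespace Frolov

/-! ### Dyadic bumps -/

section Atoms

open MeasureTheory

/-- A smooth bump function on the line supported in `[0, 1/2]`. -/
def halfBump : ContDiffBump (1 / 4 : ℝ) where
  rIn := 1 / 8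
  rOut := 1 / 4
  rIn_pos := by norm_num
  rIn_lt_rOut := by norm_num

/-- The bump function in the left (`c = 0`) or right (`c = 1`) half of the unit interval. -/
def atomBase (c : Fin 2) (t : ℝ) : ℂ := (halfBump (t - (c : ℕ) / 2) : ℂ)

/-- The bump function in the left or right half of the interval `[2^(-m) j, 2^(-m) (j + 1)]`. -/
def atom (c : Fin 2) (m j : ℕ) (t : ℝ) : ℂ := atomBase c (2 ^ m * t - j)

theorem contDiff_atomBase (c : Fin 2) : ContDiff ℝ ∞ (atomBase c) :=
  Complex.ofRealCLM.contDiff.comp (halfBump.contDiff.comp (contDiff_id.sub contDiff_const))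

theorem contDiff_atom (c : Fin 2) (m j : ℕ) : ContDiff ℝ ∞ (atom c m j) :=
  (contDiff_atomBase c).comp ((contDiff_const.mul contDiff_id).sub contDiff_const)

theorem norm_atom_le_one (c : Fin 2) (m j : ℕ) (t : ℝ) : ‖atom c m j t‖ ≤ 1 := by
  rw [atom, atomBase, Complex.norm_real, Real.norm_of_nonneg halfBump.nonneg]
  exact halfBump.le_one

theorem mem_Ioo_of_atom_ne_zero {c : Fin 2} {m j : ℕ} {t : ℝ} (h : atom c m j t ≠ 0) :
    2 ^ m * t - j ∈ Set.Ioo ((c : ℕ) / 2 : ℝ) ((c : ℕ) / 2 + 1 / 2) := by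
  have h1 : 2 ^ m * t - j - ((c : ℕ) / 2 : ℝ) ∈ Function.support halfBump := fun h0 => h (by
    rw [atom, atomBase, h0, Complex.ofReal_zero])
  rw [halfBump.support_eq, Metric.mem_ball, Real.dist_eq, abs_lt] at h1
  have h2 : halfBump.rOut = 1 / 4 := rfl
  rw [h2] at h1
  constructor <;> linarith [h1.1, h1.2]

theorem fin_two_cast_le_one (c : Fin 2) : ((c : ℕ) : ℝ) ≤ 1 := by
  have := c.2
  exact_mod_cast (by omega : (c : ℕ) ≤ 1)

theorem index_eq_of_mem_Icc {c : Fin 2} {i j : ℕ} {u : ℝ}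
    (hi : u - i ∈ Set.Icc ((c : ℕ) / 2 : ℝ) ((c : ℕ) / 2 + 1 / 2))
    (hj : u - j ∈ Set.Icc ((c : ℕ) / 2 : ℝ) ((c : ℕ) / 2 + 1 / 2)) : i = j := by
  have h1 : (i : ℝ) < (j + 1 : ℕ) := by push_cast; linarith [hi.1, hj.2]
  have h2 : (j : ℝ) < (i + 1 : ℕ) := by push_cast; linarith [hj.1, hi.2]
  have h3 : i < j + 1 := by exact_mod_cast h1
  have h4 : j < i + 1 := by exact_mod_cast h2
  omega

/-- All the bumps of one level, left and right, live in disjoint open intervals. -/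
theorem bump_eq_of_atom_ne_zero {c c' : Fin 2} {m j j' : ℕ} {t : ℝ} (h : atom c m j t ≠ 0)
    (h' : atom c' m j' t ≠ 0) : c = c' ∧ j = j' := by
  have h1 := mem_Ioo_of_atom_ne_zero h
  have h2 := mem_Ioo_of_atom_ne_zero h'
  have hc := fin_two_cast_le_one c
  have hc' := fin_two_cast_le_one c'
  have hn : (0 : ℝ) ≤ (c : ℕ) := Nat.cast_nonneg _
  have hn' : (0 : ℝ) ≤ (c' : ℕ) := Nat.cast_nonneg _
  have h3 : (j : ℝ) < (j' + 1 : ℕ) := by push_cast; linarith [h1.1, h2.2]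
  have h4 : (j' : ℝ) < (j + 1 : ℕ) := by push_cast; linarith [h2.1, h1.2]
  have h5 : j < j' + 1 := by exact_mod_cast h3
  have h6 : j' < j + 1 := by exact_mod_cast h4
  have h7 : j = j' := by omega
  subst h7
  refine ⟨Fin.ext ?_, rfl⟩
  have h8 : ((c : ℕ) : ℝ) < ((c' : ℕ) + 1 : ℕ) := by push_cast; linarith [h1.1, h2.2]
  have h9 : ((c' : ℕ) : ℝ) < ((c : ℕ) + 1 : ℕ) := by push_cast; linarith [h2.1, h1.2]
  have h10 : (c : ℕ) < (c' : ℕ) + 1 := by exact_mod_cast h8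
  have h11 : (c' : ℕ) < (c : ℕ) + 1 := by exact_mod_cast h9
  omega

theorem mem_Ioo_zero_one_of_atom_ne_zero {c : Fin 2} {m j : ℕ} (hj : j < 2 ^ m) {t : ℝ}
    (h : atom c m j t ≠ 0) : t ∈ Set.Ioo (0 : ℝ) 1 := by
  have h1 := mem_Ioo_of_atom_ne_zero h
  have hc := fin_two_cast_le_one c
  have hn : (0 : ℝ) ≤ (c : ℕ) := Nat.cast_nonneg _
  have h0 : (0 : ℝ) ≤ (j : ℕ) := Nat.cast_nonneg _
  have h2 : (j : ℝ) + 1 ≤ 2 ^ m := by exact_mod_cast hj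
  have hp : (0 : ℝ) < 2 ^ m := by positivity
  constructor
  · by_contra! ht
    nlinarith [h1.1]
  · by_contra! ht
    nlinarith [h1.2]

theorem hasCompactSupport_atom (c : Fin 2) (m j : ℕ) : HasCompactSupport (atom c m j) := by
  refine HasCompactSupport.intro
    (K := Set.Icc ((2 ^ m)⁻¹ * (j : ℝ)) ((2 ^ m)⁻¹ * ((j : ℝ) + 1))) isCompact_Icc fun t ht => ?_
  by_contra h
  have h1 := mem_Ioo_of_atom_ne_zero h
  have hc := fin_two_cast_le_one c
  have hn : (0 : ℝ) ≤ (c : ℕ) := Nat.cast_nonneg _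
  refine ht ⟨?_, ?_⟩
  · rw [inv_mul_le_iff₀ (by positivity)]
    linarith [h1.1]
  · rw [le_inv_mul_iff₀ (by positivity)]
    linarith [h1.2]

/-- The integral of the bump functions at level `0`. -/
def atomMass : ℝ := ∫ t, halfBump t

theorem atomMass_pos : 0 < atomMass := halfBump.integral_pos

theorem integral_atom (c : Fin 2) (m j : ℕ) :
    ∫ t, atom c m j t = (((2 ^ m)⁻¹ * atomMass : ℝ) : ℂ) := by
  have h1 := Measure.integral_comp_mul_left
    (fun u : ℝ => (halfBump (u - (j + (c : ℕ) / 2)) : ℝ)) ((2 : ℝ) ^ m)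
  rw [integral_sub_right_eq_self (fun u : ℝ => (halfBump u : ℝ)), abs_of_pos (by positivity)] at h1
  have h2 : ∀ t, atom c m j t = ((halfBump (2 ^ m * t - (j + (c : ℕ) / 2)) : ℝ) : ℂ) := fun t => by
    rw [atom, atomBase, sub_sub]
  simp_rw [h2]
  rw [integral_complex_ofReal, h1]
  rfl

theorem exists_norm_iteratedDeriv_atom_le (N : ℕ) : ∃ A : ℝ, 0 ≤ A ∧ ∀ (c : Fin 2) (m j : ℕ) (t : ℝ),
    ‖iteratedDeriv N (atom c m j) t‖ ≤ A * (2 ^ m) ^ N ∧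
    (iteratedDeriv N (atom c m j) t ≠ 0 →
      2 ^ m * t - j ∈ Set.Icc ((c : ℕ) / 2 : ℝ) ((c : ℕ) / 2 + 1 / 2)) := by
  set g : ℝ → ℂ := fun t => (halfBump t : ℂ) with hg
  have hgd : ContDiff ℝ ∞ g := Complex.ofRealCLM.contDiff.comp halfBump.contDiff
  have hd : ∀ (c : Fin 2) (m j : ℕ) (t : ℝ), iteratedDeriv N (atom c m j) t =
      ((2 : ℝ) ^ m) ^ N • iteratedDeriv N g (2 ^ m * t - (j + (c : ℕ) / 2)) := fun c m j t => by
    have h2 : atom c m j = fun t => (fun u => g (u - (j + (c : ℕ) / 2))) (2 ^ m * t) := by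
      funext t
      rw [atom, atomBase, sub_sub]
    have h3 : ContDiff ℝ ∞ fun u => g (u - (j + (c : ℕ) / 2)) :=
      hgd.comp (contDiff_id.sub contDiff_const)
    rw [h2, iteratedDeriv_comp_const_smul (f := fun u => g (u - (j + (c : ℕ) / 2)))
      (h3.of_le (by exact_mod_cast le_top)), iteratedDeriv_comp_sub_const]
  have hsupp : ∀ u, iteratedDeriv N g u ≠ 0 → u ∈ Set.Icc (0 : ℝ) (1 / 2) := fun u hu => by
    have h1 : u ∈ tsupport g := by
      have : u ∈ Function.support (iteratedFDeriv ℝ N g) := fun h0 => hu (by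
        rw [iteratedDeriv_eq_iteratedFDeriv, h0]; rfl)
      exact support_iteratedFDeriv_subset N this
    have h2 : tsupport g ⊆ tsupport halfBump := closure_mono fun x hx h0 => hx (by
      rw [hg]; dsimp only; rw [h0, Complex.ofReal_zero])
    have h3 := h2 h1
    rw [halfBump.tsupport_eq, Metric.mem_closedBall, Real.dist_eq, abs_le] at h3
    have h4 : halfBump.rOut = 1 / 4 := rfl
    rw [h4] at h3
    constructor <;> linarith [h3.1, h3.2]
  have hcc : HasCompactSupport (iteratedDeriv N g) := by
    refine HasCompactSupport.intro (K := Set.Icc (0 : ℝ) (1 / 2)) isCompact_Icc fun u hu => ?_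
    by_contra h
    exact hu (hsupp u h)
  obtain ⟨A, hA⟩ := hcc.exists_bound_of_continuous
    (hgd.continuous_iteratedDeriv N (by exact_mod_cast le_top))
  refine ⟨A, (norm_nonneg _).trans (hA 0), fun c m j t => ⟨?_, fun h => ?_⟩⟩
  · rw [hd, norm_smul, Real.norm_of_nonneg (by positivity), mul_comm]
    exact mul_le_mul_of_nonneg_right (hA _) (by positivity)
  · rw [hd] at h
    have := hsupp _ (right_ne_zero_of_smul h)
    constructor <;> linarith [this.1, this.2]

theorem norm_sum_le_of_unique {ι E : Type*} [NormedAddCommGroup E] (s : Finset ι) (f : ι → E)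
    {b : ℝ} (hb : 0 ≤ b) (h : ∀ i, ‖f i‖ ≤ b) (hu : ∀ i j, f i ≠ 0 → f j ≠ 0 → i = j) :
    ‖∑ i ∈ s, f i‖ ≤ b := by
  by_cases hs : ∃ i ∈ s, f i ≠ 0
  · obtain ⟨i, hi, hfi⟩ := hs
    rw [Finset.sum_eq_single_of_mem i hi fun j _ hji => by
      by_contra hfj
      exact hji (hu j i hfj hfi)]
    exact h i
  · push Not at hs
    rw [Finset.sum_eq_zero hs, norm_zero]
    exact hb

/-! ### Local means of the dyadic bumps -/

namespace LocalMeans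

variable {L : ℕ} (K : LocalMeans L)

/-- The local means of the bump functions. -/
def atomMean (k : ℕ) (c : Fin 2) (m j : ℕ) (t : ℝ) : ℂ := ∫ y, K.kernel k (t - y) * atom c m j y

theorem integrable_kernel_mul_atom (k : ℕ) (c : Fin 2) (m j : ℕ) (t : ℝ) :
    Integrable fun y => K.kernel k (t - y) * atom c m j y :=
  (((K.kernel_contDiff k).continuous.comp (continuous_const.sub continuous_id)).mul
    (contDiff_atom c m j).continuous).integrable_of_hasCompactSupport
      (hasCompactSupport_atom c m j).mul_left

/-- Unimodular factors θ_j turn the sum of absolute values into the local mean of ∑ θ_j times the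
bumps. As the supports are disjoint, this sum obeys the same bounds on values and derivatives as a
single bump, so summing over positions costs nothing. -/
theorem exists_sum_norm_atomMean_le : ∃ C > 0, ∀ (k : ℕ) (c : Fin 2) (m : ℕ) (t : ℝ),
    ∑ j ∈ Finset.range (2 ^ m), ‖K.atomMean k c m j t‖ ≤ C * ((2 ^ (k - m)) ^ (L + 1))⁻¹ := by
  obtain ⟨A, hA0, hA⟩ := exists_norm_iteratedDeriv_atom_le (L + 1)
  obtain ⟨C, hC, h⟩ := K.exists_norm_integral_kernel_mul_le A
  refine ⟨C, hC, fun k c m t => ?_⟩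
  choose θ hθ hθ' using fun j => Complex.exists_norm_eq_mul_self (K.atomMean k c m j t)
  have hBd : ∀ j, ContDiff ℝ ∞ fun y => θ j * atom c m j y := fun j =>
    contDiff_const.mul (contDiff_atom c m j)
  have h1 := h k m (fun y => ∑ j ∈ Finset.range (2 ^ m), θ j * atom c m j y) t
    (ContDiff.sum fun j _ => hBd j) (fun y => ?_) (fun y => ?_)
  · refine le_trans (le_of_eq ?_) h1
    simp_rw [Finset.mul_sum]
    have h2 : ∀ j y, K.kernel k (t - y) * (θ j * atom c m j y) =
        θ j * (K.kernel k (t - y) * atom c m j y) := fun j y => by ring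
    simp_rw [h2]
    rw [integral_finsetSum _ fun j _ => (K.integrable_kernel_mul_atom k c m j t).const_mul _]
    simp_rw [integral_const_mul]
    have h3 : ∑ j ∈ Finset.range (2 ^ m), θ j * ∫ y, K.kernel k (t - y) * atom c m j y =
        ((∑ j ∈ Finset.range (2 ^ m), ‖K.atomMean k c m j t‖ : ℝ) : ℂ) := by
      rw [Complex.ofReal_sum]
      exact Finset.sum_congr rfl fun j _ => (hθ' j).symm
    rw [h3, Complex.norm_real, Real.norm_of_nonneg (Finset.sum_nonneg fun _ _ => norm_nonneg _)]
  · refine norm_sum_le_of_unique _ _ zero_le_one (fun j => ?_) fun i j hi hj => ?_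
    · rw [norm_mul, hθ, one_mul]
      exact norm_atom_le_one c m j y
    · exact (bump_eq_of_atom_ne_zero (right_ne_zero_of_mul hi) (right_ne_zero_of_mul hj)).2
  · rw [iteratedDeriv_fun_sum fun j _ => ((hBd j).of_le (by exact_mod_cast le_top)).contDiffAt]
    simp_rw [iteratedDeriv_const_mul_field]
    refine norm_sum_le_of_unique _ _ (by positivity) (fun j => ?_) fun i j hi hj => ?_
    · rw [norm_mul, hθ, one_mul]
      exact (hA c m j y).1
    · exact index_eq_of_mem_Icc ((hA c m i y).2 (right_ne_zero_of_mul hi))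
        ((hA c m j y).2 (right_ne_zero_of_mul hj))

theorem exists_atomMean_eq_zero : ∃ R > 0, ∀ (k : ℕ) (c : Fin 2) (m j : ℕ) (t : ℝ), j < 2 ^ m →
    R < |t| → K.atomMean k c m j t = 0 := by
  obtain ⟨R, hR, h⟩ := K.exists_kernel_eq_zero
  refine ⟨R + 1, by positivity, fun k c m j t hj ht => ?_⟩
  rw [atomMean, integral_eq_zero_of_ae (.of_forall fun y => ?_)]
  change _ = (0 : ℂ)
  by_cases hy : atom c m j y = 0
  · rw [hy, mul_zero]
  · have hy1 := mem_Ioo_zero_one_of_atom_ne_zero hj hy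
    rw [h, zero_mul]
    have := abs_sub_abs_le_abs_sub t y
    rw [abs_of_pos hy1.1] at this
    linarith [hy1.2]

end LocalMeans

end Atoms

end Frolov

end

noncomputable section

namespace Frolov

/-! ### Functions vanishing on the lattice -/

section Fooling

open MeasureTheory

variable {d : ℕ}

/-- The tensor product of dyadic bumps. -/
def tensorAtom (c : Fin 2) (m j : Fin d → ℕ) (x : Space d) : ℂ := ∏ i, atom c (m i) (j i) (x i)

/-- The multi-indices `m` with `|m|₁ = M`. -/
def levelSet (d M : ℕ) : Finset (Fin d → ℕ) := (levels d M).filter fun m => level m = M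

/-- The positions of the dyadic boxes of side lengths `2^(-m_i)` in the unit cube. -/
def cells (m : Fin d → ℕ) : Finset (Fin d → ℕ) := Fintype.piFinset fun i => Finset.range (2 ^ m i)

theorem level_eq_of_mem_levelSet {M : ℕ} {m : Fin d → ℕ} (h : m ∈ levelSet d M) : level m = M :=
  (Finset.mem_filter.1 h).2

theorem mem_levelSet {M : ℕ} {m : Fin d → ℕ} : m ∈ levelSet d M ↔ level m = M := by
  refine ⟨level_eq_of_mem_levelSet, fun h => Finset.mem_filter.2 ⟨?_, h⟩⟩
  refine Fintype.mem_piFinset.2 fun i => Finset.mem_range.2 (Nat.lt_succ_of_le ?_)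
  rw [← h, level]
  exact Finset.single_le_sum (f := m) (fun _ _ => Nat.zero_le _) (Finset.mem_univ i)

theorem contDiff_tensorAtom (c : Fin 2) (m j : Fin d → ℕ) : ContDiff ℝ ∞ (tensorAtom c m j) := by
  unfold tensorAtom
  refine contDiff_prod fun i _ => (contDiff_atom c (m i) (j i)).comp ?_
  fun_prop

theorem atom_ne_zero_of_tensorAtom_ne_zero {c : Fin 2} {m j : Fin d → ℕ} {x : Space d}
    (h : tensorAtom c m j x ≠ 0) (i : Fin d) : atom c (m i) (j i) (x i) ≠ 0 :=
  Finset.prod_ne_zero_iff.1 h i (Finset.mem_univ i)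

theorem integral_tensorAtom (c : Fin 2) (m j : Fin d → ℕ) :
    ∫ x, tensorAtom c m j x = (((2 ^ level m)⁻¹ * atomMass ^ d : ℝ) : ℂ) := by
  unfold tensorAtom
  rw [integral_space_prod fun i t => atom c (m i) (j i) t]
  simp_rw [integral_atom]
  rw [← Complex.ofReal_prod, Finset.prod_mul_distrib, Finset.prod_inv_distrib,
    Finset.prod_pow_eq_pow_sum, level]
  simp

theorem card_cells (m : Fin d → ℕ) : (cells m).card = 2 ^ level m := by
  simp [cells, level, Finset.prod_pow_eq_pow_sum]

/-- If both corners were hit, then either one lattice point would lie in two disjoint supports, or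
two distinct points would lie in a box of volume 2^(-M), so their coordinate differences would have
product at most 2^(-M) < c₀/n, against admissibility. -/
theorem exists_forall_tensorAtom_latticePoint_eq_zero (hd : 1 ≤ d) : ∃ c₀ : ℝ, 0 < c₀ ∧
    ∀ n M : ℕ, 1 ≤ n → n < c₀ * 2 ^ M → ∀ m j : Fin d → ℕ, level m = M →
      ∃ c : Fin 2, ∀ k, tensorAtom c m j (latticePoint d n k) = 0 := by
  obtain ⟨c₀, hc₀, -, h⟩ := exists_div_le_prod_abs_latticePoint_sub hd
  refine ⟨c₀, hc₀, fun n M hn hM m j hm => ?_⟩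
  by_contra! hne
  obtain ⟨k, hk⟩ := hne 0
  obtain ⟨l, hl⟩ := hne 1
  have hn0 : (0 : ℝ) < n := by exact_mod_cast hn
  by_cases hkl : k = l
  · subst hkl
    have := (bump_eq_of_atom_ne_zero (atom_ne_zero_of_tensorAtom_ne_zero hk ⟨0, hd⟩)
      (atom_ne_zero_of_tensorAtom_ne_zero hl ⟨0, hd⟩)).1
    exact absurd this (by decide)
  · have h1 := h n hn k l hkl
    have h2 : ∏ i, |latticePoint d n k i - latticePoint d n l i| ≤ ∏ i, ((2 : ℝ) ^ m i)⁻¹ := by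
      refine Finset.prod_le_prod (fun _ _ => abs_nonneg _) fun i _ => ?_
      have h3 := mem_Ioo_of_atom_ne_zero (atom_ne_zero_of_tensorAtom_ne_zero hk i)
      have h4 := mem_Ioo_of_atom_ne_zero (atom_ne_zero_of_tensorAtom_ne_zero hl i)
      have hp : (0 : ℝ) < 2 ^ m i := by positivity
      rw [← one_div, le_div_iff₀ hp, ← abs_of_pos hp, ← abs_mul, abs_le]
      simp only [Fin.val_zero, Fin.val_one, Nat.cast_zero, Nat.cast_one] at *
      constructor <;> nlinarith [h3.1, h3.2, h4.1, h4.2]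
    rw [Finset.prod_inv_distrib, Finset.prod_pow_eq_pow_sum, ← level, hm] at h2
    have h5 := h1.trans h2
    rw [div_le_iff₀ hn0, inv_mul_eq_div, le_div_iff₀ (by positivity)] at h5
    linarith

/-- The sum over all dyadic boxes of volume `2^(-M)` in the unit cube of bumps in one of the corners
of the box. -/
def fooling (σ : (Fin d → ℕ) → (Fin d → ℕ) → Fin 2) (M : ℕ) (x : Space d) : ℂ :=
  ∑ m ∈ levelSet d M, ∑ j ∈ cells m, tensorAtom (σ m j) m j x

variable (σ : (Fin d → ℕ) → (Fin d → ℕ) → Fin 2) (M : ℕ)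

theorem contDiff_fooling : ContDiff ℝ ∞ (fooling σ M) :=
  ContDiff.sum fun m _ => ContDiff.sum fun j _ => contDiff_tensorAtom (σ m j) m j

theorem mem_Ioo_of_fooling_ne_zero {x : Space d} (h : fooling σ M x ≠ 0) (i : Fin d) :
    x i ∈ Set.Ioo (0 : ℝ) 1 := by
  obtain ⟨m, -, h1⟩ := Finset.exists_ne_zero_of_sum_ne_zero h
  obtain ⟨j, hj, h2⟩ := Finset.exists_ne_zero_of_sum_ne_zero h1
  exact mem_Ioo_zero_one_of_atom_ne_zero (Finset.mem_range.1 (Fintype.mem_piFinset.1 hj i))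
    (atom_ne_zero_of_tensorAtom_ne_zero h2 i)

theorem hasCompactSupport_fooling : HasCompactSupport (fooling σ M) := by
  refine HasCompactSupport.intro (isCompact_box d 1) fun x hx => ?_
  by_contra h
  refine hx fun i => ?_
  have := mem_Ioo_of_fooling_ne_zero σ M h i
  rw [abs_of_pos this.1]
  exact this.2.le

theorem hasCompactSupport_tensorAtom (c : Fin 2) (m j : Fin d → ℕ) :
    HasCompactSupport (tensorAtom c m j : Space d → ℂ) := by
  have hc : IsCompact (Set.univ.pi fun i : Fin d => tsupport (atom c (m i) (j i))) :=
    isCompact_univ_pi fun i => hasCompactSupport_atom c (m i) (j i)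
  refine HasCompactSupport.intro
    (hc.image (PiLp.continuous_toLp 2 fun _ : Fin d => ℝ)) fun x hx => ?_
  by_contra h
  exact hx ⟨x.ofLp, fun i _ => subset_tsupport _ (atom_ne_zero_of_tensorAtom_ne_zero h i), rfl⟩

/-- Each shape m has 2^M boxes, each carrying mass 2^(-M) `atomMass`^d, so all shapes contribute
equally. -/
theorem integral_fooling :
    ∫ x, fooling σ M x = ((atomMass ^ d * (levelSet d M).card : ℝ) : ℂ) := by
  have hint : ∀ (c : Fin 2) (m j : Fin d → ℕ), Integrable (tensorAtom c m j : Space d → ℂ) :=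
    fun c m j => (contDiff_tensorAtom c m j).continuous.integrable_of_hasCompactSupport
      (hasCompactSupport_tensorAtom c m j)
  unfold fooling
  rw [integral_finsetSum _ fun m _ => integrable_finsetSum _ fun j _ => hint _ m j]
  have h : ∀ m ∈ levelSet d M, ∫ x : Space d, ∑ j ∈ cells m, tensorAtom (σ m j) m j x =
      ((atomMass ^ d : ℝ) : ℂ) := fun m hm => by
    rw [integral_finsetSum _ fun j _ => hint _ m j]
    simp_rw [integral_tensorAtom]
    rw [Finset.sum_const, card_cells, nsmul_eq_mul]
    push_cast
    rw [mul_inv_cancel_left₀ (pow_ne_zero _ two_ne_zero)]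
  rw [Finset.sum_congr rfl h, Finset.sum_const, nsmul_eq_mul]
  push_cast
  ring

/-- The fooling function as a Schwartz function. -/
def foolingSchwartz : 𝓢(Space d, ℂ) :=
  (hasCompactSupport_fooling σ M).toSchwartzMap (contDiff_fooling σ M)

/-- The fooling function as a tempered distribution. -/
def foolingDistribution : 𝓢'(Space d, ℂ) :=
  SchwartzMap.toTemperedDistributionCLM (Space d) ℂ volume (foolingSchwartz σ M)

theorem foolingDistribution_apply (φ : 𝓢(Space d, ℂ)) :
    foolingDistribution σ M φ = ∫ x, φ x * fooling σ M x :=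
  SchwartzMap.toTemperedDistributionCLM_apply_apply volume _ φ

theorem isRepresentedBy_foolingDistribution :
    IsRepresentedBy (foolingDistribution σ M) (foolingSchwartz σ M).toBoundedContinuousFunction :=
  foolingDistribution_apply σ M

theorem dsupport_foolingDistribution_subset :
    Distribution.dsupport (foolingDistribution σ M) ⊆ closedCube d := by
  intro x hx
  by_contra hxc
  refine (Distribution.notMem_dsupport_iff x).2
    ⟨(closedCube d)ᶜ, fun φ hφ => ?_, isClosed_closedCube.isOpen_compl, hxc⟩ hx
  rw [foolingDistribution_apply]
  refine integral_eq_zero_of_ae (.of_forall fun y => ?_)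
  change φ y * fooling σ M y = 0
  by_cases hy : fooling σ M y = 0
  · rw [hy, mul_zero]
  · by_cases hφy : φ y = 0
    · rw [hφy, zero_mul]
    · refine absurd (fun i => ?_) (hφ (subset_tsupport _ hφy))
      exact Set.Ioo_subset_Icc_self (mem_Ioo_of_fooling_ne_zero σ M hy i)

theorem cubature_fooling (hd : 1 ≤ d) {n : ℕ} (hn : 1 ≤ n)
    (h : ∀ m j, level m = M → ∀ k, tensorAtom (σ m j) m j (latticePoint d n k) = 0) :
    cubature d n (fooling σ M) = 0 := by
  rw [cubature_eq_tsum hd hn fun x hx i =>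
    Set.Ioo_subset_Ico_self (mem_Ioo_of_fooling_ne_zero σ M hx i)]
  have h0 : ∀ k, fooling σ M (latticePoint d n k) = 0 := fun k =>
    Finset.sum_eq_zero fun m hm => Finset.sum_eq_zero fun j _ =>
      h m j (level_eq_of_mem_levelSet hm) k
  simp [h0]

theorem setIntegral_fooling :
    ∫ x in closedCube d, fooling σ M x = ((atomMass ^ d * (levelSet d M).card : ℝ) : ℂ) := by
  rw [setIntegral_closedCube_eq_integral fun x hx i =>
    Set.Ioo_subset_Ico_self (mem_Ioo_of_fooling_ne_zero σ M hx i), integral_fooling]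

/-! ### Local means of the functions vanishing on the lattice -/

namespace LocalMeans

variable {L : ℕ} (K : LocalMeans L)

theorem conv_foolingDistribution (k : Fin d → ℕ) (x : Space d) :
    K.conv k (foolingDistribution σ M) x = ∑ m ∈ levelSet d M, ∑ j ∈ cells m,
      ∏ i, K.atomMean (k i) (σ m j) (m i) (j i) (x i) := by
  have hint : ∀ (c : Fin 2) (m j : Fin d → ℕ),
      Integrable fun y : Space d => K.tensorKernel k (x - y) * tensorAtom c m j y := fun c m j =>
    (((K.tensorKernel_contDiff k).continuous.comp (continuous_const.sub continuous_id)).mul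
      (contDiff_tensorAtom c m j).continuous).integrable_of_hasCompactSupport
        (hasCompactSupport_tensorAtom c m j).mul_left
  have h : K.conv k (foolingDistribution σ M) x =
      ∫ y, K.tensorKernel k (x - y) * fooling σ M y := foolingDistribution_apply σ M _
  rw [h]
  unfold fooling
  simp_rw [Finset.mul_sum]
  rw [integral_finsetSum _ fun m _ => integrable_finsetSum _ fun j _ => hint _ m j]
  refine Finset.sum_congr rfl fun m _ => ?_
  rw [integral_finsetSum _ fun j _ => hint _ m j]
  refine Finset.sum_congr rfl fun j _ => ?_
  refine Eq.trans ?_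
    (integral_space_prod fun i t => K.kernel (k i) (x i - t) * atom (σ m j) (m i) (j i) t)
  refine integral_congr_ae (.of_forall fun y => ?_)
  dsimp only
  rw [Finset.prod_mul_distrib]
  rfl

theorem exists_norm_conv_foolingDistribution_le (d : ℕ) : ∃ R > 0, ∃ C > 0,
    ∀ (σ : (Fin d → ℕ) → (Fin d → ℕ) → Fin 2) (M : ℕ) (k : Fin d → ℕ) (x : Space d),
      ‖K.conv k (foolingDistribution σ M) x‖ ≤
        C * ∑ m ∈ levelSet d M, ∏ i, ((2 ^ (k i - m i)) ^ (L + 1) : ℝ)⁻¹ ∧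
      (x ∉ box d R → K.conv k (foolingDistribution σ M) x = 0) := by
  obtain ⟨R, hR, hR0⟩ := K.exists_atomMean_eq_zero
  obtain ⟨C, hC, h⟩ := K.exists_sum_norm_atomMean_le
  refine ⟨R, hR, 2 * C ^ d, by positivity, fun σ M k x => ⟨?_, fun hx => ?_⟩⟩
  · rw [K.conv_foolingDistribution, Finset.mul_sum]
    refine norm_sum_le_of_le _ fun m _ => ?_
    have h1 : ∀ c : Fin 2, ∑ j ∈ cells m, ∏ i, ‖K.atomMean (k i) c (m i) (j i) (x i)‖ ≤
        C ^ d * ∏ i, ((2 ^ (k i - m i)) ^ (L + 1) : ℝ)⁻¹ := fun c => by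
      rw [cells, ← Finset.prod_univ_sum (fun i => Finset.range (2 ^ m i))
        fun i j => ‖K.atomMean (k i) c (m i) j (x i)‖]
      refine (Finset.prod_le_prod (fun i _ => Finset.sum_nonneg fun _ _ => norm_nonneg _)
        fun i _ => h (k i) c (m i) (x i)).trans (le_of_eq ?_)
      rw [Finset.prod_mul_distrib, Finset.prod_const, Finset.card_univ, Fintype.card_fin]
    -- The choice of corner depends on all coordinates of j and would obstruct factorization.
    -- Summing over both corners removes it, at the price of a factor 2.
    calc ‖∑ j ∈ cells m, ∏ i, K.atomMean (k i) (σ m j) (m i) (j i) (x i)‖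
        ≤ ∑ j ∈ cells m, ∑ c, ∏ i, ‖K.atomMean (k i) c (m i) (j i) (x i)‖ := by
          refine norm_sum_le_of_le _ fun j _ => ?_
          rw [norm_prod]
          exact Finset.single_le_sum
            (f := fun c => ∏ i, ‖K.atomMean (k i) c (m i) (j i) (x i)‖)
            (fun c _ => Finset.prod_nonneg fun _ _ => norm_nonneg _) (Finset.mem_univ (σ m j))
      _ = ∑ c, ∑ j ∈ cells m, ∏ i, ‖K.atomMean (k i) c (m i) (j i) (x i)‖ := Finset.sum_comm
      _ ≤ ∑ _c : Fin 2, C ^ d * ∏ i, ((2 ^ (k i - m i)) ^ (L + 1) : ℝ)⁻¹ :=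
          Finset.sum_le_sum fun c _ => h1 c
      _ = _ := by
          rw [Finset.sum_const, Finset.card_univ, Fintype.card_fin, nsmul_eq_mul]
          push_cast
          ring
  · have hx' : ∃ i, R < |x i| := by
      by_contra! hall
      exact hx hall
    obtain ⟨i, hi⟩ := hx'
    rw [K.conv_foolingDistribution]
    exact Finset.sum_eq_zero fun m _ => Finset.sum_eq_zero fun j hj =>
      Finset.prod_eq_zero (Finset.mem_univ i)
        (hR0 _ _ _ _ _ (Finset.mem_range.1 (Fintype.mem_piFinset.1 hj i)) hi)

end LocalMeans

end Fooling

end Frolov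

end

noncomputable section

namespace Frolov

open MeasureTheory

variable {d : ℕ}

/-! ### The norm of the functions vanishing on the lattice -/

section Decay

/-- The decay `2^(-δ|k - m|)` off the diagonal. -/
def offDiagonal (δ : ℝ) (k m : ℕ) : ℝ≥0∞ := 2 ^ (-δ * ((k : ℤ) - m).natAbs)

/-- The sum of `2^(-δ|z|)` over the integers. -/
def offDiagonalSum (δ : ℝ) : ℝ≥0∞ := ∑' z : ℤ, 2 ^ (-δ * z.natAbs)

theorem offDiagonalSum_ne_top {δ : ℝ} (hδ : 0 < δ) : offDiagonalSum δ ≠ ⊤ := by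
  have h0 : Summable fun n : ℕ => (2 : ℝ) ^ (-δ * n) := by
    have h1 : ∀ n : ℕ, (2 : ℝ) ^ (-δ * n) = ((2 : ℝ) ^ (-δ)) ^ n := fun n => by
      rw [Real.rpow_mul (by norm_num), Real.rpow_natCast]
    simp only [h1]
    exact summable_geometric_of_lt_one (by positivity)
      (Real.rpow_lt_one_of_one_lt_of_neg (by norm_num) (by linarith))
  have h2 : Summable fun z : ℤ => (2 : ℝ) ^ (-δ * z.natAbs) :=
    Summable.of_nat_of_neg (by simpa using h0) (by simpa using h0)
  have h3 : offDiagonalSum δ = ∑' z : ℤ, ENNReal.ofReal ((2 : ℝ) ^ (-δ * z.natAbs)) :=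
    tsum_congr fun z => by rw [← ENNReal.ofReal_rpow_of_pos two_pos, ENNReal.ofReal_ofNat]
  rw [h3]
  exact h2.tsum_ofReal_ne_top

theorem tsum_offDiagonal_le (δ : ℝ) (m : ℕ) : ∑' k, offDiagonal δ k m ≤ offDiagonalSum δ :=
  ENNReal.tsum_comp_le_tsum_of_injective (f := fun k : ℕ => (k : ℤ) - m)
    (fun a b h => by simpa using h) fun z : ℤ => (2 : ℝ≥0∞) ^ (-δ * z.natAbs)

theorem offDiagonal_comm (δ : ℝ) (k m : ℕ) : offDiagonal δ k m = offDiagonal δ m k := by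
  rw [offDiagonal, offDiagonal, ← Int.natAbs_neg, neg_sub]

theorem tsum_prod_offDiagonal_le (δ : ℝ) (m : Fin d → ℕ) :
    ∑' k : Fin d → ℕ, ∏ i, offDiagonal δ (k i) (m i) ≤ offDiagonalSum δ ^ d := by
  rw [tsum_fin_prod_eq_prod_tsum fun i k => offDiagonal δ k (m i)]
  refine (Finset.prod_le_prod' fun i _ => tsum_offDiagonal_le δ (m i)).trans (le_of_eq ?_)
  rw [Finset.prod_const, Finset.card_univ, Fintype.card_fin]

/-- A Schur test: row and column sums of the matrix are both at most `offDiagonalSum δ`^d. One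
factor of the square is bounded by a row sum, the other is summed over columns, so the result grows
like the cardinality of S and not like its square. -/
theorem tsum_sum_prod_offDiagonal_sq_le (δ : ℝ) (S : Finset (Fin d → ℕ)) :
    ∑' k : Fin d → ℕ, (∑ m ∈ S, ∏ i, offDiagonal δ (k i) (m i)) ^ (2 : ℝ) ≤
      (offDiagonalSum δ ^ d) ^ (2 : ℝ) * S.card := by
  have h1 : ∀ k : Fin d → ℕ, ∑ m ∈ S, ∏ i, offDiagonal δ (k i) (m i) ≤ offDiagonalSum δ ^ d :=
    fun k => by
      refine (ENNReal.sum_le_tsum S).trans ?_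
      simp_rw [offDiagonal_comm δ (k _)]
      exact tsum_prod_offDiagonal_le δ k
  calc ∑' k : Fin d → ℕ, (∑ m ∈ S, ∏ i, offDiagonal δ (k i) (m i)) ^ (2 : ℝ)
      ≤ ∑' k : Fin d → ℕ, offDiagonalSum δ ^ d * ∑ m ∈ S, ∏ i, offDiagonal δ (k i) (m i) :=
        ENNReal.tsum_le_tsum fun k => by
          rw [ENNReal.rpow_two, sq]
          exact mul_le_mul' (h1 k) le_rfl
    _ = offDiagonalSum δ ^ d * ∑ m ∈ S, ∑' k : Fin d → ℕ, ∏ i, offDiagonal δ (k i) (m i) := by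
        rw [ENNReal.tsum_mul_left, Summable.tsum_finsetSum fun _ _ => ENNReal.summable]
    _ ≤ offDiagonalSum δ ^ d * ∑ _m ∈ S, offDiagonalSum δ ^ d :=
        mul_le_mul' le_rfl (Finset.sum_le_sum fun m _ => tsum_prod_offDiagonal_le δ m)
    _ = _ := by
        rw [Finset.sum_const, nsmul_eq_mul, ENNReal.rpow_two]
        ring

/-- For k ≤ m the weight itself decays, at rate s; for k ≥ m the moments win over the weight, at
rate L + 1 - s. -/
theorem two_rpow_mul_decay_le {s δ : ℝ} {L : ℕ} (hδs : δ ≤ s) (hδL : δ ≤ L + 1 - s) (k m : ℕ) :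
    (2 : ℝ≥0∞) ^ (s * k) * ENNReal.ofReal ((2 ^ (k - m)) ^ (L + 1) : ℝ)⁻¹ ≤
      2 ^ (s * m) * offDiagonal δ k m := by
  have h1 : ((2 ^ (k - m)) ^ (L + 1) : ℝ)⁻¹ = 2 ^ (-(((k - m : ℕ) : ℝ) * (L + 1))) := by
    rw [Real.rpow_neg (by norm_num), Real.rpow_mul (by norm_num), Real.rpow_natCast]
    norm_cast
  rw [h1, ← ENNReal.ofReal_rpow_of_pos two_pos, ENNReal.ofReal_ofNat, offDiagonal,
    ← ENNReal.rpow_add _ _ (by norm_num) (by norm_num),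
    ← ENNReal.rpow_add _ _ (by norm_num) (by norm_num)]
  refine ENNReal.rpow_le_rpow_of_exponent_le (by norm_num) ?_
  rcases le_total k m with h | h
  · obtain ⟨r, rfl⟩ := Nat.exists_eq_add_of_le h
    have h2 : ((k : ℤ) - (k + r : ℕ)).natAbs = r := by omega
    rw [h2, Nat.sub_eq_zero_of_le h]
    push_cast
    nlinarith [mul_le_mul_of_nonneg_right hδs (Nat.cast_nonneg (α := ℝ) r)]
  · obtain ⟨r, rfl⟩ := Nat.exists_eq_add_of_le h
    have h2 : (((m + r : ℕ) : ℤ) - m).natAbs = r := by omega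
    rw [h2, Nat.add_sub_cancel_left]
    push_cast
    nlinarith [mul_le_mul_of_nonneg_right hδL (Nat.cast_nonneg (α := ℝ) r)]

theorem two_rpow_level_mul_decay_le {s δ : ℝ} {L : ℕ} (hδs : δ ≤ s) (hδL : δ ≤ L + 1 - s)
    (k m : Fin d → ℕ) :
    (2 : ℝ≥0∞) ^ (s * level k) * ENNReal.ofReal (∏ i, ((2 ^ (k i - m i)) ^ (L + 1) : ℝ)⁻¹) ≤
      2 ^ (s * level m) * ∏ i, offDiagonal δ (k i) (m i) := by
  have h : ∀ m : Fin d → ℕ, (2 : ℝ≥0∞) ^ (s * level m) = ∏ i, (2 : ℝ≥0∞) ^ (s * m i) := fun m => by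
    simp only [ENNReal.rpow_mul, ENNReal.rpow_natCast]
    rw [Finset.prod_pow_eq_pow_sum, level]
  rw [h, h, ENNReal.ofReal_prod_of_nonneg fun i _ => by positivity, ← Finset.prod_mul_distrib,
    ← Finset.prod_mul_distrib]
  exact Finset.prod_le_prod' fun i _ => two_rpow_mul_decay_le hδs hδL (k i) (m i)

end Decay

section Count

/-- The last d - 1 entries may be chosen freely up to M/d; the first then brings the level to M. -/
theorem pow_le_card_levelSet (hd : 1 ≤ d) (M : ℕ) :
    (M / d + 1) ^ (d - 1) ≤ (levelSet d M).card := by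
  obtain ⟨e, rfl⟩ : ∃ e, d = e + 1 := ⟨d - 1, by omega⟩
  have h : (Fintype.piFinset fun _ : Fin e => Finset.range (M / (e + 1) + 1)).card ≤
      (levelSet (e + 1) M).card := by
    refine Finset.card_le_card_of_injOn
      (fun a => (Fin.cons (M - ∑ i, a i) a : Fin (e + 1) → ℕ)) (fun a ha => ?_) fun a _ b _ hab => ?_
    · refine mem_levelSet.2 ?_
      have h1 : ∑ i, a i ≤ ∑ _i : Fin e, M / (e + 1) := Finset.sum_le_sum fun i _ =>
        Nat.le_of_lt_succ (Finset.mem_range.1 (Fintype.mem_piFinset.1 ha i))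
      rw [Finset.sum_const, Finset.card_univ, Fintype.card_fin, smul_eq_mul] at h1
      have h2 : (e + 1) * (M / (e + 1)) ≤ M := Nat.mul_div_le M (e + 1)
      have h3 : ∑ i, a i ≤ M := by nlinarith
      rw [level, Fin.sum_univ_succ]
      simp only [Fin.cons_zero, Fin.cons_succ]
      omega
    · exact (Fin.cons_inj.1 hab).2
  simpa using h

end Count

/-! ### The lower bound for the worst-case error -/

namespace LocalMeans

variable {L : ℕ} (K : LocalMeans L)

/-- The off-diagonal decay and the Schur test bound the square function pointwise, and it vanishes
off a fixed box. The shapes thus add up in the ℓ_2 sense, whence the square root of their number. -/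
theorem exists_sobolevNorm_foolingDistribution_le (d : ℕ) {s p : ℝ} (hp : 0 < p) (hs : 0 < s)
    (hL : s < L + 1) : ∃ C : ℝ, 0 < C ∧ ∀ (σ : (Fin d → ℕ) → (Fin d → ℕ) → Fin 2) (M : ℕ),
      K.sobolevNorm s p (foolingDistribution σ M) ≤
        ENNReal.ofReal (C * (2 ^ (s * M) * Real.sqrt (levelSet d M).card)) := by
  obtain ⟨R, hR, C, hC, h⟩ := K.exists_norm_conv_foolingDistribution_le d
  obtain ⟨δ, hδ, hδs, hδL⟩ : ∃ δ : ℝ, 0 < δ ∧ δ ≤ s ∧ δ ≤ L + 1 - s :=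
    ⟨min s (L + 1 - s), lt_min hs (by linarith), min_le_left _ _, min_le_right _ _⟩
  set G := offDiagonalSum δ ^ d with hG
  have hGt : G ≠ ⊤ := ENNReal.pow_ne_top (offDiagonalSum_ne_top hδ)
  have hconv : ∀ (σ : (Fin d → ℕ) → (Fin d → ℕ) → Fin 2) (M : ℕ) (k : Fin d → ℕ) (x : Space d),
      (2 : ℝ≥0∞) ^ (s * level k) * ‖K.conv k (foolingDistribution σ M) x‖ₑ ≤
        ENNReal.ofReal C * 2 ^ (s * M) *
          ∑ m ∈ levelSet d M, ∏ i, offDiagonal δ (k i) (m i) := fun σ M k x => by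
    have h1 : ‖K.conv k (foolingDistribution σ M) x‖ₑ ≤ ENNReal.ofReal C *
        ∑ m ∈ levelSet d M, ENNReal.ofReal (∏ i, ((2 ^ (k i - m i)) ^ (L + 1) : ℝ)⁻¹) := by
      rw [← ofReal_norm, ← ENNReal.ofReal_sum_of_nonneg fun m _ => by positivity,
        ← ENNReal.ofReal_mul hC.le]
      exact ENNReal.ofReal_le_ofReal (h σ M k x).1
    refine (mul_le_mul' le_rfl h1).trans ?_
    rw [mul_left_comm, mul_assoc]
    refine mul_le_mul' (le_refl (ENNReal.ofReal C)) ?_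
    rw [Finset.mul_sum, Finset.mul_sum]
    refine Finset.sum_le_sum fun m hm => ?_
    refine (two_rpow_level_mul_decay_le hδs hδL k m).trans (le_of_eq ?_)
    rw [level_eq_of_mem_levelSet hm]
  have hroot : ∀ a g c : ℝ≥0∞, (a ^ (2 : ℝ) * (g ^ (2 : ℝ) * c)) ^ (1 / (2 : ℝ)) =
      a * (g * c ^ (1 / (2 : ℝ))) := fun a g c => by
    rw [ENNReal.mul_rpow_of_nonneg _ _ (by norm_num), ENNReal.mul_rpow_of_nonneg _ _ (by norm_num),
      ← ENNReal.rpow_mul, ← ENNReal.rpow_mul, mul_one_div_cancel two_ne_zero, ENNReal.rpow_one,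
      ENNReal.rpow_one]
  have hsq : ∀ (σ : (Fin d → ℕ) → (Fin d → ℕ) → Fin 2) (M : ℕ) (x : Space d),
      K.square s (foolingDistribution σ M) x ≤ (box d R).indicator (fun _ =>
        ENNReal.ofReal C * 2 ^ (s * M) * (G * ((levelSet d M).card : ℝ≥0∞) ^ (1 / (2 : ℝ)))) x :=
      fun σ M x => by
    by_cases hx : x ∈ box d R
    · rw [Set.indicator_of_mem hx, square]
      calc (∑' k : Fin d → ℕ, ((2 : ℝ≥0∞) ^ (s * level k) *
            ‖K.conv k (foolingDistribution σ M) x‖ₑ) ^ (2 : ℝ)) ^ (1 / (2 : ℝ))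
          ≤ ((ENNReal.ofReal C * 2 ^ (s * M)) ^ (2 : ℝ) *
              (G ^ (2 : ℝ) * (levelSet d M).card)) ^ (1 / (2 : ℝ)) := by
            refine ENNReal.rpow_le_rpow ?_ (by norm_num)
            refine (ENNReal.tsum_le_tsum fun k =>
              ENNReal.rpow_le_rpow (hconv σ M k x) (by norm_num)).trans ?_
            simp_rw [ENNReal.mul_rpow_of_nonneg _ _ (zero_le_two (α := ℝ))]
            rw [ENNReal.tsum_mul_left]
            exact mul_le_mul' le_rfl (tsum_sum_prod_offDiagonal_sq_le δ _)
        _ = _ := hroot _ _ _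
    · rw [Set.indicator_of_notMem hx, square]
      simp [(h σ M _ x).2 hx]
  have hV : volume (box d R) ≠ ⊤ := (isCompact_box d R).measure_lt_top.ne
  set V := volume (box d R) ^ (1 / p) with hVdef
  have hVt : V ≠ ⊤ := ENNReal.rpow_ne_top_of_nonneg (by positivity) hV
  refine ⟨C * G.toReal * V.toReal + 1, by positivity, fun σ M => ?_⟩
  rw [sobolevNorm_eq]
  set A := ENNReal.ofReal C * 2 ^ (s * M) *
    (G * ((levelSet d M).card : ℝ≥0∞) ^ (1 / (2 : ℝ))) with hA
  calc (∫⁻ z, K.square s (foolingDistribution σ M) z ^ p) ^ (1 / p)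
      ≤ (∫⁻ z, (box d R).indicator (fun _ => A ^ p) z) ^ (1 / p) := by
        refine ENNReal.rpow_le_rpow (lintegral_mono fun z => ?_) (by positivity)
        refine (ENNReal.rpow_le_rpow (hsq σ M z) hp.le).trans (le_of_eq ?_)
        by_cases hz : z ∈ box d R
        · rw [Set.indicator_of_mem hz, Set.indicator_of_mem hz]
        · rw [Set.indicator_of_notMem hz, Set.indicator_of_notMem hz, ENNReal.zero_rpow_of_pos hp]
    _ = A * V := by
        rw [lintegral_indicator_const (isCompact_box d R).measurableSet,
          ENNReal.mul_rpow_of_nonneg _ _ (by positivity), ← ENNReal.rpow_mul,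
          mul_one_div_cancel hp.ne', ENNReal.rpow_one]
    _ = ENNReal.ofReal (C * G.toReal * V.toReal * (2 ^ (s * M) *
          Real.sqrt (levelSet d M).card)) := by
        rw [ENNReal.ofReal_mul (by positivity), ENNReal.ofReal_mul (by positivity),
          ENNReal.ofReal_mul (by positivity), ENNReal.ofReal_mul (by positivity),
          ENNReal.ofReal_toReal hGt, ENNReal.ofReal_toReal hVt, hA, Real.sqrt_eq_rpow,
          ← ENNReal.ofReal_rpow_of_pos two_pos, ENNReal.ofReal_ofNat,
          ← ENNReal.ofReal_rpow_of_nonneg (Nat.cast_nonneg _) (by norm_num),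
          ENNReal.ofReal_natCast]
        ring
    _ ≤ _ := ENNReal.ofReal_le_ofReal (mul_le_mul_of_nonneg_right (by linarith) (by positivity))

/-- Homogeneity: T/A lies in the unit ball, and both the norm and the error functional scale
accordingly. -/
theorem enorm_le_mul_worstCaseError {s p A : ℝ} (hp : 0 < p) {T : 𝓢'(Space d, ℂ)}
    (hT : T ∈ K.sobolevCube d s p) {f : Space d →ᵇ ℂ} (hf : IsRepresentedBy T f) (hA : 0 < A)
    (hN : K.sobolevNorm s p T ≤ ENNReal.ofReal A) (n : ℕ) :
    ‖(∫ x in closedCube d, f x) - cubature d n f‖ₑ ≤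
      ENNReal.ofReal A * worstCaseError n (K.sobolevCube d s p) (K.sobolevNorm s p) := by
  set a : ℂ := ((A⁻¹ : ℝ) : ℂ) with ha
  have hae : ‖a‖ₑ = (ENNReal.ofReal A)⁻¹ := by
    rw [← ofReal_norm, ha, Complex.norm_real, Real.norm_of_nonneg (by positivity),
      ENNReal.ofReal_inv_of_pos hA]
  have hA0 : ENNReal.ofReal A ≠ 0 := by simpa using hA
  have hsq : ∀ x, K.square s (a • T) x = ‖a‖ₑ * K.square s T x := fun x => by
    have h1 : ∀ m, K.conv m (a • T) x = a * K.conv m T x := fun m => rfl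
    simp_rw [square, h1, enorm_mul, mul_left_comm _ ‖a‖ₑ,
      ENNReal.mul_rpow_of_nonneg ‖a‖ₑ _ (zero_le_two (α := ℝ))]
    rw [ENNReal.tsum_mul_left, ENNReal.mul_rpow_of_nonneg _ _ (by norm_num), ← ENNReal.rpow_mul]
    norm_num
  have hnorm : K.sobolevNorm s p (a • T) = ‖a‖ₑ * K.sobolevNorm s p T := by
    simp_rw [sobolevNorm_eq, hsq, ENNReal.mul_rpow_of_nonneg _ _ hp.le]
    rw [lintegral_const_mul' _ _ (by finiteness), ENNReal.mul_rpow_of_nonneg _ _ (by positivity),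
      ← ENNReal.rpow_mul, mul_one_div_cancel hp.ne', ENNReal.rpow_one]
  have hle : K.sobolevNorm s p (a • T) ≤ 1 := by
    rw [hnorm, hae]
    refine (mul_le_mul' le_rfl hN).trans ?_
    rw [ENNReal.inv_mul_cancel hA0 ENNReal.ofReal_ne_top]
  have hmem : a • T ∈ K.sobolevCube d s p := by
    refine ⟨hle.trans_lt ENNReal.one_lt_top, fun x hx => hT.2 ?_⟩
    by_contra hxT
    obtain ⟨u, hu, hu'⟩ := (Distribution.notMem_dsupport_iff x).1 hxT
    refine (Distribution.notMem_dsupport_iff x).2 ⟨u, fun φ hφ => ?_, hu'⟩ hx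
    change a * T φ = 0
    rw [hu φ hφ, mul_zero]
  have hrep : IsRepresentedBy (a • T) (a • f) := fun φ => by
    change a * T φ = ∫ x, φ x * (a * f x)
    rw [hf φ, ← integral_const_mul]
    refine integral_congr_ae (.of_forall fun x => ?_)
    dsimp only
    ring
  have h1 : ‖(∫ x in closedCube d, (a • f) x) - cubature d n (a • f)‖ₑ ≤
      worstCaseError n (K.sobolevCube d s p) (K.sobolevNorm s p) :=
    le_iSup₂_of_le (a • T) (a • f) (le_iSup₂_of_le hmem hle (le_iSup_of_le hrep le_rfl))
  have h2 : (∫ x in closedCube d, (a • f) x) - cubature d n (a • f) =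
      a * ((∫ x in closedCube d, f x) - cubature d n f) := by
    have h3 : cubature d n (a • f) = a * cubature d n f := by
      change 1 / (n : ℂ) * ∑ᶠ x ∈ lattice d n ∩ halfOpenCube d, a • f x = _
      simp_rw [← smul_finsum]
      rw [cubature, smul_eq_mul, mul_left_comm]
    rw [h3, mul_sub, ← integral_const_mul]
    rfl
  rw [h2, enorm_mul, hae] at h1
  refine le_trans (le_of_eq ?_) (mul_le_mul' le_rfl h1)
  rw [← mul_assoc, ENNReal.mul_inv_cancel hA0 ENNReal.ofReal_ne_top, one_mul]

/-- With S shapes, the error of the fooling function is of order S and its norm at most of order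
2^(sM) √S. The ratio 2^(-sM) √S has the asserted order, since 2^M is comparable to n and S is at
least of order M^(d-1). -/
theorem exists_le_worstCaseError (hd : 1 ≤ d) {s p : ℝ} (hp : 1 < p) (hs : 1 / p < s)
    (hL : s < L + 1) : ∃ c : ℝ, 0 < c ∧ ∀ n : ℕ, 2 ≤ n →
      ENNReal.ofReal (c * ((n : ℝ) ^ (-s) * Real.log n ^ (((d : ℝ) - 1) / 2))) ≤
        worstCaseError n (K.sobolevCube d s p) (K.sobolevNorm s p) := by
  have hp0 : 0 < p := by linarith
  have hs0 : 0 < s := lt_trans (by positivity) hs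
  have hd0 : (0 : ℝ) < d := by exact_mod_cast hd
  obtain ⟨C, hC, hnorm⟩ := K.exists_sobolevNorm_foolingDistribution_le d hp0 hs0 hL
  obtain ⟨c₀, hc₀, hzero⟩ := exists_forall_tensorAtom_latticePoint_eq_zero hd
  set c₁ := min c₀ 1 with hc₁
  have hc₁0 : 0 < c₁ := lt_min hc₀ one_pos
  have hβ := pow_pos atomMass_pos d
  refine ⟨atomMass ^ d * C⁻¹ * (2 / c₁) ^ (-s) * ((d : ℝ)⁻¹ ^ (((d : ℝ) - 1) / 2)), by positivity,
    fun n hn => ?_⟩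
  have hn0 : (0 : ℝ) < n := by exact_mod_cast (by omega : 0 < n)
  have hn1 : (1 : ℝ) ≤ n := by exact_mod_cast (by omega : 1 ≤ n)
  have hx : 1 ≤ (n : ℝ) / c₁ := by
    rw [le_div_iff₀ hc₁0, one_mul]
    exact (min_le_right _ _).trans hn1
  -- M = N + 1 satisfies n < c₁ 2^M and 2^M ≤ 2n/c₁. Here c₁ ≤ c₀ provides a corner free of lattice
  -- points in each box, and c₁ ≤ 1 gives n < 2^M, hence log n ≤ M.
  obtain ⟨N, hN1, hN2⟩ := exists_nat_pow_near hx (one_lt_two (α := ℝ))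
  set M := N + 1 with hM
  have hM1 : (2 : ℝ) ^ M ≤ 2 / c₁ * n := by
    rw [hM, pow_succ]
    calc (2 : ℝ) ^ N * 2 ≤ n / c₁ * 2 := by linarith
      _ = _ := by ring
  rw [div_lt_iff₀ hc₁0, mul_comm] at hN2
  have hM2 : (n : ℝ) < c₀ * 2 ^ M :=
    hN2.trans_le (mul_le_mul_of_nonneg_right (min_le_left _ _) (by positivity))
  have hM3 : (n : ℝ) < 2 ^ M :=
    hN2.trans_le (mul_le_of_le_one_left (by positivity) (min_le_right _ _))
  choose! σ hσ using hzero n M (by omega) hM2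
  set S : ℝ := ((levelSet d M).card : ℝ) with hS
  have hcount : ((M / d + 1 : ℕ) : ℝ) ^ (d - 1) ≤ S := by
    rw [hS]
    exact_mod_cast pow_le_card_levelSet hd M
  have hS0 : 0 < S := lt_of_lt_of_le (by positivity) hcount
  have hA : 0 < C * (2 ^ (s * M) * Real.sqrt S) := by positivity
  have hT : foolingDistribution σ M ∈ K.sobolevCube d s p :=
    ⟨(hnorm σ M).trans_lt ENNReal.ofReal_lt_top, dsupport_foolingDistribution_subset σ M⟩
  have h1 := K.enorm_le_mul_worstCaseError hp0 hT (isRepresentedBy_foolingDistribution σ M) hA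
    (hnorm σ M) n
  have h2 : (∫ x in closedCube d, (foolingSchwartz σ M).toBoundedContinuousFunction x) -
      cubature d n (foolingSchwartz σ M).toBoundedContinuousFunction =
        ((atomMass ^ d * S : ℝ) : ℂ) := by
    change (∫ x in closedCube d, fooling σ M x) - cubature d n (fooling σ M) = _
    rw [setIntegral_fooling, cubature_fooling σ M hd (by omega) fun m j hm => hσ m j hm, sub_zero]
  rw [h2, ← ofReal_norm, Complex.norm_real, Real.norm_of_nonneg (by positivity)] at h1
  have h3 : ENNReal.ofReal (atomMass ^ d * S / (C * (2 ^ (s * M) * Real.sqrt S))) ≤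
      worstCaseError n (K.sobolevCube d s p) (K.sobolevNorm s p) := by
    rw [ENNReal.ofReal_div_of_pos hA]
    exact ENNReal.div_le_of_le_mul' h1
  refine (ENNReal.ofReal_le_ofReal ?_).trans h3
  have hlog0 : 0 ≤ Real.log n := Real.log_nonneg hn1
  have hlogM : Real.log n ≤ M := by
    have h4 := Real.log_le_log hn0 hM3.le
    rw [Real.log_pow] at h4
    have h5 : Real.log 2 ≤ 1 := by linarith [Real.log_two_lt_d9]
    nlinarith [Nat.cast_nonneg (α := ℝ) M]
  have hdiv : (d : ℝ)⁻¹ * Real.log n ≤ ((M / d + 1 : ℕ) : ℝ) := by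
    rw [inv_mul_le_iff₀ hd0]
    refine hlogM.trans ?_
    exact_mod_cast (Nat.lt_mul_div_succ M (by omega : 0 < d)).le
  have hroot : (d : ℝ)⁻¹ ^ (((d : ℝ) - 1) / 2) * Real.log n ^ (((d : ℝ) - 1) / 2) ≤ Real.sqrt S := by
    have he : (((d - 1 : ℕ) : ℝ)) = (d : ℝ) - 1 := by rw [Nat.cast_sub hd, Nat.cast_one]
    rw [← Real.mul_rpow (by positivity) hlog0, Real.sqrt_eq_rpow, div_eq_mul_one_div, Real.rpow_mul
      (by positivity), ← he, Real.rpow_natCast]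
    exact Real.rpow_le_rpow (by positivity)
      ((pow_le_pow_left₀ (by positivity) hdiv _).trans hcount) (by norm_num)
  have hpow : (2 / c₁) ^ (-s) * (n : ℝ) ^ (-s) ≤ (2 ^ (s * M))⁻¹ := by
    rw [← Real.mul_rpow (by positivity) hn0.le, mul_comm s, Real.rpow_mul (by norm_num),
      Real.rpow_natCast, ← Real.rpow_neg (by positivity)]
    exact Real.rpow_le_rpow_of_nonpos (by positivity) hM1 (by linarith)
  calc atomMass ^ d * C⁻¹ * (2 / c₁) ^ (-s) * ((d : ℝ)⁻¹ ^ (((d : ℝ) - 1) / 2)) *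
        ((n : ℝ) ^ (-s) * Real.log n ^ (((d : ℝ) - 1) / 2))
      = atomMass ^ d * C⁻¹ * (((2 / c₁) ^ (-s) * (n : ℝ) ^ (-s)) *
          ((d : ℝ)⁻¹ ^ (((d : ℝ) - 1) / 2) * Real.log n ^ (((d : ℝ) - 1) / 2))) := by ring
    _ ≤ atomMass ^ d * C⁻¹ * ((2 ^ (s * M))⁻¹ * Real.sqrt S) :=
        mul_le_mul_of_nonneg_left (mul_le_mul hpow hroot (by positivity) (by positivity))
          (by positivity)
    _ = atomMass ^ d * S / (C * (2 ^ (s * M) * Real.sqrt S)) := by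
        have h6 : Real.sqrt S * Real.sqrt S = S := Real.mul_self_sqrt hS0.le
        have h7 : 0 < Real.sqrt S := Real.sqrt_pos.2 hS0
        rw [eq_div_iff hA.ne']
        have h8 : (2 : ℝ) ^ (s * M) ≠ 0 := by positivity
        field_simp
        linarith

end LocalMeans

end Frolov

end

theorem corollary5p3 (d : ℕ) (hd : 1 ≤ d) (p s : ℝ) (hp : 1 < p) (hs : 1 / p < s)
    (L : ℕ) (hL : s < (L : ℝ) + 1) (K : Frolov.LocalMeans L) :
    -- the elements of the space are continuous functions
    (∀ T ∈ K.sobolevCube d s p, ∃ f : Frolov.Space d →ᵇ ℂ, Frolov.IsRepresentedBy T f) ∧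
    (1 / 2 < s → ∃ c C : ℝ, 0 < c ∧ 0 < C ∧ ∀ n : ℕ, 2 ≤ n →
      ENNReal.ofReal (c * ((n : ℝ) ^ (-s) * Real.log n ^ (((d : ℝ) - 1) / 2))) ≤
        Frolov.worstCaseError n (K.sobolevCube d s p) (K.sobolevNorm s p) ∧
      Frolov.worstCaseError n (K.sobolevCube d s p) (K.sobolevNorm s p) ≤
        ENNReal.ofReal (C * ((n : ℝ) ^ (-s) * Real.log n ^ (((d : ℝ) - 1) / 2)))) ∧
    (s < 1 / 2 → ∃ C : ℝ, 0 < C ∧ ∀ n : ℕ, 2 ≤ n →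
      Frolov.worstCaseError n (K.sobolevCube d s p) (K.sobolevNorm s p) ≤
        ENNReal.ofReal (C * ((n : ℝ) ^ (-s) * Real.log n ^ (((d : ℝ) - 1) * (1 - s))))) ∧
    (s = 1 / 2 → ∃ C : ℝ, 0 < C ∧ ∀ n : ℕ, 3 ≤ n →
      Frolov.worstCaseError n (K.sobolevCube d s p) (K.sobolevNorm s p) ≤
        ENNReal.ofReal (C * ((n : ℝ) ^ (-s) * Real.log n ^ (((d : ℝ) - 1) / 2) *
          Real.sqrt (Real.log (Real.log n))))) := by
  refine ⟨fun T hT => ?_, fun h => ?_, fun h => ?_, fun h => ?_⟩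
  · obtain ⟨f, hf, -⟩ := K.exists_isRepresentedBy hp hs hT
    exact ⟨f, hf⟩
  · obtain ⟨c, hc, hcn⟩ := K.exists_le_worstCaseError hd hp hs hL
    obtain ⟨C, hC, hCn⟩ := K.exists_worstCaseError_le_of_half_lt hd hp hs h
    exact ⟨c, C, hc, hC, fun n hn => ⟨hcn n hn, hCn n hn⟩⟩
  · exact K.exists_worstCaseError_le_of_lt_half hd hp hs h
  · exact K.exists_worstCaseError_le_of_eq_half hd hp hs h
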